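/- Let $\mathcal O$ be a complete discrete valuation ring with fraction field $K$ and perfect residue field $k$, and let $X$ be a smooth projective $K$-variety (irreducibility is not needed). A *regular snc model* of $X$ is a regular projective flat $\mathcal O$-scheme $\mathcal X$ together with an identification of its generic fiber with $X$, whose special fiber $\mathcal X_k$ is a (not necessarily reduced) simple normal crossing divisor in $\mathcal X$. Assume: 1. (Desingularization) $X$ has a regular snc model. 2. (Weak factorization) Any two regular snc models $\mathcal X,\mathcal X'$ of $X$ are joined by a finite chain $\mathcal X=\mathcal X_0,\mathcal X_1,\dots,\mathcal X_n=\mathcal X'$ of regular snc models of $X$ such that for every $i$ one of $\mathcal X_i,\mathcal X_{i+1}$ is the blowup of the other, compatibly with the identifications of the generic fibers with $X$, along a regular center $Z$ contained in the special fiber and having normal crossings with it. Normal crossings means: at every closed point $x$ of the special fiber there is a regular system of parameters $x_1,\dots,x_d$ such that near $x$ the support of the special fiber is the zero locus of $\prod_{v\in V}x_v$ for some $V\subset\{1,\dots,d\}$ and, if $x\in Z$, such that near $x$ the center $Z$ is the common zero locus of the $x_w$, $w\in W$, for some $W\subset\{1,\dots,d\}$. Let $K_0(\mathrm{Var}_k)$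 be the Grothendieck ring of $k$-varieties, $\mathbb L=[\mathbb A^1_k]$ and $K_0(\mathrm{Var}_k)_{\mathbb Q}=K_0(\mathrm{Var}_k)\otimes_{\mathbb Z}\mathbb Q$. For a regular snc model $\mathcal X$ write $\mathcal X_k=\sum_{i\in I}a_iD_i$ with $D_i$ the irreducible components and $a_i$ their multiplicities, put $D_H^\circ=\bigcap_{h\in H}D_h\setminus\bigcup_{i\in I\setminus H}D_i$ for $H\subset I$, $D_i^\circ=D_{\{i\}}^\circ$, $D_{ij}^\circ=D_{\{i,j\}}^\circ$, and $$\tilde S(\mathcal X)=\sum_{i\in I,\ a_i=1}[D_i^\circ]+\sum_{\substack{\{i,j\}\subset I,\ i\neq j\\ \gcd(a_i,a_j)=1}}\frac1{a_ia_j}[D_{ij}^\circ](1-\mathbb L)\ \in\ K_0(\mathrm{Var}_k)_{\mathbb Q}/(\mathbb L-1)^2 .$$ Then $\tilde S(\mathcal X)$ does not depend on the choice of the regular snc model $\mathcal X$: there is a unique element $\tilde S(X)\in K_0(\mathrm{Var}_k)_{\mathbb Q}/(\mathbb L-1)^2$ with $\tilde S(\mathcal X)=\tilde S(X)$ for all regular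 snc models $\mathcal X$ of $X$. Moreover $\tilde S(X)$ lifts the motivic Serre invariant of Loeser and Sebag: for every regular snc model $\mathcal X$ of $X$, the image of $\tilde S(\mathcal X)$ in $K_0(\mathrm{Var}_k)_{\mathbb Q}/(\mathbb L-1)$ is the image of $S(X)=[\mathcal X_{\mathrm{sm},k}]\in K_0(\mathrm{Var}_k)/(\mathbb L-1)$, where $\mathcal X_{\mathrm{sm}}$ is the $\mathcal O$-smooth locus of $\mathcal X$ (a weak Néron model of $X$) and $\mathcal X_{\mathrm{sm},k}$ its special fiber. -/

import Mathlib

universe u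

open CategoryTheory CategoryTheory.Limits AlgebraicGeometry IsLocalRing

noncomputable section

namespace MotivicSerre

/-! ### Algebraic varieties over a field and their Grothendieck ring -/

/-- A `k`-variety: a separated scheme of finite type over `k`. Neither reducedness nor
irreducibility is required; nilpotents do not matter in the Grothendieck ring. -/
structure AlgVar (k : Type u) [Field k] where
  /-- the underlying scheme -/
  carrier : Scheme.{u}
  /-- the structure morphism -/
  hom : carrier ⟶ Spec (CommRingCat.of k)
  [isSeparated : IsSeparated hom]
  [locallyOfFiniteType : LocallyOfFiniteType hom]
  [quasiCompact : QuasiCompact hom]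

attribute [instance] AlgVar.isSeparated AlgVar.locallyOfFiniteType AlgVar.quasiCompact

section Varieties

variable {k : Type u} [Field k]

instance (W : AlgVar k) : IsNoetherian W.carrier := by
  have : IsLocallyNoetherian W.carrier := LocallyOfFiniteType.isLocallyNoetherian W.hom
  have : CompactSpace W.carrier := QuasiCompact.compactSpace_of_compactSpace W.hom
  exact {}

/-- A subscheme of a variety is a variety. -/
def AlgVar.sub (W : AlgVar k) {Y : Scheme.{u}} (i : Y ⟶ W.carrier) [IsImmersion i] : AlgVar k :=
  have : TopologicalSpace.NoetherianSpace Y := i.isEmbedding.isInducing.noetherianSpace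
  { carrier := Y, hom := i ≫ W.hom }

/-- The fiber product over `k`. -/
def AlgVar.prod (V W : AlgVar k) : AlgVar k where
  carrier := pullback V.hom W.hom
  hom := pullback.fst V.hom W.hom ≫ V.hom

variable (k) in
/-- The one-point variety `Spec k`. -/
def AlgVar.point : AlgVar k where
  carrier := Spec (CommRingCat.of k)
  hom := 𝟙 _

variable (k) in
/-- The affine line over `k`. -/
def AlgVar.affineLine : AlgVar k where
  carrier := AffineSpace PUnit.{u + 1} (Spec (CommRingCat.of k))
  hom := AffineSpace PUnit.{u + 1} (Spec (CommRingCat.of k)) ↘ Spec (CommRingCat.of k)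

variable (k) in
/-- The relations of the Grothendieck ring: invariance under isomorphism, the scissor relation
for a closed subvariety and its open complement, multiplicativity, and the unit. -/
inductive K0Rel : FreeCommRing (AlgVar k) → Prop
  | iso (V W : AlgVar k) (e : V.carrier ≅ W.carrier) (he : e.hom ≫ W.hom = V.hom) :
      K0Rel (.of V - .of W)
  | scissor (W Z U : AlgVar k) (i : Z.carrier ⟶ W.carrier) (j : U.carrier ⟶ W.carrier)
      (hi : IsClosedImmersion i) (hj : IsOpenImmersion j)
      (hiW : i ≫ W.hom = Z.hom) (hjW : j ≫ W.hom = U.hom)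
      (hij : Set.range j = (Set.range i)ᶜ) :
      K0Rel (.of W - .of Z - .of U)
  | mul (V W : AlgVar k) : K0Rel (.of (V.prod W) - .of V * .of W)
  | one : K0Rel (.of (AlgVar.point k) - 1)

variable (k) in
/-- The Grothendieck ring of `k`-varieties. -/
abbrev K0 : Type (u + 1) := FreeCommRing (AlgVar k) ⧸ Ideal.span {r | K0Rel k r}

/-- The class of a variety in the Grothendieck ring. -/
def AlgVar.cls (W : AlgVar k) : K0 k := Ideal.Quotient.mk _ (.of W)

variable (k) in
/-- The class `𝕃` of the affine line. -/
def lefschetz : K0 k := (AlgVar.affineLine k).cls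

variable (k) in
/-- The Grothendieck ring with rational coefficients. -/
abbrev K0Q : Type (u + 1) := TensorProduct ℤ ℚ (K0 k)

variable (k) in
/-- The natural map from the Grothendieck ring to its rationalization. -/
def toK0Q : K0 k →+* K0Q k := Algebra.TensorProduct.includeRight.toRingHom

variable (k) in
/-- The ideal `(𝕃 - 1)` of the Grothendieck ring. -/
abbrev idealL : Ideal (K0 k) := Ideal.span {lefschetz k - 1}

variable (k) in
/-- The ideal `((𝕃 - 1) ^ n)` of the rational Grothendieck ring. -/
abbrev idealLQ (n : ℕ) : Ideal (K0Q k) := Ideal.span {(toK0Q k (lefschetz k) - 1) ^ n}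

variable (k) in
lemma idealLQ_two_le_one : idealLQ k 2 ≤ idealLQ k 1 := by
  rw [Ideal.span_singleton_le_span_singleton]
  exact pow_dvd_pow _ (by norm_num)

variable (k) in
lemma idealL_le_comap : idealL k ≤ (idealLQ k 1).comap (toK0Q k) := by
  rw [Ideal.span_singleton_le_iff_mem, Ideal.mem_comap, map_sub, map_one]
  exact Ideal.subset_span (by simp)

variable (k) in
/-- The natural map `K₀(Var_k)_ℚ / (𝕃 - 1)² → K₀(Var_k)_ℚ / (𝕃 - 1)`. -/
def reduction : (K0Q k ⧸ idealLQ k 2) →+* (K0Q k ⧸ idealLQ k 1) :=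
  Ideal.Quotient.factor (idealLQ_two_le_one k)

variable (k) in
/-- The natural map `K₀(Var_k) / (𝕃 - 1) → K₀(Var_k)_ℚ / (𝕃 - 1)`. -/
def rationalization : (K0 k ⧸ idealL k) →+* (K0Q k ⧸ idealLQ k 1) :=
  Ideal.quotientMap (idealLQ k 1) (toK0Q k) (idealL_le_comap k)

/-- A locally closed subset `C` of a scheme, with its reduced structure: the reduced closed
subscheme with underlying set `C` of the largest open subscheme in which `C` is closed. -/
def locClosedIdeal {X : Scheme.{u}} {C : Set X} (hC : IsLocallyClosed C) :
    (Scheme.Opens.toScheme (X := X) ⟨coborder C, hC.isOpen_coborder⟩).IdealSheafData :=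
  Scheme.IdealSheafData.vanishingIdeal ⟨Subtype.val ⁻¹' C, isClosed_preimage_val_coborder⟩

/-- The locally closed subset `C` of a variety, as a (reduced) variety. -/
def AlgVar.locClosed (W : AlgVar k) {C : Set W.carrier} (hC : IsLocallyClosed C) : AlgVar k :=
  W.sub ((locClosedIdeal hC).subschemeι ≫ Scheme.Opens.ι _)

/-! ### Strata of a variety and their multiplicities -/

/-- The (finite) index set `I` of irreducible components of a variety. -/
abbrev AlgVar.Comp (W : AlgVar k) : Type u := irreducibleComponents W.carrier

instance (W : AlgVar k) : Finite W.Comp :=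
  TopologicalSpace.NoetherianSpace.finite_irreducibleComponents.to_subtype

instance (W : AlgVar k) : Fintype W.Comp := Fintype.ofFinite _

/-- The multiplicity of a component `D` of `W`: the length of the local ring of `W` at the
generic point of `D`. -/
def AlgVar.mult (W : AlgVar k) (D : W.Comp) : ℕ :=
  let R := W.carrier.presheaf.stalk (IsIrreducible.genericPoint D.2.1)
  (Module.length R R).toNat

/-- The stratum `D_H° = ⋂_{h ∈ H} D_h ∖ ⋃_{i ∉ H} D_i`. -/
def AlgVar.stratum (W : AlgVar k) (H : Finset W.Comp) : Set W.carrier :=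
  (⋂ h ∈ H, (h : Set W.carrier)) \ ⋃ i ∈ {i : W.Comp | i ∉ H}, (i : Set W.carrier)

lemma AlgVar.isLocallyClosed_stratum (W : AlgVar k) (H : Finset W.Comp) :
    IsLocallyClosed (W.stratum H) := by
  refine IsLocallyClosed.inter ?_ ?_
  · exact (isClosed_biInter fun h _ ↦ isClosed_of_mem_irreducibleComponents _ h.2).isLocallyClosed
  · exact ((Set.toFinite _).isClosed_biUnion fun i _ ↦
      isClosed_of_mem_irreducibleComponents _ i.2).isOpen_compl.isLocallyClosed

/-- The class `[D_H°]` in the rational Grothendieck ring. -/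
def AlgVar.stratumClass (W : AlgVar k) (H : Finset W.Comp) : K0Q k :=
  toK0Q k (W.locClosed (W.isLocallyClosed_stratum H)).cls

/-- For `W = ∑ a_i D_i`, the class in `K₀(Var_k)_ℚ / (𝕃 - 1)²` of
`∑_{a_i = 1} [D_i°] + ∑_{{i, j} ⊆ I, gcd(a_i, a_j) = 1} (1 / (a_i a_j)) [D_ij°] (1 - 𝕃)`.
The second sum runs over the two-element subsets of the index set. -/
def AlgVar.serreTilde (W : AlgVar k) : K0Q k ⧸ idealLQ k 2 :=
  Ideal.Quotient.mk _
    (∑ i with W.mult i = 1, W.stratumClass {i} +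
      ∑ H ∈ Finset.univ.powersetCard 2 with H.gcd W.mult = 1,
        ((1 : ℚ) / ∏ h ∈ H, (W.mult h : ℚ)) •
          (W.stratumClass H * (1 - toK0Q k (lefschetz k))))

end Varieties

/-! ### Regularity, normal crossings, projectivity, blowups -/

/-- A regular scheme. -/
structure IsRegularScheme (X : Scheme.{u}) : Prop where
  isLocallyNoetherian : IsLocallyNoetherian X
  isRegularLocalRing_stalk (x : X) : IsRegularLocalRing (X.presheaf.stalk x)

/-- `x₁, …, x_d` is a regular system of parameters of the local ring `R`
(such a system exists, for Noetherian `R`, exactly when `R` is regular). -/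
structure IsRegularSystemOfParameters {R : Type u} [CommRing R] [IsLocalRing R] {d : ℕ}
    (x : Fin d → R) : Prop where
  span_range : Ideal.span (Set.range x) = maximalIdeal R
  card_eq : (d : WithBot ℕ∞) = ringKrullDim R

/-- The stalk at `x` of an ideal sheaf, as an ideal of the local ring at `x`. -/
def stalkIdeal {X : Scheme.{u}} (I : X.IdealSheafData) (x : X) : Ideal (X.presheaf.stalk x) :=
  ⨆ (U : X.affineOpens) (hx : x ∈ U.1), (I.ideal U).map (X.presheaf.germ U.1 x hx).hom

/-- The closed subscheme defined by `I` is an effective Cartier divisor: locally, `I` is generated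
by one nonzerodivisor. -/
def IsEffectiveCartier {X : Scheme.{u}} (I : X.IdealSheafData) : Prop :=
  ∀ x : X, ∃ U : X.affineOpens, x ∈ U.1 ∧
    ∃ a ∈ nonZeroDivisors Γ(X, U.1), I.ideal U = Ideal.span {a}

/-- `f : Y ⟶ X` is the blowup of `X` along the closed subscheme defined by `I`: it is the
universal morphism to `X` that pulls this closed subscheme back to an effective Cartier divisor. -/
structure IsBlowup {X Y : Scheme.{u}} (f : Y ⟶ X) (I : X.IdealSheafData) : Prop where
  isEffectiveCartier : IsEffectiveCartier (I.comap f)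
  existsUnique_lift (T : Scheme.{u}) (g : T ⟶ X) (hg : IsEffectiveCartier (I.comap g)) :
    ∃! h : T ⟶ Y, h ≫ f = g

attribute [local instance] MvPolynomial.gradedAlgebra

/-- Projective `n`-space over an affine base. -/
abbrev projectiveSpace (R : Type u) [CommRing R] (n : ℕ) : Scheme.{u} :=
  Proj (MvPolynomial.homogeneousSubmodule (Fin (n + 1)) R)

/-- The structure morphism of projective `n`-space. -/
def projectiveSpaceHom (R : Type u) [CommRing R] (n : ℕ) :
    projectiveSpace R n ⟶ Spec (CommRingCat.of R) :=
  Proj.toSpecZero (MvPolynomial.homogeneousSubmodule (Fin (n + 1)) R) ≫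
    Spec.map (CommRingCat.ofHom
      (algebraMap R (MvPolynomial.homogeneousSubmodule (Fin (n + 1)) R 0)))

/-- A scheme over an affine base is projective if it is a closed subscheme of some projective
space. -/
def IsProjective {R : Type u} [CommRing R] {X : Scheme.{u}}
    (f : X ⟶ Spec (CommRingCat.of R)) : Prop :=
  ∃ (n : ℕ) (i : X ⟶ projectiveSpace R n), IsClosedImmersion i ∧ i ≫ projectiveSpaceHom R n = f

instance (R : Type u) [CommRing R] (n : ℕ) : IsProper (projectiveSpaceHom R n) := by
  let 𝒜 := MvPolynomial.homogeneousSubmodule (Fin (n + 1)) R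
  have hsurj : Function.Surjective (algebraMap R (𝒜 0)) := by
    rintro ⟨p, hp⟩
    have hp' : p.totalDegree = 0 := by
      rw [MvPolynomial.mem_homogeneousSubmodule] at hp
      by_cases h0 : p = 0
      · simp [h0]
      · exact hp.totalDegree h0
    refine ⟨p.coeff 0, Subtype.ext ?_⟩
    exact (MvPolynomial.totalDegree_eq_zero_iff_eq_C.mp hp').symm
  have : IsClosedImmersion (Spec.map (CommRingCat.ofHom (algebraMap R (𝒜 0)))) :=
    IsClosedImmersion.spec_of_surjective _ hsurj
  have : Algebra.FiniteType (𝒜 0) (MvPolynomial (Fin (n + 1)) R) :=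
    have : IsScalarTower R (𝒜 0) (MvPolynomial (Fin (n + 1)) R) :=
      ⟨fun r a p ↦ by
        change (r • (a : MvPolynomial (Fin (n + 1)) R)) * p = r • ((a : MvPolynomial _ R) * p)
        exact smul_mul_assoc _ _ _⟩
    Algebra.FiniteType.of_restrictScalars_finiteType R _ _
  unfold projectiveSpaceHom
  infer_instance

lemma IsProjective.isProper {R : Type u} [CommRing R] {X : Scheme.{u}}
    {f : X ⟶ Spec (CommRingCat.of R)} (hf : IsProjective f) : IsProper f := by
  obtain ⟨n, i, hi, rfl⟩ := hf
  infer_instance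

section Models

variable {O : Type u} [CommRing O] [IsLocalRing O]

/-- The ideal of the special fiber in the local ring at `x` of an `O`-scheme: the extension of
the maximal ideal of `O`. -/
def specialFiberIdeal {X : Scheme.{u}} (p : X ⟶ Spec (CommRingCat.of O)) (x : X) :
    Ideal (X.presheaf.stalk x) :=
  (maximalIdeal O).map ((Scheme.ΓSpecIso (CommRingCat.of O)).inv ≫ p.appTop ≫
    X.presheaf.germ ⊤ x trivial).hom

/-- The special fiber `X_k = ∑ a_i D_i` is a simple normal crossing divisor: at each of its
points `x` there is a regular system of parameters `x₁, …, x_d` of the (Zariski) local ring such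
that `X_k` is cut out by `∏ x_v ^ a_v`, for some exponents `a_v ≥ 0`. -/
def SpecialFiberIsSnc {X : Scheme.{u}} (p : X ⟶ Spec (CommRingCat.of O)) : Prop :=
  ∀ x : X, p x = closedPoint O →
    ∃ (d : ℕ) (t : Fin d → X.presheaf.stalk x) (a : Fin d → ℕ),
      IsRegularSystemOfParameters t ∧
      specialFiberIdeal p x = Ideal.span {∏ v, t v ^ a v}

/-- The closed subscheme `Z` defined by `I` has normal crossings with the special fiber: at each
closed point `x` of the special fiber there is a regular system of parameters `x₁, …, x_d` such
that the special fiber is locally cut out by `∏ x_v ^ a_v` (so that its support is the zero locus of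
`∏ x_v` over the set `V` of those `v` with `a_v > 0`), and, if `x` lies on `Z`, such that `Z` is
locally cut out by the `x_w` with `w ∈ W`, for some `W ⊆ {1, …, d}`. -/
def HasNormalCrossings {X : Scheme.{u}} (p : X ⟶ Spec (CommRingCat.of O))
    (I : X.IdealSheafData) : Prop :=
  ∀ x : X, IsClosed {x} → p x = closedPoint O →
    ∃ (d : ℕ) (t : Fin d → X.presheaf.stalk x),
      IsRegularSystemOfParameters t ∧
      (∃ a : Fin d → ℕ, specialFiberIdeal p x = Ideal.span {∏ v, t v ^ a v}) ∧
      (x ∈ I.support → ∃ W : Set (Fin d), stalkIdeal I x = Ideal.span (t '' W))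

variable (O) in
/-- A regular snc model over `O` of a scheme `X` over `K`: a regular projective flat `O`-scheme,
with an identification of its generic fiber with `X`, whose special fiber is a simple normal
crossing divisor. -/
structure RegularSncModel {K : Type u} [Field K] [Algebra O K] {X : Scheme.{u}}
    (f : X ⟶ Spec (CommRingCat.of K)) where
  /-- the total space -/
  carrier : Scheme.{u}
  /-- the structure morphism -/
  hom : carrier ⟶ Spec (CommRingCat.of O)
  /-- the inclusion of the generic fiber -/
  generic : X ⟶ carrier
  isPullback : IsPullback generic f hom (Spec.map (CommRingCat.ofHom (algebraMap O K)))
  isRegular : IsRegularScheme carrier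
  isProjective : IsProjective hom
  flat : Flat hom
  snc : SpecialFiberIsSnc hom

namespace RegularSncModel

variable {K : Type u} [Field K] [Algebra O K] {X : Scheme.{u}} {f : X ⟶ Spec (CommRingCat.of K)}

instance (𝒳 : RegularSncModel O f) : IsProper 𝒳.hom := 𝒳.isProjective.isProper

/-- `𝒴` is the blowup of `𝒳`, compatibly with the identifications of the generic fibers with
`X`, along a regular center that is contained in the special fiber and has normal crossings with
it. -/
def IsBlowupOf (𝒴 𝒳 : RegularSncModel O f) : Prop :=
  ∃ (b : 𝒴.carrier ⟶ 𝒳.carrier) (I : 𝒳.carrier.IdealSheafData),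
    b ≫ 𝒳.hom = 𝒴.hom ∧ 𝒴.generic ≫ b = 𝒳.generic ∧
    IsBlowup b I ∧ IsRegularScheme I.subscheme ∧
    (∀ z ∈ I.support, 𝒳.hom z = closedPoint O) ∧ HasNormalCrossings 𝒳.hom I

/-- The special fiber `𝒳_k`, as a variety over the residue field `k`. -/
def specialFiber (𝒳 : RegularSncModel O f) : AlgVar (ResidueField O) where
  carrier := pullback 𝒳.hom (Spec.map (CommRingCat.ofHom (residue O)))
  hom := pullback.snd 𝒳.hom (Spec.map (CommRingCat.ofHom (residue O)))

/-- The inclusion of the special fiber. -/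
def specialFiberι (𝒳 : RegularSncModel O f) : 𝒳.specialFiber.carrier ⟶ 𝒳.carrier :=
  pullback.fst 𝒳.hom (Spec.map (CommRingCat.ofHom (residue O)))

/-- The element `S̃(𝒳)` of `K₀(Var_k)_ℚ / (𝕃 - 1)²`. -/
def serreTilde (𝒳 : RegularSncModel O f) :
    K0Q (ResidueField O) ⧸ idealLQ (ResidueField O) 2 :=
  𝒳.specialFiber.serreTilde

/-- The special fiber `𝒳_{sm,k}` of the `O`-smooth locus of `𝒳`. -/
def smoothSpecialFiber [IsNoetherianRing O] (𝒳 : RegularSncModel O f) :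
    AlgVar (ResidueField O) :=
  𝒳.specialFiber.sub (𝒳.specialFiberι ⁻¹ᵁ 𝒳.hom.smoothLocus).ι

/-- The motivic Serre invariant `[𝒳_{sm,k}]` in `K₀(Var_k) / (𝕃 - 1)`, computed with the weak Néron
model `𝒳_sm` of `X`. -/
def serre [IsNoetherianRing O] (𝒳 : RegularSncModel O f) :
    K0 (ResidueField O) ⧸ idealL (ResidueField O) :=
  Ideal.Quotient.mk _ 𝒳.smoothSpecialFiber.cls

end RegularSncModel

end Models

end MotivicSerre

end

noncomputable section

namespace MotivicSerre

/-! ### Classes of locally closed subsets in the Grothendieck ring -/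

section GrothendieckRing

variable {k : Type u} [Field k]

/-! The invariant is a sum over points. To a point of the special fiber belongs the multiset of
multiplicities of the components through it. Its `weight` is 1 for `{1}`, is (1/(ab))(1 - 𝕃) for a
coprime pair `{a, b}`, and is 0 otherwise. Summing weight times class over the strata gives the
contribution `AlgVar.contr`, and S̃ is the contribution of the whole special fiber
(`AlgVar.serreTilde_eq_contr`). Contributions are additive for decompositions into a closed and an
open part.

Weak factorization leaves a single blowup to be treated. By Noetherian induction
(`locallyClosed_induction`) it is enough to compare a small affine piece Spec D of an irreducible
closed subset with its preimage. Around it the special fiber is the divisor of ∏ tᵢ^aᵢ, all tᵢ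
vanish on Spec D, and the center is either empty or cut out by the tᵢ with i ∈ W. In the second case
the preimage is a trivial projective bundle, which is cut into tori by the set G ⊆ W of nonzero
homogeneous coordinates. The torus of G contributes (𝕃 - 1)^(|G| - 1)[Spec D]. It lies on the
exceptional divisor, of multiplicity ∑_W aᵢ, and on the strict transforms with i ∉ G and aᵢ ≠ 0.
Invariance thus becomes the identity `sum_weight` modulo (𝕃 - 1)². If exactly two components contain
the center and no other passes through the piece, it says 1/(a(a+b)) + 1/(b(a+b)) = 1/(ab), together
with gcd(a+b, a) = gcd(a, b). If exactly one component i contains the center, the terms of G and G ∪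
{i} cancel. With three or more, every term vanishes. At least one exists because the center lies in
the special fiber.

The charts of the blowup are the spectra of A[Xᵢ]/(tᵢ - t_w Xᵢ), and they are identified with open
subschemes by the universal property alone (`IsBlowup.isOpenImmersion_chart`). `IsPrimeFamily` plays
the role of a regular system of parameters in rings that are not local; it passes to the charts
(`IsPrimeFamily.chartCoord`) and determines multiplicities (`RegularSncModel.mults_eq`).

Modulo 𝕃 - 1 only the points with multiset `{1}` count. By the normal crossings condition these are
the points where a uniformizer lies outside 𝔪². Since the model is regular and the residue field
perfect, a Jacobian criterion (`formallySmooth_iff_uniformizer_notMem_sq`) shows that they are the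
smooth points. -/

lemma AlgVar.cls_scissor (W Z U : AlgVar k) (i : Z.carrier ⟶ W.carrier) (j : U.carrier ⟶ W.carrier)
    (hi : IsClosedImmersion i) (hj : IsOpenImmersion j)
    (hiW : i ≫ W.hom = Z.hom) (hjW : j ≫ W.hom = U.hom)
    (hij : Set.range j = (Set.range i)ᶜ) : W.cls = Z.cls + U.cls := by
  have : (Ideal.Quotient.mk (Ideal.span {r | K0Rel k r})) (.of W - .of Z - .of U) = 0 :=
    Ideal.Quotient.eq_zero_iff_mem.mpr
      (Ideal.subset_span (K0Rel.scissor W Z U i j hi hj hiW hjW hij))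
  rw [map_sub, map_sub, sub_sub, sub_eq_zero] at this
  exact this

lemma AlgVar.cls_prod (V W : AlgVar k) : (V.prod W).cls = V.cls * W.cls := by
  have : (Ideal.Quotient.mk (Ideal.span {r | K0Rel k r})) (.of (V.prod W) - .of V * .of W) = 0 :=
    Ideal.Quotient.eq_zero_iff_mem.mpr (Ideal.subset_span (K0Rel.mul V W))
  rw [map_sub, map_mul, sub_eq_zero] at this
  exact this

variable (k) in
/-- The empty variety. -/
def AlgVar.empty : AlgVar k where
  carrier := ∅
  hom := Scheme.emptyTo _

/-- An empty variety is both the closed and the open part of itself, so the scissor relation reads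
[W] = [W] + [W]. -/
lemma AlgVar.cls_eq_zero (W : AlgVar k) [IsEmpty W.carrier] : W.cls = 0 := by
  have h := W.cls_scissor W W (𝟙 _) (𝟙 _) inferInstance inferInstance (by simp) (by simp)
    (by ext x; exact isEmptyElim x)
  simpa using h

/-- A surjective closed immersion does not change the class. -/
lemma AlgVar.cls_eq_of_surjective_immersion (V W : AlgVar k) (i : V.carrier ⟶ W.carrier)
    (_ : IsImmersion i) (hi : Function.Surjective i) (hiW : i ≫ W.hom = V.hom) : W.cls = V.cls := by
  have _ : IsEmpty (AlgVar.empty k).carrier := inferInstanceAs (IsEmpty (∅ : Scheme.{u}))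
  have : IsClosedImmersion i := by
    refine IsClosedImmersion.of_isPreimmersion i ?_
    rw [hi.range_eq]; exact isClosed_univ
  have h := W.cls_scissor V (AlgVar.empty k) i (Scheme.emptyTo _) this
    (inferInstanceAs (IsOpenImmersion (Scheme.emptyTo W.carrier))) hiW
    (Scheme.empty_ext _ _) (by
      rw [hi.range_eq, Set.compl_univ]
      ext x; simp only [Set.mem_range, Set.mem_empty_iff_false, iff_false, not_exists]
      exact fun y ↦ isEmptyElim (α := (AlgVar.empty k).carrier) y)
  rw [h, (AlgVar.empty k).cls_eq_zero, add_zero]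

/-- The class of a subvariety only depends on its underlying set. -/
lemma AlgVar.cls_eq_of_range_eq (V V' : AlgVar k) {X : Scheme.{u}} (p : X ⟶ Spec (.of k))
    (i : V.carrier ⟶ X) (j : V'.carrier ⟶ X) [IsImmersion i] [IsImmersion j]
    (hi : i ≫ p = V.hom) (hj : j ≫ p = V'.hom) (h : Set.range i = Set.range j) :
    V.cls = V'.cls := by
  -- The fiber product over the ambient scheme maps to both subvarieties by surjective immersions,
  -- so both have its class.
  let F : AlgVar k := V.sub (pullback.fst i j)
  have h1 : V.cls = F.cls := by
    refine V.cls_eq_of_surjective_immersion (V := F) (pullback.fst i j)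
      (inferInstanceAs (IsImmersion (pullback.fst i j))) ?_ rfl
    intro x
    have : i x ∈ Set.range j := h ▸ Set.mem_range_self x
    obtain ⟨y, hy⟩ := this
    obtain ⟨z, hz, -⟩ := Scheme.Pullback.exists_preimage_pullback x y hy.symm
    exact ⟨z, hz⟩
  have h2 : V'.cls = F.cls := by
    refine V'.cls_eq_of_surjective_immersion (V := F) (pullback.snd i j)
      (inferInstanceAs (IsImmersion (pullback.snd i j))) ?_ ?_
    · intro x
      have : j x ∈ Set.range i := h ▸ Set.mem_range_self x
      obtain ⟨y, hy⟩ := this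
      obtain ⟨z, -, hz⟩ := Scheme.Pullback.exists_preimage_pullback y x hy
      exact ⟨z, hz⟩
    · change pullback.snd i j ≫ V'.hom = pullback.fst i j ≫ V.hom
      rw [← hi, ← hj, pullback.condition_assoc]
  rw [h1, h2]

/-- The inclusion of a locally closed subset. -/
def AlgVar.locClosedι (W : AlgVar k) {C : Set W.carrier} (hC : IsLocallyClosed C) :
    (W.locClosed hC).carrier ⟶ W.carrier :=
  (locClosedIdeal hC).subschemeι ≫ Scheme.Opens.ι _

instance (W : AlgVar k) {C : Set W.carrier} (hC : IsLocallyClosed C) :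
    IsImmersion (W.locClosedι hC) :=
  inferInstanceAs (IsImmersion ((locClosedIdeal hC).subschemeι ≫ Scheme.Opens.ι _))

lemma AlgVar.locClosedι_hom (W : AlgVar k) {C : Set W.carrier} (hC : IsLocallyClosed C) :
    W.locClosedι hC ≫ W.hom = (W.locClosed hC).hom := rfl

lemma AlgVar.range_locClosedι (W : AlgVar k) {C : Set W.carrier} (hC : IsLocallyClosed C) :
    Set.range (W.locClosedι hC) = C := by
  change Set.range ((locClosedIdeal hC).subschemeι ≫ Scheme.Opens.ι _) = C
  rw [Scheme.Hom.comp_base, TopCat.coe_comp, Set.range_comp,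
    Scheme.IdealSheafData.range_subschemeι]
  simp only [locClosedIdeal, Scheme.IdealSheafData.coe_support_vanishingIdeal]
  change Subtype.val '' (Subtype.val ⁻¹' C) = C
  exact (Subtype.image_preimage_coe (coborder C) C).trans
    (Set.inter_eq_right.mpr subset_coborder)

open Classical in
/-- The class of a locally closed subset of a variety (and `0` for other subsets). -/
def AlgVar.setCls (W : AlgVar k) (C : Set W.carrier) : K0 k :=
  if hC : IsLocallyClosed C then (W.locClosed hC).cls else 0

lemma AlgVar.setCls_of_isLocallyClosed (W : AlgVar k) {C : Set W.carrier}
    (hC : IsLocallyClosed C) : W.setCls C = (W.locClosed hC).cls := dif_pos hC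

lemma AlgVar.setCls_range (V W : AlgVar k) (i : V.carrier ⟶ W.carrier) (_ : IsImmersion i)
    (hi : i ≫ W.hom = V.hom) : W.setCls (Set.range i) = V.cls := by
  have hC : IsLocallyClosed (Set.range i) := i.isLocallyClosed_range
  rw [W.setCls_of_isLocallyClosed hC]
  exact AlgVar.cls_eq_of_range_eq _ _ W.hom (W.locClosedι hC) i (W.locClosedι_hom hC) hi
    (W.range_locClosedι hC)

lemma AlgVar.setCls_image (V W : AlgVar k) (i : V.carrier ⟶ W.carrier) (_ : IsImmersion i)
    (hi : i ≫ W.hom = V.hom) {S : Set V.carrier} (hS : IsLocallyClosed S) :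
    W.setCls (i '' S) = V.setCls S := by
  rw [V.setCls_of_isLocallyClosed hS]
  have := AlgVar.setCls_range (V.locClosed hS) W (V.locClosedι hS ≫ i) inferInstance
    (by rw [Category.assoc, hi, V.locClosedι_hom])
  rw [← this, Scheme.Hom.comp_base, TopCat.coe_comp, Set.range_comp, V.range_locClosedι]

lemma AlgVar.setCls_univ (W : AlgVar k) : W.setCls Set.univ = W.cls := by
  have := W.setCls_range W (𝟙 _) inferInstance (by simp)
  rwa [show Set.range (𝟙 W.carrier : W.carrier ⟶ W.carrier) = Set.univ from
    Set.range_eq_univ.mpr fun x ↦ ⟨x, rfl⟩] at this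

lemma AlgVar.setCls_empty (W : AlgVar k) : W.setCls ∅ = 0 := by
  have hC : IsLocallyClosed (∅ : Set W.carrier) := isClosed_empty.isLocallyClosed
  rw [W.setCls_of_isLocallyClosed hC]
  have : IsEmpty (W.locClosed hC).carrier :=
    Set.range_eq_empty_iff.mp (W.range_locClosedι hC)
  exact AlgVar.cls_eq_zero _

lemma AlgVar.setCls_univ_closed_open (W : AlgVar k) {F : Set W.carrier} (hF : IsClosed F) :
    W.cls = W.setCls F + W.setCls Fᶜ := by
  let U : W.carrier.Opens := ⟨Fᶜ, hF.isOpen_compl⟩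
  have hUr : Set.range U.ι = Fᶜ := by rw [Scheme.Opens.range_ι]; rfl
  have h2 : W.setCls Fᶜ = (W.sub U.ι).cls := by
    rw [← AlgVar.setCls_range (W.sub U.ι) W U.ι (inferInstanceAs (IsImmersion U.ι)) rfl]
    congr 1
    exact hUr.symm
  have : IsClosedImmersion (W.locClosedι hF.isLocallyClosed) :=
    IsClosedImmersion.of_isPreimmersion _ (by rwa [W.range_locClosedι])
  rw [h2, W.setCls_of_isLocallyClosed hF.isLocallyClosed]
  refine W.cls_scissor _ (W.sub U.ι) (W.locClosedι hF.isLocallyClosed) U.ι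
    this (inferInstanceAs (IsOpenImmersion U.ι)) rfl rfl ?_
  rw [W.range_locClosedι]; exact hUr

/-- This is the scissor relation on the variety carried by `C`, transported back to `W`. -/
lemma AlgVar.setCls_closed_open (W : AlgVar k) {C F : Set W.carrier} (hC : IsLocallyClosed C)
    (hF : IsClosed F) : W.setCls C = W.setCls (C ∩ F) + W.setCls (C ∩ Fᶜ) := by
  have hF' : IsClosed (W.locClosedι hC ⁻¹' F) := hF.preimage (W.locClosedι hC).continuous
  have h := (W.locClosed hC).setCls_univ_closed_open hF'
  rw [← W.setCls_of_isLocallyClosed hC,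
    ← AlgVar.setCls_image _ W (W.locClosedι hC) inferInstance rfl hF'.isLocallyClosed,
    ← AlgVar.setCls_image _ W (W.locClosedι hC) inferInstance rfl hF'.isOpen_compl.isLocallyClosed,
    ← Set.preimage_compl, Set.image_preimage_eq_range_inter, Set.image_preimage_eq_range_inter,
    W.range_locClosedι] at h
  exact h

end GrothendieckRing

/-! ### Noetherian induction on locally closed subsets -/

section Induction

variable {X : Type*} [TopologicalSpace X] [TopologicalSpace.NoetherianSpace X] [QuasiSober X]

/-- A property of locally closed subsets of a sober Noetherian space that can be glued along a
decomposition into a closed and an open part, and that holds generically on every irreducible closed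
subset, holds for all locally closed subsets. -/
theorem locallyClosed_induction {Q : Set X → Prop} (h0 : Q ∅)
    (hadd : ∀ C F : Set X, IsLocallyClosed C → IsClosed F → Q (C ∩ F) → Q (C ∩ Fᶜ) → Q C)
    (hgen : ∀ (η : X) (O : Set X), IsOpen O → η ∈ O →
      ∃ U ⊆ O, IsOpen U ∧ η ∈ U ∧ Q (closure {η} ∩ U))
    {C : Set X} (hC : IsLocallyClosed C) : Q C := by
  suffices H : ∀ F : TopologicalSpace.Closeds X, ∀ O : Set X, IsOpen O → Q (F ∩ O) by
    obtain ⟨O, F, hO, hF, rfl⟩ := hC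
    rw [Set.inter_comm]
    exact H ⟨F, hF⟩ O hO
  intro F
  -- Induction on the closed set, with all open sets treated at once so that `O` may shrink.
  refine wellFounded_lt.induction
    (C := fun F : TopologicalSpace.Closeds X ↦ ∀ O : Set X, IsOpen O → Q (F ∩ O)) F ?_
  intro F ih O hO
  have hFO : IsLocallyClosed ((F : Set X) ∩ O) := F.isClosed.isLocallyClosed.inter
    hO.isLocallyClosed
  have key (G : Set X) (hG : IsClosed G) (hGF : ¬ (F : Set X) ⊆ G) (O' : Set X) (hO' : IsOpen O') :
      Q ((F ∩ G) ∩ O') := by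
    refine ih ⟨(F : Set X) ∩ G, F.isClosed.inter hG⟩ ?_ O' hO'
    refine lt_of_le_of_ne (Set.inter_subset_left (s := (F : Set X))) fun h ↦ hGF ?_
    intro x hx
    have : x ∈ (F : Set X) ∩ G := by
      have h' := congrArg (fun K : TopologicalSpace.Closeds X ↦ (K : Set X)) h
      change (F : Set X) ∩ G = F at h'
      rwa [h']
    exact this.2
  -- If F is irreducible, either its generic point lies in O and `hgen` handles a dense open part,
  -- or F ∩ O is empty. If F is reducible, it splits into two proper closed parts.
  by_cases hirr : IsIrreducible (F : Set X)
  · obtain ⟨η, hη⟩ := QuasiSober.sober hirr F.isClosed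
    by_cases hηO : η ∈ O
    · obtain ⟨U, hUO, hU, hηU, hQ⟩ := hgen η O hO hηO
      refine hadd _ Uᶜ hFO hU.isClosed_compl ?_ ?_
      · rw [Set.inter_right_comm]
        refine key _ hU.isClosed_compl (fun h ↦ h ?_ hηU) O hO
        have : η ∈ closure {η} := subset_closure rfl
        rwa [hη.def] at this
      · rw [compl_compl, Set.inter_assoc, Set.inter_eq_right.mpr hUO, ← hη.def]
        exact hQ
    · have : (F : Set X) ∩ O = ∅ := by
        by_contra hne
        obtain ⟨x, hxF, hxO⟩ := Set.nonempty_iff_ne_empty.mpr hne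
        rw [← hη.def] at hxF
        exact hηO ((specializes_iff_mem_closure.mpr hxF).mem_open hO hxO)
      rw [this]; exact h0
  · by_cases hne : (F : Set X).Nonempty
    · have : ¬ IsPreirreducible (F : Set X) := fun h ↦ hirr ⟨hne, h⟩
      rw [isPreirreducible_iff_isClosed_union_isClosed] at this
      push Not at this
      obtain ⟨F1, F2, hF1, hF2, hsub, h1, h2⟩ := this
      refine hadd _ F1 hFO hF1 ?_ ?_
      · rw [Set.inter_right_comm]
        exact key F1 hF1 h1 O hO
      · have : (F : Set X) ∩ O ∩ F1ᶜ = ((F : Set X) ∩ F2) ∩ (O ∩ F1ᶜ) := by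
          ext x; constructor
          · rintro ⟨⟨a, b⟩, c⟩
            exact ⟨⟨a, (hsub a).resolve_left c⟩, b, c⟩
          · rintro ⟨⟨a, _⟩, b, c⟩
            exact ⟨⟨a, b⟩, c⟩
        rw [this]
        exact key F2 hF2 h2 _ (hO.inter hF1.isOpen_compl)
    · rw [Set.not_nonempty_iff_eq_empty.mp hne, Set.empty_inter]; exact h0

end Induction

/-! ### Additivity of classes over finite partitions -/

section GrothendieckRing

variable {k : Type u} [Field k]

/-- Additivity of classes over finite partitions into locally closed subsets. -/
lemma AlgVar.setCls_eq_sum {ι : Type*} [Fintype ι] (W : AlgVar k) (f : W.carrier → ι)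
    (hf : ∀ i, IsLocallyClosed (f ⁻¹' {i})) {C : Set W.carrier} (hC : IsLocallyClosed C) :
    W.setCls C = ∑ i, W.setCls (C ∩ f ⁻¹' {i}) := by
  classical
  refine locallyClosed_induction (Q := fun C ↦ W.setCls C = ∑ i, W.setCls (C ∩ f ⁻¹' {i}))
    ?_ ?_ ?_ hC
  · simp [AlgVar.setCls_empty]
  · intro C F hC hF h1 h2
    rw [W.setCls_closed_open hC hF, h1, h2, ← Finset.sum_add_distrib]
    refine Finset.sum_congr rfl fun i _ ↦ ?_
    rw [W.setCls_closed_open (hC.inter (hf i)) hF, Set.inter_right_comm,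
      Set.inter_right_comm C Fᶜ]
  · intro η O hO hη
    -- The fiber through η is locally closed, so it contains a whole neighbourhood of η in its
    -- closure, and there only one summand is nonzero.
    obtain ⟨O', F, hO', hF, h⟩ := hf (f η)
    have hη' : η ∈ O' ∩ F := h ▸ (rfl : f η = f η)
    refine ⟨O ∩ O', Set.inter_subset_left, hO.inter hO', ⟨hη, hη'.1⟩, ?_⟩
    have hsub : closure {η} ∩ (O ∩ O') ⊆ f ⁻¹' {f η} := by
      rw [h]
      exact fun x hx ↦ ⟨hx.2.2, closure_minimal (by simpa using hη'.2) hF hx.1⟩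
    rw [Finset.sum_eq_single (f η)]
    · rw [Set.inter_eq_left.mpr hsub]
    · intro i _ hi
      rw [show closure {η} ∩ (O ∩ O') ∩ f ⁻¹' {i} = ∅ from ?_, W.setCls_empty]
      ext x
      simp only [Set.mem_inter_iff, Set.mem_empty_iff_false, iff_false, not_and]
      exact fun hx hxi ↦ hi ((show f x = i from hxi) ▸ (show f x = f η from hsub hx))
    · simp

end GrothendieckRing

/-! ### The invariant as a sum of contributions of points -/

section Contributions

variable {k : Type u} [Field k]

variable {A : Type*} [CommRing A] [Algebra ℚ A] (θ : K0 k →+* A)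

/-- The factor with which the points lying on components of multiplicities `m` contribute to the
invariant, in a ring `A` over the Grothendieck ring. -/
def weight (m : Multiset ℕ) : A :=
  (if m = {1} then 1 else 0) +
    if m.card = 2 ∧ m.gcd = 1 then ((1 : ℚ) / (m.prod : ℚ)) • (1 - θ (lefschetz k)) else 0

open Classical in
/-- The set of components through a point. -/
def AlgVar.compsThrough (W : AlgVar k) (y : W.carrier) : Finset W.Comp :=
  {D | y ∈ (D : Set W.carrier)}

/-- The multiplicities of the components through a point. -/
def AlgVar.mults (W : AlgVar k) (y : W.carrier) : Multiset ℕ :=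
  (W.compsThrough y).val.map W.mult

lemma AlgVar.stratum_eq_preimage (W : AlgVar k) (H : Finset W.Comp) :
    W.stratum H = W.compsThrough ⁻¹' {H} := by
  ext y
  simp only [AlgVar.stratum, Set.mem_sdiff, Set.mem_iInter, Set.mem_iUnion, Set.mem_preimage,
    Set.mem_singleton_iff, Finset.ext_iff, AlgVar.compsThrough, Finset.mem_filter,
    Finset.mem_univ, true_and, Set.mem_ofPred_eq, not_exists]
  constructor
  · rintro ⟨h1, h2⟩ D
    exact ⟨fun h ↦ by_contra fun hD ↦ h2 D hD h, h1 D⟩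
  · intro h
    exact ⟨fun D hD ↦ (h D).2 hD, fun D hD hy ↦ hD ((h D).1 hy)⟩

/-- The contribution of a locally closed subset to the invariant. -/
def AlgVar.contr (W : AlgVar k) (C : Set W.carrier) : A :=
  ∑ H : Finset W.Comp, weight θ (H.val.map W.mult) * θ (W.setCls (C ∩ W.stratum H))

lemma AlgVar.contr_empty (W : AlgVar k) : W.contr θ ∅ = 0 := by
  simp [AlgVar.contr, AlgVar.setCls_empty]

lemma AlgVar.contr_closed_open (W : AlgVar k) {C F : Set W.carrier} (hC : IsLocallyClosed C)
    (hF : IsClosed F) : W.contr θ C = W.contr θ (C ∩ F) + W.contr θ (C ∩ Fᶜ) := by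
  rw [AlgVar.contr, AlgVar.contr, AlgVar.contr, ← Finset.sum_add_distrib]
  refine Finset.sum_congr rfl fun H _ ↦ ?_
  rw [W.setCls_closed_open (hC.inter (W.isLocallyClosed_stratum H)) hF, map_add, mul_add,
    Set.inter_right_comm, Set.inter_right_comm C Fᶜ]

lemma AlgVar.contr_eq_sum {ι : Type*} [Fintype ι] (W : AlgVar k) (f : W.carrier → ι)
    (hf : ∀ i, IsLocallyClosed (f ⁻¹' {i})) {C : Set W.carrier} (hC : IsLocallyClosed C) :
    W.contr θ C = ∑ i, W.contr θ (C ∩ f ⁻¹' {i}) := by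
  simp only [AlgVar.contr]
  rw [Finset.sum_comm]
  refine Finset.sum_congr rfl fun H _ ↦ ?_
  rw [W.setCls_eq_sum f hf (hC.inter (W.isLocallyClosed_stratum H)), map_sum, Finset.mul_sum]
  refine Finset.sum_congr rfl fun i _ ↦ ?_
  rw [Set.inter_right_comm]

/-- All strata that meet `C` have the same weight, and the others contribute the class of the empty
set. -/
lemma AlgVar.contr_eq_of_mults_eq (W : AlgVar k) {C : Set W.carrier} (hC : IsLocallyClosed C)
    {m : Multiset ℕ} (hm : ∀ y ∈ C, W.mults y = m) :
    W.contr θ C = weight θ m * θ (W.setCls C) := by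
  classical
  rw [W.setCls_eq_sum W.compsThrough
    (fun H ↦ W.stratum_eq_preimage H ▸ W.isLocallyClosed_stratum H) hC, map_sum, Finset.mul_sum]
  refine Finset.sum_congr rfl fun H _ ↦ ?_
  rw [← W.stratum_eq_preimage]
  by_cases h : (C ∩ W.stratum H).Nonempty
  · obtain ⟨y, hyC, hy⟩ := h
    rw [W.stratum_eq_preimage] at hy
    rw [← hm y hyC, AlgVar.mults, show W.compsThrough y = H from hy]
  · rw [Set.not_nonempty_iff_eq_empty.mp h, W.setCls_empty, map_zero, mul_zero, mul_zero]

/-- Index sets with one element produce the first sum and those with two elements the second; all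
others have weight 0. -/
lemma AlgVar.serreTilde_eq_contr_of_algebra {Q : Type*} [CommRing Q] [Algebra ℚ Q] (τ : K0 k →+* Q)
    (I : Ideal Q) (W : AlgVar k) :
    Ideal.Quotient.mk I (∑ i with W.mult i = 1,
        τ (W.locClosed (W.isLocallyClosed_stratum {i})).cls +
      ∑ H ∈ Finset.univ.powersetCard 2 with H.gcd W.mult = 1,
        ((1 : ℚ) / ∏ h ∈ H, (W.mult h : ℚ)) •
          (τ (W.locClosed (W.isLocallyClosed_stratum H)).cls * (1 - τ (lefschetz k)))) =
    W.contr ((Ideal.Quotient.mk I).comp τ) Set.univ := by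
  classical
  have hcls (H : Finset W.Comp) : τ (W.locClosed (W.isLocallyClosed_stratum H)).cls =
      τ (W.setCls (Set.univ ∩ W.stratum H)) := by
    rw [Set.univ_inter, W.setCls_of_isLocallyClosed (W.isLocallyClosed_stratum H)]
  simp only [AlgVar.contr, weight, add_mul, Finset.sum_add_distrib, map_add, map_sum]
  congr 1
  · simp only [ite_mul, one_mul, zero_mul, ← Finset.sum_filter]
    refine Finset.sum_bij (fun i _ ↦ {i}) ?_ ?_ ?_ ?_
    · intro i hi; simpa using hi
    · intro i _ j _ h; simpa using h
    · intro H hH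
      simp only [Finset.mem_filter, Finset.mem_univ, true_and] at hH
      have hcard : H.card = 1 := by simpa using congrArg Multiset.card hH
      obtain ⟨i, rfl⟩ := Finset.card_eq_one.mp hcard
      exact ⟨i, by simpa using hH, rfl⟩
    · intro i _; rw [hcls, RingHom.comp_apply]
  · simp only [ite_mul, zero_mul, ← Finset.sum_filter]
    refine Finset.sum_congr ?_ ?_
    · ext H
      rw [Finset.mem_filter, Finset.mem_powersetCard, Finset.mem_filter, Multiset.card_map,
        Finset.gcd_def]
      exact ⟨fun h ↦ ⟨Finset.mem_univ _, h.1.2, h.2⟩,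
        fun h ↦ ⟨⟨Finset.subset_univ _, h.2.1⟩, h.2.2⟩⟩
    · intro H _
      rw [smul_mul_assoc, hcls]
      change Ideal.Quotient.mkₐ ℚ I _ = _ • _
      rw [map_smul, map_mul, map_sub, map_one, mul_comm]
      congr 2
      rw [Finset.prod_map_val, Nat.cast_prod]

variable (k) in
/-- The quotient map to `K₀(Var_k)_ℚ / (𝕃 - 1)²`. -/
def toK0QQuot : K0 k →+* K0Q k ⧸ idealLQ k 2 := (Ideal.Quotient.mk (idealLQ k 2)).comp (toK0Q k)

lemma AlgVar.serreTilde_eq_contr (W : AlgVar k) :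
    W.serreTilde = W.contr (toK0QQuot k) Set.univ :=
  W.serreTilde_eq_contr_of_algebra (toK0Q k) (idealLQ k 2)

lemma map_weight {B : Type*} [CommRing B] (r : A →+* B) (hr : r (θ (lefschetz k)) = 1)
    (m : Multiset ℕ) : r (weight θ m) = if m = {1} then 1 else 0 := by
  rw [weight, map_add]
  split_ifs <;> simp [Algebra.smul_def, hr]

/-- Once 𝕃 becomes 1, the weight is the indicator of the multiset `{1}`, so the invariant is the
class of the points with this multiset. It will be applied to the smooth locus. -/
lemma AlgVar.map_contr {B : Type*} [CommRing B] (r : A →+* B) (hr : r (θ (lefschetz k)) = 1)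
    (W : AlgVar k) {S : Set W.carrier} (hS : IsLocallyClosed S)
    (h : ∀ y, y ∈ S ↔ W.mults y = {1}) :
    r (W.contr θ Set.univ) = r (θ (W.setCls S)) := by
  classical
  rw [W.setCls_eq_sum W.compsThrough
    (fun H ↦ W.stratum_eq_preimage H ▸ W.isLocallyClosed_stratum H) hS,
    AlgVar.contr, map_sum, map_sum, map_sum]
  refine Finset.sum_congr rfl fun H _ ↦ ?_
  rw [← W.stratum_eq_preimage, map_mul, map_weight θ r hr]
  have hmult : ∀ y ∈ W.stratum H, W.mults y = H.val.map W.mult := by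
    intro y hy
    rw [W.stratum_eq_preimage] at hy
    rw [AlgVar.mults, show W.compsThrough y = H from hy]
  split_ifs with h1
  · rw [one_mul, Set.univ_inter, Set.inter_eq_right.mpr]
    intro y hy
    rw [h, hmult y hy, h1]
  · rw [zero_mul, show S ∩ W.stratum H = ∅ from ?_, W.setCls_empty, map_zero, map_zero]
    ext y
    simp only [Set.mem_inter_iff, Set.mem_empty_iff_false, iff_false, not_and]
    intro hy hyH
    exact h1 ((hmult y hyH).symm.trans ((h y).mp hy))

lemma reduction_toK0QQuot (x : K0 k) :
    reduction k (toK0QQuot k x) = rationalization k (Ideal.Quotient.mk _ x) := rfl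

lemma AlgVar.reduction_serreTilde (W : AlgVar k) {S : Set W.carrier} (hS : IsLocallyClosed S)
    (h : ∀ y, y ∈ S ↔ W.mults y = {1}) :
    reduction k W.serreTilde = rationalization k (Ideal.Quotient.mk _ (W.setCls S)) := by
  rw [W.serreTilde_eq_contr, ← reduction_toK0QQuot]
  refine W.map_contr (A := K0Q k ⧸ idealLQ k 2) (B := K0Q k ⧸ idealLQ k 1) (toK0QQuot k)
    (reduction k) ?_ hS h
  rw [reduction_toK0QQuot]
  have : Ideal.Quotient.mk (idealL k) (lefschetz k) = 1 := by
    rw [← map_one (Ideal.Quotient.mk (idealL k))]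
    exact (Ideal.Quotient.mk_eq_mk_iff_sub_mem _ _).mpr (Ideal.subset_span rfl)
  rw [this, map_one]

/-- This is the only property of the coefficient ring on which the invariance under blowups depends.
-/
lemma toK0QQuot_sq : (1 - toK0QQuot k (lefschetz k)) ^ 2 = 0 := by
  have h : Ideal.Quotient.mk (idealLQ k 2) ((toK0Q k (lefschetz k) - 1) ^ 2) = 0 :=
    Ideal.Quotient.eq_zero_iff_mem.mpr (Ideal.subset_span rfl)
  rw [map_pow, map_sub, map_one] at h
  rw [← h]
  change _ = (toK0QQuot k (lefschetz k) - 1) ^ 2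
  ring

end Contributions

/-! ### Multiplicities and local rings -/

section Multiplicities

/-- The stalk at a generization of `y` is a localization of the stalk at `y`. -/
lemma isLocalization_stalkSpecializes {X : Scheme.{u}} {y ξ : X} (h : ξ ⤳ y)
    (P : PrimeSpectrum (X.presheaf.stalk y)) (hP : X.fromSpecStalk y P = ξ) :
    letI := (X.presheaf.stalkSpecializes h).hom.toAlgebra
    IsLocalization.AtPrime (X.presheaf.stalk ξ) P.asIdeal := by
  let : Algebra (X.presheaf.stalk y) (X.presheaf.stalk ξ) :=
    (X.presheaf.stalkSpecializes h).hom.toAlgebra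
  obtain ⟨_, ⟨U, hU, rfl⟩, hyU, -⟩ :=
    X.isBasis_affineOpens.exists_subset_of_mem_open (Set.mem_univ y) isOpen_univ
  have hU : IsAffineOpen U := hU
  have hξU : ξ ∈ U := h.mem_open U.2 hyU
  let : Algebra Γ(X, U) (X.presheaf.stalk y) :=
    TopCat.Presheaf.algebra_section_stalk X.presheaf ⟨y, hyU⟩
  let : Algebra Γ(X, U) (X.presheaf.stalk ξ) :=
    TopCat.Presheaf.algebra_section_stalk X.presheaf ⟨ξ, hξU⟩
  have hy : IsLocalization.AtPrime (X.presheaf.stalk y) (hU.primeIdealOf ⟨y, hyU⟩).asIdeal :=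
    hU.isLocalization_stalk ⟨y, hyU⟩
  have hξ : IsLocalization.AtPrime (X.presheaf.stalk ξ) (hU.primeIdealOf ⟨ξ, hξU⟩).asIdeal :=
    hU.isLocalization_stalk ⟨ξ, hξU⟩
  have : IsScalarTower Γ(X, U) (X.presheaf.stalk y) (X.presheaf.stalk ξ) := by
    refine IsScalarTower.of_algebraMap_eq fun r ↦ ?_
    exact congr($((X.presheaf.germ_stalkSpecializes (U := U) hyU h).symm).hom r)
  have hcomap : (hU.primeIdealOf ⟨ξ, hξU⟩).asIdeal =
      P.asIdeal.comap (algebraMap Γ(X, U) (X.presheaf.stalk y)) := by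
    have : hU.primeIdealOf ⟨ξ, hξU⟩ = Spec.map (X.presheaf.germ U y hyU) P := by
      apply hU.fromSpec.isOpenEmbedding.injective
      refine (hU.fromSpec_primeIdealOf ⟨ξ, hξU⟩).trans (hP.symm.trans ?_)
      rw [← hU.fromSpecStalk_eq_fromSpecStalk hyU]
      rfl
    rw [this]; rfl
  have hle : (hU.primeIdealOf ⟨y, hyU⟩).asIdeal.primeCompl ≤
      (hU.primeIdealOf ⟨ξ, hξU⟩).asIdeal.primeCompl := by
    intro s hs hs'
    refine P.2.ne_top (Ideal.eq_top_of_isUnit_mem _ (?_ : algebraMap _ _ s ∈ P.asIdeal)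
      (IsLocalization.map_units (X.presheaf.stalk y) ⟨s, hs⟩))
    rw [hcomap] at hs'; exact hs'
  have h1 := IsLocalization.isLocalization_of_submonoid_le (X.presheaf.stalk y)
    (X.presheaf.stalk ξ) _ _ hle
  -- The stalk at ξ inverts only the functions on `U` outside the prime of ξ. Every element outside
  -- `P` divides such a function, up to a denominator that is a unit in the stalk at y, so the two
  -- localizations agree.
  refine IsLocalization.of_le_of_exists_dvd ((hU.primeIdealOf ⟨ξ, hξU⟩).asIdeal.primeCompl.map
    (algebraMap Γ(X, U) (X.presheaf.stalk y))) P.asIdeal.primeCompl ?_ ?_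
  · rintro _ ⟨s, hs, rfl⟩ hs'
    refine hs ?_
    rw [SetLike.mem_coe, hcomap]; exact hs'
  · intro s hs
    obtain ⟨⟨b, m⟩, hb⟩ := IsLocalization.surj (hU.primeIdealOf ⟨y, hyU⟩).asIdeal.primeCompl s
    refine ⟨algebraMap _ _ b, ⟨b, ?_, rfl⟩, ⟨_, hb.symm⟩⟩
    intro hb'
    rw [SetLike.mem_coe, hcomap, Ideal.mem_comap, ← hb] at hb'
    rcases P.2.mem_or_mem hb' with h2 | h2
    · exact hs h2
    · exact P.2.ne_top (Ideal.eq_top_of_isUnit_mem _ h2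
        (IsLocalization.map_units (X.presheaf.stalk y) m))

/-- A local ring whose maximal ideal is generated by an element `q` with `q ^ b = 0` and
`q ^ (b - 1) ≠ 0` has length `b`. -/
lemma length_eq_of_maximalIdeal_eq_span {S : Type*} [CommRing S] [IsLocalRing S] {q : S}
    (hq : maximalIdeal S = Ideal.span {q}) {b : ℕ} (hb : q ^ b = 0)
    (hb' : ∀ j < b, q ^ j ≠ 0) : Module.length S S = b := by
  have hcov (j : ℕ) (hj : j < b) : Ideal.span {q ^ (j + 1)} ⋖ Ideal.span {q ^ j} := by
    refine ⟨lt_of_le_of_ne ?_ fun h ↦ ?_, ?_⟩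
    · rw [Ideal.span_singleton_le_span_singleton]; exact pow_dvd_pow _ (Nat.le_succ j)
    · have : q ^ j ∈ Ideal.span {q ^ (j + 1)} := h ▸ Ideal.mem_span_singleton_self _
      obtain ⟨r, hr⟩ := Ideal.mem_span_singleton.mp this
      have h0 : q ^ j * (1 - q * r) = 0 := by
        rw [mul_sub, mul_one, sub_eq_zero, ← mul_assoc, ← pow_succ]; exact hr
      -- As q lies in the maximal ideal, 1 - qr is a unit, so q^j would vanish for some j < b.
      have hu : IsUnit (1 - q * r) := by
        refine (isUnit_or_isUnit_one_sub_self (q * r)).resolve_left fun h ↦ ?_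
        have : q ∈ maximalIdeal S := hq ▸ Ideal.mem_span_singleton_self q
        exact (mem_maximalIdeal q).mp this (isUnit_of_mul_isUnit_left h)
      exact hb' j hj (hu.mul_left_eq_zero.mp h0)
    · intro I h1 h2
      obtain ⟨x, hxI, hx⟩ := SetLike.exists_of_lt h1
      obtain ⟨u, rfl⟩ := Ideal.mem_span_singleton.mp (h2.le hxI)
      have hu : IsUnit u := by
        by_contra hu
        have : u ∈ Ideal.span {q} := hq ▸ (mem_maximalIdeal u).mpr hu
        obtain ⟨v, rfl⟩ := Ideal.mem_span_singleton.mp this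
        exact hx (Ideal.mem_span_singleton.mpr ⟨v, by ring⟩)
      refine h2.not_ge ?_
      rw [Ideal.span_singleton_le_iff_mem]
      exact (Ideal.mul_unit_mem_iff_mem I hu).mp hxI
  -- The powers of q are listed backwards, from (q^b) = 0 up to (q^0) = S.
  let s : CompositionSeries (Submodule S S) :=
    { length := b
      toFun := fun i ↦ Ideal.span {q ^ (b - (i : ℕ))}
      step := fun i ↦ by
        have h := hcov (b - (i : ℕ) - 1) (by have := i.2; omega)
        have h2 : b - (i : ℕ) - 1 + 1 = b - (i : ℕ) := by have := i.2; omega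
        rw [h2, Nat.sub_sub] at h
        exact h }
  refine (Module.length_compositionSeries s ?_ ?_).symm
  · change Ideal.span {q ^ (b - 0)} = ⊥
    rw [Nat.sub_zero, hb, Ideal.span_singleton_eq_bot]
  · change Ideal.span {q ^ (b - b)} = ⊤
    rw [Nat.sub_self, pow_zero, Ideal.span_singleton_one]

variable {k : Type u} [Field k]

/-- If the local ring at `y` is `R / (∏ q_v ^ b_v)` for a domain `R` and distinct principal primes
`(q_v)`, then the multiplicities of the components through `y` are the exponents `b_v`. -/
lemma AlgVar.mults_eq_of_stalk (W : AlgVar k) (y : W.carrier) {R : Type*} [CommRing R] [IsDomain R]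
    (g : R →+* W.carrier.presheaf.stalk y) (hg : Function.Surjective g) {ι : Type*}
    (V : Finset ι) (q : ι → R) (b : ι → ℕ) (hb : ∀ v ∈ V, b v ≠ 0)
    (hker : RingHom.ker g = Ideal.span {∏ v ∈ V, q v ^ b v})
    (hprime : ∀ v ∈ V, Prime (q v)) (hdvd : ∀ v ∈ V, ∀ w ∈ V, q v ∣ q w → v = w) :
    W.mults y = V.val.map b := by
  classical
  have hqker (v) (hv : v ∈ V) : RingHom.ker g ≤ Ideal.span {q v} := by
    rw [hker, Ideal.span_singleton_le_span_singleton]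
    exact (dvd_pow_self _ (hb v hv)).trans (Finset.dvd_prod_of_mem _ hv)
  have hPprime (v) (hv : v ∈ V) : ((Ideal.span {q v}).map g).IsPrime := by
    have := (Ideal.span_singleton_prime (hprime v hv).ne_zero).mpr (hprime v hv)
    exact Ideal.map_isPrime_of_surjective hg (hqker v hv)
  have hcomap (v) (hv : v ∈ V) : ((Ideal.span {q v}).map g).comap g = Ideal.span {q v} := by
    rw [Ideal.comap_map_of_surjective g hg, sup_eq_left]
    exact hqker v hv
  -- The product of the q_v^b_v vanishes in the stalk, so every prime contains some q_v. Since no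
  -- q_w divides another, the primes (q_v) are exactly the minimal ones.
  have hmin (P : PrimeSpectrum (W.carrier.presheaf.stalk y)) :
      ∃ v, ∃ hv : v ∈ V, (⟨_, hPprime v hv⟩ : PrimeSpectrum _) ≤ P := by
    have h0 : ∏ v ∈ V, q v ^ b v ∈ P.asIdeal.comap g := by
      have : ∏ v ∈ V, q v ^ b v ∈ RingHom.ker g := hker ▸ Ideal.mem_span_singleton_self _
      rw [Ideal.mem_comap, (RingHom.mem_ker).mp this]
      exact zero_mem _
    have hp := Ideal.comap_isPrime g P.asIdeal
    obtain ⟨v, hv, h⟩ := (Ideal.IsPrime.prod_mem_iff (p := P.asIdeal.comap g)).mp h0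
    refine ⟨v, hv, ?_⟩
    change (Ideal.span {q v}).map g ≤ P.asIdeal
    rw [Ideal.map_le_iff_le_comap, Ideal.span_singleton_le_iff_mem]
    exact hp.mem_of_pow_mem _ h
  have hanti (v) (hv : v ∈ V) (P : PrimeSpectrum (W.carrier.presheaf.stalk y))
      (hP : P ≤ ⟨_, hPprime v hv⟩) : P = ⟨_, hPprime v hv⟩ := by
    obtain ⟨w, hw, h⟩ := hmin P
    have h1 : (Ideal.span {q w}).map g ≤ (Ideal.span {q v}).map g := h.trans hP
    have h2 := Ideal.comap_mono (f := g) h1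
    rw [hcomap v hv, hcomap w hw, Ideal.span_singleton_le_span_singleton] at h2
    have := hdvd v hv w hw h2
    subst this
    exact le_antisymm hP h
  let ξ (v) (hv : v ∈ V) : W.carrier := W.carrier.fromSpecStalk y ⟨_, hPprime v hv⟩
  have hξy (v) (hv : v ∈ V) : ξ v hv ⤳ y := by
    have : ξ v hv ∈ Set.range (W.carrier.fromSpecStalk y) := ⟨_, rfl⟩
    rwa [Scheme.range_fromSpecStalk] at this
  have hspec (P P' : PrimeSpectrum (W.carrier.presheaf.stalk y))
      (h : W.carrier.fromSpecStalk y P ⤳ W.carrier.fromSpecStalk y P') : P ≤ P' := by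
    rw [PrimeSpectrum.le_iff_specializes]
    exact ((W.carrier.fromSpecStalk y).isEmbedding.isInducing.specializes_iff).mp h
  have hspec' (P P' : PrimeSpectrum (W.carrier.presheaf.stalk y)) (h : P ≤ P') :
      W.carrier.fromSpecStalk y P ⤳ W.carrier.fromSpecStalk y P' :=
    ((PrimeSpectrum.le_iff_specializes _ _).mp h).map (W.carrier.fromSpecStalk y).continuous
  -- The generic point of a closed irreducible set through ξ_v generizes y, hence comes from a prime
  -- of the stalk at y; by minimality that prime is the one of ξ_v.
  have hgen (Z : Set W.carrier) (hZ : IsIrreducible Z) (hZc : IsClosed Z) (v) (hv : v ∈ V)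
      (hle : ξ v hv ∈ Z) : Z = closure {ξ v hv} := by
    obtain ⟨ζ, hζ⟩ := QuasiSober.sober hZ hZc
    have h1 : ζ ⤳ ξ v hv := by rw [specializes_iff_mem_closure, hζ.def]; exact hle
    have h2 : ζ ∈ Set.range (W.carrier.fromSpecStalk y) := by
      rw [Scheme.range_fromSpecStalk]; exact h1.trans (hξy v hv)
    obtain ⟨P, rfl⟩ := h2
    rw [← hζ.def, hanti v hv P (hspec _ _ h1)]
  have hcomp (v) (hv : v ∈ V) : closure {ξ v hv} ∈ irreducibleComponents W.carrier := by
    refine ⟨isIrreducible_singleton.closure, fun Z hZ hle ↦ ?_⟩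
    have hZc := hgen (closure Z) hZ.closure isClosed_closure v hv
      (subset_closure (hle (subset_closure rfl)))
    exact hZc ▸ subset_closure
  let D (v : V) : W.Comp := ⟨_, hcomp v.1 v.2⟩
  have hDinj : Function.Injective D := by
    rintro ⟨v, hv⟩ ⟨w, hw⟩ h
    have h1 : closure {ξ v hv} = closure {ξ w hw} := congrArg Subtype.val h
    have h2 : ξ v hv ⤳ ξ w hw := by
      rw [specializes_iff_mem_closure, h1]; exact subset_closure rfl
    have h3 : (Ideal.span {q v}).map g ≤ (Ideal.span {q w}).map g := hspec _ _ h2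
    have h4 := Ideal.comap_mono (f := g) h3
    rw [hcomap v hv, hcomap w hw, Ideal.span_singleton_le_span_singleton] at h4
    exact Subtype.ext (hdvd w hw v hv h4).symm
  have hthrough : W.compsThrough y = V.attach.map ⟨D, hDinj⟩ := by
    ext Z
    simp only [AlgVar.compsThrough, Finset.mem_filter, Finset.mem_univ, true_and, Finset.mem_map,
      Finset.mem_attach, Function.Embedding.coeFn_mk, Subtype.exists]
    constructor
    · intro hyZ
      have hZc := isClosed_of_mem_irreducibleComponents _ Z.2
      obtain ⟨ζ, hζ⟩ := QuasiSober.sober Z.2.1 hZc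
      have h2 : ζ ∈ Set.range (W.carrier.fromSpecStalk y) := by
        rw [Scheme.range_fromSpecStalk]
        change ζ ⤳ y
        rw [specializes_iff_mem_closure, hζ.def]; exact hyZ
      obtain ⟨P, rfl⟩ := h2
      obtain ⟨v, hv, h⟩ := hmin P
      refine ⟨v, hv, Subtype.ext ?_⟩
      have h3 : (Z : Set W.carrier) ⊆ closure {ξ v hv} := by
        rw [← hζ.def]
        exact (hspec' _ _ h).closure_subset
      exact Set.Subset.antisymm (Z.2.2 isIrreducible_singleton.closure h3) h3
    · rintro ⟨v, hv, rfl⟩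
      exact (hξy v hv).mem_closed isClosed_closure (subset_closure rfl)
  have hmult (v : V) : W.mult (D v) = b v := by
    obtain ⟨v, hv⟩ := v
    have hζ : IsIrreducible.genericPoint (D ⟨v, hv⟩).2.1 = ξ v hv :=
      (IsIrreducible.isGenericPoint_genericPoint _ isClosed_closure).eq rfl
    have hlen : Module.length (W.carrier.presheaf.stalk (ξ v hv)) (W.carrier.presheaf.stalk (ξ v hv)) = b v := by
      have := hPprime v hv
      let := (W.carrier.presheaf.stalkSpecializes (hξy v hv)).hom.toAlgebra
      have hloc := isLocalization_stalkSpecializes (hξy v hv) ⟨_, hPprime v hv⟩ rfl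
      change IsLocalization.AtPrime (W.carrier.presheaf.stalk (ξ v hv)) ((Ideal.span {q v}).map g) at hloc
      refine length_eq_of_maximalIdeal_eq_span
        (q := algebraMap (W.carrier.presheaf.stalk y) (W.carrier.presheaf.stalk (ξ v hv)) (g (q v))) ?_ ?_ ?_
      · rw [← IsLocalization.AtPrime.map_eq_maximalIdeal ((Ideal.span {q v}).map g),
          Ideal.map_span, Ideal.map_span, Set.image_singleton, Set.image_singleton]
      · rw [← map_pow, ← map_pow, IsLocalization.map_eq_zero_iff
          ((Ideal.span {q v}).map g).primeCompl]
        -- The cofactor of q_v^b_v becomes a unit at ξ_v, so q_v^b_v vanishes there.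
        have hs : ∏ w ∈ V.erase v, q w ^ b w ∉ Ideal.span {q v} := by
          rw [Ideal.mem_span_singleton, (hprime v hv).dvd_finsetProd_iff]
          rintro ⟨w, hw, h⟩
          exact (Finset.ne_of_mem_erase hw) (hdvd v hv w (Finset.mem_of_mem_erase hw)
            ((hprime v hv).dvd_of_dvd_pow h)).symm
        refine ⟨⟨g (∏ w ∈ V.erase v, q w ^ b w), fun h ↦ hs ?_⟩, ?_⟩
        · rw [← hcomap v hv]; exact h
        · change g _ * g _ = 0
          rw [← map_mul, ← RingHom.mem_ker, hker, mul_comm,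
            Finset.mul_prod_erase V (fun w ↦ q w ^ b w) hv]
          exact Ideal.mem_span_singleton_self _
      · intro j hj h0
        rw [← map_pow, ← map_pow, IsLocalization.map_eq_zero_iff
          ((Ideal.span {q v}).map g).primeCompl] at h0
        obtain ⟨⟨m, hm⟩, h0⟩ := h0
        obtain ⟨s, rfl⟩ := hg m
        change g s * g _ = 0 at h0
        rw [← map_mul, ← RingHom.mem_ker, hker, Ideal.mem_span_singleton,
          ← Finset.mul_prod_erase V (fun w ↦ q w ^ b w) hv] at h0
        -- If q_v^j already vanished for some j < b_v, cancelling it would show that q_v divides s,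
        -- which lies outside (q_v).
        have h1 : q v ^ (j + 1) ∣ s * q v ^ j :=
          (pow_dvd_pow _ hj).trans ((dvd_mul_right _ _).trans h0)
        rw [pow_succ', mul_dvd_mul_iff_right (pow_ne_zero _ (hprime v hv).ne_zero)] at h1
        exact hm (Ideal.mem_map_of_mem g (Ideal.mem_span_singleton.mpr h1))
    change (Module.length (W.carrier.presheaf.stalk (IsIrreducible.genericPoint (D ⟨v, hv⟩).2.1))
      (W.carrier.presheaf.stalk (IsIrreducible.genericPoint (D ⟨v, hv⟩).2.1))).toNat = b v
    rw [hζ, hlen]; rfl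
  rw [AlgVar.mults, hthrough, Finset.map_val, Multiset.map_map]
  have : V.attach.val.map (fun v : V ↦ b v.1) = V.val.map b :=
    Multiset.attach_map_val' V.val b
  rw [← this]
  exact Multiset.map_congr rfl fun v _ ↦ hmult v

end Multiplicities

/-! ### Regular local rings and families generating prime ideals -/

section Regular

/-- A finite family generating the maximal ideal of a local ring, with as many members as the
dimension. -/
structure IsParameterFamily {ι R : Type*} [CommRing R] [IsLocalRing R] (t : ι → R) : Prop where
  span_range : Ideal.span (Set.range t) = maximalIdeal R
  card_eq : ((Nat.card ι : ℕ) : WithBot ℕ∞) = ringKrullDim R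

lemma span_image_union_compl {ι R : Type*} [CommRing R] (t : ι → R) (S : Set ι) :
    Ideal.span (t '' S) ⊔ Ideal.span (Set.range fun j : (Sᶜ : Set ι) ↦ t j) =
      Ideal.span (Set.range t) := by
  rw [← Ideal.span_union]
  congr 1
  have : (Set.range fun j : (Sᶜ : Set ι) ↦ t j) = t '' Sᶜ := by
    ext; simp
  rw [this, ← Set.image_union, Set.union_compl_self, Set.image_univ]

/-- The quotient of a regular local ring by part of a regular system of parameters. -/
lemma IsParameterFamily.quotient {ι R : Type*} [Finite ι] [CommRing R] [IsLocalRing R]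
    [IsNoetherianRing R] {t : ι → R} (ht : IsParameterFamily t) (S : Set ι) :
    ∃ _ : IsLocalRing (R ⧸ Ideal.span (t '' S)),
      IsParameterFamily fun j : (Sᶜ : Set ι) ↦ Ideal.Quotient.mk (Ideal.span (t '' S)) (t j) := by
  classical
  have hle : Ideal.span (t '' S) ≤ maximalIdeal R := by
    rw [← ht.span_range]; exact Ideal.span_mono (Set.image_subset_range _ _)
  have hne : Ideal.span (t '' S) ≠ ⊤ := ne_top_of_le_ne_top (Ideal.IsPrime.ne_top inferInstance) hle
  have : Nontrivial (R ⧸ Ideal.span (t '' S)) := Ideal.Quotient.nontrivial_iff.mpr hne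
  have hloc : IsLocalRing (R ⧸ Ideal.span (t '' S)) :=
    .of_surjective' (Ideal.Quotient.mk _) Ideal.Quotient.mk_surjective
  have hspan : Ideal.span (Set.range fun j : (Sᶜ : Set ι) ↦
      Ideal.Quotient.mk (Ideal.span (t '' S)) (t j)) = maximalIdeal _ := by
    have h1 : maximalIdeal (R ⧸ Ideal.span (t '' S)) =
        (maximalIdeal R).map (Ideal.Quotient.mk (Ideal.span (t '' S))) :=
      (IsLocalRing.map_maximalIdeal_of_surjective _ Ideal.Quotient.mk_surjective).symm
    rw [h1, ← ht.span_range, ← span_image_union_compl t S, Ideal.map_sup, Ideal.map_quotient_self,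
      bot_sup_eq, Ideal.map_span, ← Set.range_comp]
    rfl
  refine ⟨hloc, hspan, le_antisymm ?_ ?_⟩
  -- Dividing by |S| elements lowers the dimension by at most |S|. Conversely, the dimension is at
  -- most the number of remaining generators of the maximal ideal.
  · have h1 := ringKrullDim_le_ringKrullDim_quotient_add_spanFinrank (I := Ideal.span (t '' S))
      (by rw [IsLocalRing.ringJacobson_eq_maximalIdeal]; exact hle)
    have h2 : (Ideal.span (t '' S)).spanFinrank ≤ Nat.card S := by
      refine (Submodule.spanFinrank_span_le_ncard_of_finite (Set.toFinite _)).trans ?_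
      exact Set.ncard_image_le (Set.toFinite _)
    rw [← ht.card_eq] at h1
    have h3 : Nat.card ι = Nat.card (Sᶜ : Set ι) + Nat.card S := by
      rw [← Nat.card_congr (Equiv.Set.sumCompl S), Nat.card_sum, add_comm]
    have h4 : ((Nat.card ι : ℕ) : WithBot ℕ∞) ≤
        ringKrullDim (R ⧸ Ideal.span (t '' S)) + (Nat.card S : ℕ) :=
      h1.trans (by gcongr)
    rw [h3, Nat.cast_add] at h4
    exact ENat.WithBot.add_le_add_natCast_right_iff.mp h4
  · refine (ringKrullDim_le_spanFinrank_maximalIdeal _).trans ?_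
    rw [← hspan]
    have := Submodule.spanFinrank_span_le_ncard_of_finite (R := R ⧸ Ideal.span (t '' S))
      (Set.finite_range fun j : (Sᶜ : Set ι) ↦
      Ideal.Quotient.mk (Ideal.span (t '' S)) (t j))
    refine (Nat.cast_le.mpr this).trans (Nat.cast_le.mpr ?_)
    rw [← Set.image_univ, ← Set.ncard_univ]
    exact Set.ncard_image_le (Set.toFinite _)

/-- Regular local rings are domains. -/
lemma IsParameterFamily.isDomain {ι R : Type*} [Finite ι] [CommRing R] [IsLocalRing R]
    [IsNoetherianRing R] {t : ι → R} (ht : IsParameterFamily t) : IsDomain R := by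
  classical
  induction h : Nat.card ι generalizing ι R with
  | zero =>
    have : IsEmpty ι := (Nat.card_eq_zero.mp h).resolve_right (by simpa using ‹Finite ι›)
    have h0 : maximalIdeal R = ⊥ := by
      rw [← ht.span_range, Set.range_eq_empty, Ideal.span_empty]
    exact (isField_iff_maximalIdeal_eq.mpr h0).isDomain
  | succ n ih =>
    have hdim : ringKrullDim R = (n + 1 : ℕ) := by rw [← ht.card_eq, h]
    have hnmin : maximalIdeal R ∉ minimalPrimes R := by
      intro hm
      have h1 : (maximalIdeal R).height = 0 := by
        rwa [Ideal.height_eq_zero_iff]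
      have h2 := IsLocalRing.maximalIdeal_height_eq_ringKrullDim (R := R)
      rw [h1, hdim] at h2
      have h3 : ((0 : ℕ) : WithBot ℕ∞) = ((n + 1 : ℕ) : WithBot ℕ∞) := by exact_mod_cast h2
      exact absurd (by exact_mod_cast h3 : (0 : ℕ) = n + 1) (by omega)
    -- Prime avoidance, in which the ideal 𝔪² need not be prime. The inclusion 𝔪 ⊆ 𝔪² would force 𝔪
    -- = 0 by Nakayama, contrary to the positive dimension.
    obtain ⟨x, hxm, hx2, hxmin⟩ : ∃ x ∈ maximalIdeal R, x ∉ maximalIdeal R ^ 2 ∧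
        ∀ p ∈ minimalPrimes R, x ∉ p := by
      by_contra hcon
      push Not at hcon
      have hfin := minimalPrimes.finite_of_isNoetherianRing R
      have hsub : ((maximalIdeal R : Ideal R) : Set R) ⊆
          ⋃ i ∈ (↑(insert (maximalIdeal R ^ 2) hfin.toFinset) : Set (Ideal R)), (i : Set R) := by
        intro x hx
        by_cases hx2 : x ∈ maximalIdeal R ^ 2
        · exact Set.mem_biUnion (by simp) hx2
        · obtain ⟨p, hp, hxp⟩ := hcon x hx hx2
          exact Set.mem_biUnion (by simp [hp]) hxp
      rw [Ideal.subset_union_prime (f := fun i ↦ i) (maximalIdeal R ^ 2) (maximalIdeal R ^ 2)] at hsub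
      · obtain ⟨i, hi, hle⟩ := hsub
        rw [Finset.mem_insert] at hi
        rcases hi with rfl | hi
        · have hbot : maximalIdeal R = ⊥ := by
            refine Submodule.eq_bot_of_le_smul_of_le_jacobson_bot (maximalIdeal R)
              (maximalIdeal R) (IsNoetherian.noetherian _) ?_
              (IsLocalRing.maximalIdeal_le_jacobson _)
            rw [smul_eq_mul, ← pow_two]; exact hle
          have hdom := (isField_iff_maximalIdeal_eq.mpr hbot).isDomain
          exact hnmin (by rw [hbot, IsDomain.minimalPrimes_eq_singleton_bot]; rfl)
        · have hi' : i ∈ minimalPrimes R := by simpa using hi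
          have hip : i.IsPrime := hi'.1.1
          have : maximalIdeal R = i := le_antisymm hle (le_maximalIdeal hip.ne_top)
          exact hnmin (this ▸ hi')
      · intro i hi h1 _
        rw [Finset.mem_insert] at hi
        exact (by simpa using hi.resolve_left h1 : i ∈ minimalPrimes R).1.1
    have hxspan : x ∈ Ideal.span (Set.range t) := ht.span_range ▸ hxm
    have : Fintype ι := Fintype.ofFinite ι
    obtain ⟨c, hc⟩ := (Ideal.mem_span_range_iff_exists_fun).mp hxspan
    have htm (i : ι) : t i ∈ maximalIdeal R := ht.span_range ▸ Ideal.subset_span ⟨i, rfl⟩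
    -- Because x is not in 𝔪², one of its coefficients is a unit, so x can replace the corresponding
    -- parameter.
    obtain ⟨i, hi⟩ : ∃ i, IsUnit (c i) := by
      by_contra hcon
      push Not at hcon
      refine hx2 ?_
      rw [← hc, pow_two]
      exact Ideal.sum_mem _ fun i _ ↦ Ideal.mul_mem_mul ((mem_maximalIdeal _).mpr (hcon i)) (htm i)
    let s : ι → R := Function.update t i x
    have hs : IsParameterFamily s := by
      refine ⟨le_antisymm ?_ ?_, ht.card_eq⟩
      · rw [Ideal.span_le]
        rintro _ ⟨j, rfl⟩
        by_cases hj : j = i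
        · subst hj; simpa [s] using hxm
        · simpa [s, hj] using htm j
      · rw [← ht.span_range, Ideal.span_le]
        have hj (j : ι) (hj : j ≠ i) : t j ∈ Ideal.span (Set.range s) :=
          Ideal.subset_span ⟨j, by simp [s, hj]⟩
        rintro _ ⟨j, rfl⟩
        by_cases hji : j = i
        · subst hji
          rw [SetLike.mem_coe, ← Ideal.unit_mul_mem_iff_mem _ hi]
          have : c j * t j = x - ∑ l ∈ Finset.univ.erase j, c l * t l := by
            rw [← hc, ← Finset.add_sum_erase _ _ (Finset.mem_univ j)]; ring
          rw [this]
          refine Ideal.sub_mem _ (Ideal.subset_span ⟨j, by simp [s]⟩) (Ideal.sum_mem _ fun l hl ↦ ?_)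
          exact Ideal.mul_mem_left _ _ (hj l (Finset.ne_of_mem_erase hl))
        · exact hj j hji
    obtain ⟨hloc, hq⟩ := hs.quotient {i}
    have himg : s '' {i} = {x} := by simp [s]
    have hdomq : IsDomain (R ⧸ Ideal.span (s '' {i})) := by
      refine ih hq ?_
      have h3 : Nat.card ι = Nat.card (({i} : Set ι)ᶜ : Set ι) + Nat.card ({i} : Set ι) := by
        rw [← Nat.card_congr (Equiv.Set.sumCompl ({i} : Set ι)), Nat.card_sum, add_comm]
      have h4 : Nat.card ({i} : Set ι) = 1 := by simp
      omega
    rw [himg] at hdomq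
    have hprime : (Ideal.span {x}).IsPrime := (Ideal.Quotient.isDomain_iff_prime _).mp hdomq
    -- By induction (x) is prime. For a minimal prime p inside (x), each y = xz in p has z in p
    -- because x is not in p. Hence p ⊆ 𝔪p, and p = 0 by Nakayama.
    obtain ⟨p, hp, hpx⟩ := Ideal.exists_minimalPrimes_le (I := ⊥) (J := Ideal.span {x}) bot_le
    have hpp : p.IsPrime := hp.1.1
    have hxp : x ∉ p := hxmin p hp
    have hbot : p = ⊥ := by
      refine Submodule.eq_bot_of_le_smul_of_le_jacobson_bot (maximalIdeal R) p
        (IsNoetherian.noetherian _) ?_ (IsLocalRing.maximalIdeal_le_jacobson _)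
      intro y hy
      obtain ⟨z, rfl⟩ := Ideal.mem_span_singleton.mp (hpx hy)
      exact Submodule.smul_mem_smul hxm ((hpp.mem_or_mem hy).resolve_left hxp)
    rw [hbot] at hpp
    exact IsDomain.of_bot_isPrime R

/-- A family of elements such that all its subfamilies generate distinct prime ideals. -/
structure IsPrimeFamily {ι R : Type*} [CommRing R] (t : ι → R) : Prop where
  isPrime (S : Set ι) : (Ideal.span (t '' S)).IsPrime
  notMem (S : Set ι) (j : ι) (hj : j ∉ S) : t j ∉ Ideal.span (t '' S)

/-- Each quotient by part of the parameters is again regular local, hence a domain. A further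
parameter cannot already lie in the ideal, since dividing by it lowers the dimension. -/
lemma IsParameterFamily.isPrimeFamily {ι R : Type*} [Finite ι] [CommRing R] [IsLocalRing R]
    [IsNoetherianRing R] {t : ι → R} (ht : IsParameterFamily t) : IsPrimeFamily t where
  isPrime S := by
    obtain ⟨hloc, hq⟩ := ht.quotient S
    exact (Ideal.Quotient.isDomain_iff_prime _).mp hq.isDomain
  notMem S j hj hmem := by
    obtain ⟨hloc, hq⟩ := ht.quotient S
    obtain ⟨hloc', hq'⟩ := ht.quotient (insert j S)
    have heq : Ideal.span (t '' insert j S) = Ideal.span (t '' S) := by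
      rw [Set.image_insert_eq, Ideal.span_insert, sup_eq_right, Ideal.span_singleton_le_iff_mem]
      exact hmem
    have h1 := hq.card_eq
    have h2 := hq'.card_eq
    rw [ringKrullDim_eq_of_ringEquiv (Ideal.quotEquivOfEq heq), ← h1] at h2
    have h3 : Nat.card ((insert j S)ᶜ : Set ι) = Nat.card (Sᶜ : Set ι) := by exact_mod_cast h2
    rw [Nat.card_coe_set_eq, Nat.card_coe_set_eq] at h3
    have h4 : (insert j S)ᶜ ⊂ Sᶜ := by
      rw [Set.ssubset_iff_subset_ne, Set.compl_subset_compl]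
      refine ⟨Set.subset_insert _ _, fun h ↦ ?_⟩
      have : j ∈ (insert j S)ᶜ := h ▸ hj
      exact this (Set.mem_insert _ _)
    exact (Set.ncard_lt_ncard h4 (Set.toFinite _)).ne h3

lemma IsRegularSystemOfParameters.isParameterFamily {R : Type u} [CommRing R] [IsLocalRing R]
    {d : ℕ} {t : Fin d → R} (ht : IsRegularSystemOfParameters t) : IsParameterFamily t :=
  ⟨ht.span_range, by simpa using ht.card_eq⟩

namespace IsPrimeFamily

variable {ι κ R : Type*} [CommRing R] {t : ι → R}

lemma comp (ht : IsPrimeFamily t) {f : κ → ι} (hf : Function.Injective f) :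
    IsPrimeFamily fun j ↦ t (f j) where
  isPrime S := by
    rw [← Set.image_image t f S]; exact ht.isPrime _
  notMem S j hj := by
    rw [← Set.image_image t f S]
    exact ht.notMem _ _ (by rwa [hf.mem_set_image])

lemma isDomain (ht : IsPrimeFamily t) : IsDomain R := by
  have := ht.isPrime ∅
  rw [Set.image_empty, Ideal.span_empty] at this
  exact IsDomain.of_bot_isPrime R

lemma ne_zero (ht : IsPrimeFamily t) (i : ι) : t i ≠ 0 := fun h ↦
  ht.notMem ∅ i (Set.notMem_empty i) (h ▸ zero_mem _)

lemma prime (ht : IsPrimeFamily t) (i : ι) : Prime (t i) := by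
  rw [← Ideal.span_singleton_prime (ht.ne_zero i)]
  simpa using ht.isPrime {i}

lemma eq_of_dvd (ht : IsPrimeFamily t) {i j : ι} (h : t i ∣ t j) : i = j := by
  by_contra hij
  refine ht.notMem {i} j (fun h ↦ hij h.symm) ?_
  rwa [Set.image_singleton, Ideal.mem_span_singleton]

lemma image_span {R' : Type*} [CommRing R'] (g : R →+* R') (S : Set ι) :
    Ideal.span ((fun i ↦ g (t i)) '' S) = (Ideal.span (t '' S)).map g := by
  rw [Ideal.map_span, Set.image_image]

lemma localization (ht : IsPrimeFamily t) (M : Submonoid R) {R' : Type*} [CommRing R']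
    [Algebra R R'] [IsLocalization M R'] (hM : ∀ m ∈ M, m ∉ Ideal.span (Set.range t)) :
    IsPrimeFamily fun i ↦ algebraMap R R' (t i) := by
  have hdisj (S : Set ι) : Disjoint (M : Set R) (Ideal.span (t '' S) : Set R) := by
    rw [Set.disjoint_left]
    intro m hm hm'
    exact hM m hm (Ideal.span_mono (Set.image_subset_range _ _) hm')
  refine ⟨fun S ↦ ?_, fun S j hj hmem ↦ ?_⟩
  · rw [image_span]
    exact IsLocalization.isPrime_of_isPrime_disjoint M R' _ (ht.isPrime S) (hdisj S)
  · rw [image_span] at hmem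
    have : t j ∈ ((Ideal.span (t '' S)).map (algebraMap R R')).comap (algebraMap R R') := hmem
    rw [← Ideal.under_def, IsLocalization.under_map_of_isPrime_disjoint M R' (ht.isPrime S) (hdisj S)] at this
    exact ht.notMem S j hj this

/-- A family that is prime in a local ring of `R` is prime in a localization at one element. -/
lemma exists_away [Finite ι] [IsNoetherianRing R] (p : Ideal R) [p.IsPrime] {R' : Type*}
    [CommRing R'] [Algebra R R'] [IsLocalization.AtPrime R' p] (htp : ∀ i, t i ∈ p)
    (ht : IsPrimeFamily fun i ↦ algebraMap R R' (t i)) :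
    ∃ f ∉ p, ∀ (A : Type*) [CommRing A] [Algebra R A] [IsLocalization.Away f A],
      IsPrimeFamily fun i ↦ algebraMap R A (t i) := by
  classical
  -- `P S` consists of the elements of `R` that lie in the ideal of the local ring. It is prime and
  -- finitely generated, so one denominator outside p carries it into the ideal generated by the t_i
  -- with i ∈ S.
  let P (S : Set ι) : Ideal R :=
    (Ideal.span ((fun i ↦ algebraMap R R' (t i)) '' S)).comap (algebraMap R R')
  have hPprime (S : Set ι) : (P S).IsPrime :=
    have := ht.isPrime S
    Ideal.comap_isPrime _ _
  have hspanP (S : Set ι) : Ideal.span (t '' S) ≤ P S := by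
    rw [← Ideal.map_le_iff_le_comap, image_span]
  have hPp (S : Set ι) : P S ≤ p := by
    intro x hx
    have h1 : algebraMap R R' x ∈ p.map (algebraMap R R') := by
      have h2 : algebraMap R R' x ∈ Ideal.span ((fun i ↦ algebraMap R R' (t i)) '' S) := hx
      rw [image_span] at h2
      refine Ideal.map_mono ?_ h2
      rw [Ideal.span_le]; rintro _ ⟨i, -, rfl⟩; exact htp i
    have h3 : x ∈ (p.map (algebraMap R R')).comap (algebraMap R R') := h1
    rwa [← Ideal.under_def, IsLocalization.under_map_of_isPrime_disjoint p.primeCompl R' ‹_›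
      (by rw [Set.disjoint_left]; exact fun _ h ↦ h)] at h3
  have hex (S : Set ι) : ∃ s ∉ p, ∀ x ∈ P S, s * x ∈ Ideal.span (t '' S) := by
    obtain ⟨G, hG⟩ := IsNoetherian.noetherian (P S)
    have h1 (x : R) (hx : x ∈ P S) : ∃ s ∉ p, s * x ∈ Ideal.span (t '' S) := by
      have h2 : algebraMap R R' x ∈ Ideal.span ((fun i ↦ algebraMap R R' (t i)) '' S) := hx
      rw [image_span, IsLocalization.algebraMap_mem_map_algebraMap_iff p.primeCompl] at h2
      obtain ⟨m, hm, h⟩ := h2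
      exact ⟨m, hm, h⟩
    choose! s hs hs' using h1
    refine ⟨∏ x ∈ G, s x, ?_, ?_⟩
    · rw [Ideal.IsPrime.prod_mem_iff]
      rintro ⟨x, hx, h⟩
      exact hs x (hG ▸ Ideal.subset_span hx) h
    · intro x hx
      have : P S ≤ Submodule.comap (LinearMap.mulLeft R (∏ x ∈ G, s x))
          (Ideal.span (t '' S)) := by
        rw [← hG, Submodule.span_le]
        intro y hy
        change (∏ x ∈ G, s x) * y ∈ Ideal.span (t '' S)
        rw [← Finset.mul_prod_erase _ _ hy, mul_right_comm]
        exact Ideal.mul_mem_right _ _ (hs' y (hG ▸ Ideal.subset_span hy))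
      exact this hx
  choose s hs hs' using hex
  have : Fintype (Set ι) := Fintype.ofFinite _
  -- There are finitely many subsets S, so inverting one product handles all of them.
  have hf : ∏ S : Set ι, s S ∉ p := by
    rw [Ideal.IsPrime.prod_mem_iff]
    rintro ⟨S, -, h⟩
    exact hs S h
  refine ⟨∏ S : Set ι, s S, hf, fun A _ _ _ ↦ ?_⟩
  have hdisj (S : Set ι) : Disjoint (Submonoid.powers (∏ S : Set ι, s S) : Set R) (P S : Set R) := by
    rw [Set.disjoint_left]
    rintro _ ⟨n, rfl⟩ h
    exact hf (hPp S ((hPprime S).mem_of_pow_mem _ h))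
  have hmap (S : Set ι) : Ideal.span ((fun i ↦ algebraMap R A (t i)) '' S) =
      (P S).map (algebraMap R A) := by
    rw [image_span]
    refine le_antisymm (Ideal.map_mono (hspanP S)) ?_
    rw [Ideal.map_le_iff_le_comap]
    intro x hx
    have hu : IsUnit (algebraMap R A (∏ S : Set ι, s S)) := IsLocalization.Away.algebraMap_isUnit _
    rw [Ideal.mem_comap, ← Ideal.unit_mul_mem_iff_mem _ hu, ← map_mul]
    refine Ideal.mem_map_of_mem _ ?_
    rw [← Finset.mul_prod_erase _ _ (Finset.mem_univ S), mul_right_comm]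
    exact Ideal.mul_mem_right _ _ (hs' S x hx)
  refine ⟨fun S ↦ ?_, fun S j hj hmem ↦ ?_⟩
  · rw [hmap]
    exact IsLocalization.isPrime_of_isPrime_disjoint (.powers (∏ S : Set ι, s S)) A _ (hPprime S)
      (hdisj S)
  · rw [hmap] at hmem
    have h1 : t j ∈ ((P S).map (algebraMap R A)).comap (algebraMap R A) := hmem
    rw [← Ideal.under_def, IsLocalization.under_map_of_isPrime_disjoint
      (.powers (∏ S : Set ι, s S)) A (hPprime S) (hdisj S)] at h1
    exact ht.notMem S j hj h1

/-- The members of a prime family and the variables form a prime family of the polynomial ring. -/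
lemma mvPolynomial (ht : IsPrimeFamily t) (σ : Type*) :
    IsPrimeFamily (Sum.elim (fun i ↦ MvPolynomial.C (t i)) MvPolynomial.X :
      ι ⊕ σ → MvPolynomial σ R) := by
  classical
  have key (S : Set (ι ⊕ σ)) : ∃ φ : MvPolynomial σ R →+* MvPolynomial σ
      (R ⧸ Ideal.span (t '' (Sum.inl ⁻¹' S))),
      RingHom.ker φ = Ideal.span ((Sum.elim (fun i ↦ MvPolynomial.C (t i)) MvPolynomial.X) '' S) ∧
      (∀ i, φ (MvPolynomial.C (t i)) =
        MvPolynomial.C (Ideal.Quotient.mk (Ideal.span (t '' (Sum.inl ⁻¹' S))) (t i))) ∧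
      ∀ i, φ (MvPolynomial.X i) = if Sum.inr i ∈ S then 0 else MvPolynomial.X i := by
    let I := Ideal.span (t '' (Sum.inl ⁻¹' S))
    -- The quotient by the chosen members is realized as a polynomial ring over a domain: ψ sets the
    -- chosen variables to 0, then μ reduces the coefficients.
    let ψ : MvPolynomial σ R →ₐ[R] MvPolynomial σ R :=
      MvPolynomial.aeval fun i ↦ if Sum.inr i ∈ S then 0 else MvPolynomial.X i
    let μ : MvPolynomial σ R →+* MvPolynomial σ (R ⧸ I) := MvPolynomial.map (Ideal.Quotient.mk I)
    let J := Ideal.span ((Sum.elim (fun i ↦ MvPolynomial.C (t i)) MvPolynomial.X :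
      ι ⊕ σ → MvPolynomial σ R) '' S)
    have hC (i) : μ.comp ψ.toRingHom (MvPolynomial.C (t i)) =
        MvPolynomial.C (Ideal.Quotient.mk I (t i)) := by
      simp [μ, ψ]
    have hX (i) : μ.comp ψ.toRingHom (MvPolynomial.X i) =
        if Sum.inr i ∈ S then 0 else MvPolynomial.X i := by
      simp only [μ, ψ, RingHom.comp_apply, AlgHom.toRingHom_eq_coe, RingHom.coe_coe,
        MvPolynomial.aeval_X]
      split_ifs <;> simp
    refine ⟨μ.comp ψ.toRingHom, le_antisymm ?_ ?_, hC, hX⟩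
    · intro x hx
      have h1 : ψ x ∈ J := by
        have h2 : ψ x ∈ RingHom.ker μ := hx
        rw [MvPolynomial.ker_map, Ideal.mk_ker, Ideal.map_span] at h2
        refine Ideal.span_mono ?_ h2
        rintro _ ⟨_, ⟨i, hi, rfl⟩, rfl⟩
        exact ⟨_, hi, rfl⟩
      -- Modulo J the substitution ψ is the identity, so an element with image in J lies in J
      -- itself.
      have h2 : (Ideal.Quotient.mkₐ R J).comp ψ = Ideal.Quotient.mkₐ R J := by
        refine MvPolynomial.algHom_ext fun i ↦ ?_
        simp only [ψ, AlgHom.comp_apply, MvPolynomial.aeval_X]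
        split_ifs with h
        · rw [map_zero]
          exact (Ideal.Quotient.eq_zero_iff_mem.mpr (Ideal.subset_span (Set.mem_image_of_mem _ h))).symm
        · rfl
      have h3 : Ideal.Quotient.mk J (ψ x) = Ideal.Quotient.mk J x := congr($h2 x)
      rw [Ideal.Quotient.eq_zero_iff_mem.mpr h1] at h3
      exact Ideal.Quotient.eq_zero_iff_mem.mp h3.symm
    · rw [Ideal.span_le]
      rintro _ ⟨i | i, hi, rfl⟩
      · rw [SetLike.mem_coe, RingHom.mem_ker, Sum.elim_inl, hC,
          Ideal.Quotient.eq_zero_iff_mem.mpr (Ideal.subset_span (Set.mem_image_of_mem t hi)), map_zero]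
      · rw [SetLike.mem_coe, RingHom.mem_ker, Sum.elim_inr, hX, if_pos hi]
  refine ⟨fun S ↦ ?_, fun S j hj hmem ↦ ?_⟩
  · obtain ⟨φ, hker, -⟩ := key S
    have := ht.isPrime (Sum.inl ⁻¹' S)
    rw [← hker]
    exact RingHom.ker_isPrime φ
  · obtain ⟨φ, hker, hC, hX⟩ := key S
    rw [← hker, RingHom.mem_ker] at hmem
    have := ht.isPrime (Sum.inl ⁻¹' S)
    rcases j with j | j
    · rw [Sum.elim_inl, hC, MvPolynomial.C_eq_zero, Ideal.Quotient.eq_zero_iff_mem] at hmem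
      exact ht.notMem _ j hj hmem
    · rw [Sum.elim_inr, hX, if_neg hj] at hmem
      exact MvPolynomial.X_ne_zero _ hmem

/-- Every list of distinct members of a prime family is a weakly regular sequence. -/
lemma isWeaklyRegular (ht : IsPrimeFamily t) {l : List ι} (hl : l.Nodup) :
    RingTheory.Sequence.IsWeaklyRegular R (l.map t) := by
  refine ⟨fun i hi ↦ ?_⟩
  have hi' : i < l.length := by simpa using hi
  have hspan : Ideal.ofList ((l.map t).take i) = Ideal.span (t '' {j | j ∈ l.take i}) := by
    rw [← List.map_take, Ideal.ofList]
    congr 1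
    ext x
    rw [Set.mem_ofPred_eq, List.mem_map]; rfl
  have hnot : l[i] ∉ {j | j ∈ l.take i} := by
    intro h
    obtain ⟨j, hj, h⟩ := List.mem_take_iff_getElem.mp h
    have := (List.Nodup.getElem_inj_iff hl).mp h
    omega
  have hp := ht.isPrime {j | j ∈ l.take i}
  rw [isSMulRegular_iff_right_eq_zero_of_smul]
  intro x hx
  obtain ⟨x, rfl⟩ := Submodule.Quotient.mk_surjective _ x
  rw [← Submodule.Quotient.mk_smul, Submodule.Quotient.mk_eq_zero, smul_eq_mul, smul_eq_mul,
    Ideal.mul_top, hspan, List.getElem_map] at hx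
  rw [Submodule.Quotient.mk_eq_zero, smul_eq_mul, Ideal.mul_top, hspan]
  exact (hp.mem_or_mem hx).resolve_left (ht.notMem _ _ hnot)

end IsPrimeFamily

/-- The first member of a weakly regular sequence in a Noetherian ring is regular modulo the
others. -/
lemma mem_ofList_of_mul_mem {R : Type*} [CommRing R] [IsNoetherianRing R] {x : R} {fs : List R}
    (h : RingTheory.Sequence.IsWeaklyRegular R (x :: fs)) {b : R} (hb : x * b ∈ Ideal.ofList fs) :
    b ∈ Ideal.ofList fs := by
  -- At a maximal ideal containing the whole sequence, the sequence may be permuted, which moves x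
  -- to the end. At any other, either x is a unit or the ideal of the remaining members is
  -- everything.
  refine Ideal.mem_of_localization_maximal fun P hP ↦ ?_
  set g := algebraMap R (Localization.AtPrime P)
  have hb' : g x * g b ∈ (Ideal.ofList fs).map g := by
    rw [← map_mul]; exact Ideal.mem_map_of_mem _ hb
  by_cases hx : x ∈ P
  · by_cases hfs : ∀ f ∈ fs, f ∈ P
    · have h1 := RingTheory.Sequence.IsWeaklyRegular.of_isLocalization (Localization.AtPrime P)
        P.primeCompl h
      rw [List.map_cons] at h1
      have hmem (r) (hr : r ∈ P) : g r ∈ maximalIdeal (Localization.AtPrime P) := by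
        rw [← Localization.AtPrime.map_eq_maximalIdeal]
        exact Ideal.mem_map_of_mem _ hr
      have h2 := IsLocalRing.isWeaklyRegular_of_perm_of_subset_maximalIdeal h1
        (List.perm_append_singleton (g x) (fs.map g)).symm (by
          intro r hr
          rw [List.mem_cons] at hr
          rcases hr with rfl | hr
          · exact hmem x hx
          · obtain ⟨f, hf, rfl⟩ := List.mem_map.mp hr
            exact hmem f (hfs f hf))
      rw [RingTheory.Sequence.isWeaklyRegular_append_iff,
        RingTheory.Sequence.isWeaklyRegular_singleton_iff,
        isSMulRegular_iff_right_eq_zero_of_smul] at h2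
      have h3 := h2.2 (Submodule.Quotient.mk (g b))
      rw [← Submodule.Quotient.mk_smul, Submodule.Quotient.mk_eq_zero, smul_eq_mul,
        Submodule.Quotient.mk_eq_zero, smul_eq_mul, Ideal.mul_top, ← Ideal.map_ofList] at h3
      exact h3 hb'
    · push Not at hfs
      obtain ⟨f, hf, hfP⟩ := hfs
      have : (Ideal.ofList fs).map g = ⊤ :=
        Ideal.eq_top_of_isUnit_mem _ (Ideal.mem_map_of_mem g (Ideal.subset_span hf))
          (IsLocalization.map_units (M := P.primeCompl) (Localization.AtPrime P) ⟨f, hfP⟩)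
      rw [this]; trivial
  · exact (Ideal.unit_mul_mem_iff_mem _
      (IsLocalization.map_units (M := P.primeCompl) (Localization.AtPrime P) ⟨x, hx⟩)).mp hb'

end Regular

/-! ### The affine charts of a blowup -/

section ChartRing

variable {ι A : Type*} [CommRing A]

/-- The ideal of relations `t i = t w * X i`, for `i ∈ σ`. -/
abbrev chartIdeal (t : ι → A) (σ : Set ι) (w : ι) : Ideal (MvPolynomial σ A) :=
  Ideal.span (Set.range fun i : σ ↦
    MvPolynomial.C (t i) - MvPolynomial.C (t w) * MvPolynomial.X i)

/-- The coordinate ring of an affine chart of the blowup along the ideal generated by `t w` and the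
`t i` with `i ∈ σ`. -/
abbrev ChartRing (t : ι → A) (σ : Set ι) (w : ι) : Type _ :=
  MvPolynomial σ A ⧸ chartIdeal t σ w

open Classical in
/-- The elements of the polynomial ring that lift the coordinates of the chart. -/
def chartLift (t : ι → A) (σ : Set ι) (j : ι) : MvPolynomial σ A :=
  if h : j ∈ σ then MvPolynomial.X ⟨j, h⟩ else MvPolynomial.C (t j)

/-- The coordinates of the chart: the strict transforms of the `t j` with `j ≠ w`, and `t w`. -/
def chartCoord (t : ι → A) (σ : Set ι) (w : ι) (j : ι) : ChartRing t σ w :=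
  Ideal.Quotient.mk _ (chartLift t σ j)

variable {t : ι → A} {σ : Set ι} {w : ι}

lemma chartLift_of_mem {j : ι} (h : j ∈ σ) : chartLift t σ j = MvPolynomial.X ⟨j, h⟩ := dif_pos h

lemma chartLift_of_notMem {j : ι} (h : j ∉ σ) : chartLift t σ j = MvPolynomial.C (t j) := dif_neg h

lemma chartCoord_of_notMem {j : ι} (h : j ∉ σ) :
    chartCoord t σ w j = algebraMap A (ChartRing t σ w) (t j) := by
  rw [chartCoord, chartLift_of_notMem h]; rfl

lemma algebraMap_eq_mul_chartCoord {j : ι} (h : j ∈ σ) :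
    algebraMap A (ChartRing t σ w) (t j) =
      algebraMap A (ChartRing t σ w) (t w) * chartCoord t σ w j := by
  rw [chartCoord, chartLift_of_mem h]
  refine Ideal.Quotient.eq.mpr (Ideal.subset_span ⟨⟨j, h⟩, rfl⟩)

/-- On the chart Xᵢ stands for tᵢ/t_w, and a power of t_w clears the denominators. -/
lemma exists_pow_mul_sub_mem_chartIdeal (b : MvPolynomial σ A) :
    ∃ (n : ℕ) (a : A), MvPolynomial.C (t w) ^ n * b - MvPolynomial.C a ∈ chartIdeal t σ w := by
  induction b using MvPolynomial.induction_on with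
  | C a => exact ⟨0, a, by simp⟩
  | add p q hp hq =>
    obtain ⟨n, a, hn⟩ := hp
    obtain ⟨m, c, hm⟩ := hq
    refine ⟨n + m, t w ^ m * a + t w ^ n * c, ?_⟩
    have := Ideal.add_mem _ (Ideal.mul_mem_left _ (MvPolynomial.C (t w) ^ m) hn)
      (Ideal.mul_mem_left _ (MvPolynomial.C (t w) ^ n) hm)
    refine (congrArg (· ∈ chartIdeal t σ w) ?_).mp this
    simp only [map_add, map_mul, map_pow]
    ring
  | mul_X p i hp =>
    obtain ⟨n, a, hn⟩ := hp
    refine ⟨n + 1, a * t i, ?_⟩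
    have h1 : MvPolynomial.C (t i) - MvPolynomial.C (t w) * MvPolynomial.X i ∈ chartIdeal t σ w :=
      Ideal.subset_span ⟨i, rfl⟩
    have := Ideal.sub_mem _ (Ideal.mul_mem_left _ (MvPolynomial.C (t w) * MvPolynomial.X i) hn)
      (Ideal.mul_mem_left _ (MvPolynomial.C a) h1)
    refine (congrArg (· ∈ chartIdeal t σ w) ?_).mp this
    simp only [map_mul]
    ring

/-- The inverse image in the polynomial ring of the ideal generated by some coordinates. -/
def chartLiftIdeal (t : ι → A) (σ : Set ι) (w : ι) (S : Set ι) : Ideal (MvPolynomial σ A) :=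
  Ideal.span (chartLift t σ '' S) ⊔ chartIdeal t σ w

lemma chartLift_mem {S : Set ι} {j : ι} (hj : j ∈ S) : chartLift t σ j ∈ chartLiftIdeal t σ w S :=
  Ideal.mem_sup_left (Ideal.subset_span ⟨j, hj, rfl⟩)

lemma C_sub_mem {S : Set ι} (i : σ) :
    MvPolynomial.C (t i) - MvPolynomial.C (t w) * MvPolynomial.X i ∈ chartLiftIdeal t σ w S :=
  Ideal.mem_sup_right (Ideal.subset_span ⟨i, rfl⟩)

lemma C_mem_chartLiftIdeal {S : Set ι} {j : ι} (hj : j ∈ S) :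
    MvPolynomial.C (t j) ∈ chartLiftIdeal t σ w S := by
  by_cases h : j ∈ σ
  · have := Ideal.add_mem _ (C_sub_mem (w := w) (t := t) (S := S) ⟨j, h⟩)
      (Ideal.mul_mem_left _ (MvPolynomial.C (t w)) (chartLift_mem (w := w) (t := t) (σ := σ) hj))
    rwa [chartLift_of_mem h, sub_add_cancel] at this
  · rw [← chartLift_of_notMem h]; exact chartLift_mem hj

/-- Once t_w is in the ideal, the relation tᵢ - t_w Xᵢ amounts to tᵢ. The ideal is then generated by
constants and variables from the prime family of the polynomial ring. -/
lemma IsPrimeFamily.isPrime_chartLiftIdeal_of_mem (ht : IsPrimeFamily t) {S : Set ι}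
    (hwS : w ∈ S) : (chartLiftIdeal t σ w S).IsPrime ∧
      ∀ j ∉ S, chartLift t σ j ∉ chartLiftIdeal t σ w S := by
  let S' : Set (ι ⊕ σ) := Sum.elim (· ∈ σ ∪ S) (fun i ↦ i.1 ∈ S)
  have hS' : chartLiftIdeal t σ w S = Ideal.span
      (Sum.elim (fun i ↦ MvPolynomial.C (t i)) MvPolynomial.X '' S') := by
    have hCw : (MvPolynomial.C (t w) : MvPolynomial σ A) ∈ chartLiftIdeal t σ w S :=
      C_mem_chartLiftIdeal hwS
    refine le_antisymm (sup_le ?_ ?_) ?_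
    · rw [Ideal.span_le]
      rintro _ ⟨j, hj, rfl⟩
      by_cases h : j ∈ σ
      · rw [chartLift_of_mem h]
        exact Ideal.subset_span ⟨.inr ⟨j, h⟩, hj, rfl⟩
      · rw [chartLift_of_notMem h]
        exact Ideal.subset_span ⟨.inl j, Or.inr hj, rfl⟩
    · rw [Ideal.span_le]
      rintro _ ⟨i, rfl⟩
      exact Ideal.sub_mem _ (Ideal.subset_span ⟨.inl i, Or.inl i.2, rfl⟩)
        (Ideal.mul_mem_right _ _ (Ideal.subset_span ⟨.inl w, Or.inr hwS, rfl⟩))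
    · rw [Ideal.span_le]
      rintro _ ⟨j | i, hj, rfl⟩
      · rcases hj with hj | hj
        · have := Ideal.add_mem _ (C_sub_mem (w := w) (t := t) (S := S) ⟨j, hj⟩)
            (Ideal.mul_mem_right (MvPolynomial.X ⟨j, hj⟩) _ hCw)
          rwa [sub_add_cancel] at this
        · exact C_mem_chartLiftIdeal hj
      · have := chartLift_mem (w := w) (t := t) (σ := σ) (S := S) hj
        rwa [chartLift_of_mem i.2] at this
  have hT := ht.mvPolynomial σ
  refine ⟨hS' ▸ hT.isPrime S', fun j hj ↦ ?_⟩
  rw [hS']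
  by_cases h : j ∈ σ
  · rw [chartLift_of_mem h]
    exact hT.notMem S' (.inr ⟨j, h⟩) hj
  · rw [chartLift_of_notMem h]
    exact hT.notMem S' (.inl j) (by rintro (h' | h'); exacts [h h', hj h'])

/-- The claim is that t_w is regular modulo the relations and the coordinates in S. The sequence
consisting of t_w, the relations and these coordinates is weakly regular, and
`mem_ofList_of_mul_mem` makes its first member regular modulo the others. -/
lemma IsPrimeFamily.mem_chartLiftIdeal_of_mul_mem [Finite ι] [IsNoetherianRing A]
    (ht : IsPrimeFamily t) (hw : w ∉ σ) {S : Set ι} (hwS : w ∉ S) {b : MvPolynomial σ A}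
    (hb : MvPolynomial.C (t w) * b ∈ chartLiftIdeal t σ w S) : b ∈ chartLiftIdeal t σ w S := by
  classical
  have : Fintype ι := Fintype.ofFinite ι
  let T : ι ⊕ σ → MvPolynomial σ A := Sum.elim (fun i ↦ MvPolynomial.C (t i)) MvPolynomial.X
  let l₁ : List σ := Finset.univ.toList
  let l₂ : List ι := S.toFinset.toList
  let c : ι → ι ⊕ σ := fun j ↦ if h : j ∈ σ then .inr ⟨j, h⟩ else .inl j
  have hc (j) : T (c j) = chartLift t σ j := by
    by_cases h : j ∈ σ
    · simp [c, h, T, chartLift_of_mem h]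
    · simp [c, h, T, chartLift_of_notMem h]
  have hcinj : Function.Injective c := by
    intro i j hij
    by_cases hi : i ∈ σ <;> by_cases hj : j ∈ σ <;> simp_all [c]
  let fs : List (MvPolynomial σ A) := l₁.map (fun i : σ ↦ MvPolynomial.C (t i.1) -
    MvPolynomial.C (t w) * MvPolynomial.X i) ++ l₂.map (chartLift t σ)
  have hfs : chartLiftIdeal t σ w S = Ideal.ofList fs := by
    rw [Ideal.ofList_append, sup_comm, chartLiftIdeal]
    congr 1
    · rw [Ideal.ofList]; congr 1; ext x; simp [l₂]
    · rw [Ideal.ofList, chartIdeal]; congr 1; ext x; simp [l₁]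
  rw [hfs] at hb ⊢
  refine mem_ofList_of_mul_mem ?_ hb
  -- Modulo t_w the relation tᵢ - t_w Xᵢ equals tᵢ, so after its first entry the sequence agrees
  -- with this list of distinct members of the prime family.
  let L : List (ι ⊕ σ) := .inl w :: (l₁.map (fun i : σ ↦ .inl i) ++ l₂.map c)
  have hL : L.Nodup := by
    refine List.nodup_cons.mpr ⟨?_, List.Nodup.append ?_ ?_ ?_⟩
    · rw [List.mem_append, List.mem_map, List.mem_map]
      rintro (⟨i, -, h⟩ | ⟨j, hj, h⟩)
      · exact hw (Sum.inl_injective h ▸ i.2)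
      · have hjS : j ∈ S := by simpa [l₂] using hj
        by_cases hjσ : j ∈ σ
        · simp [c, hjσ] at h
        · simp only [c, hjσ, dite_false] at h
          exact hwS (Sum.inl_injective h ▸ hjS)
    · exact (Finset.nodup_toList _).map fun i j h ↦ Subtype.ext (Sum.inl_injective h)
    · exact (Finset.nodup_toList _).map hcinj
    · rw [List.disjoint_left]
      intro x hx hx'
      obtain ⟨i, -, rfl⟩ := List.mem_map.mp hx
      obtain ⟨j, -, h⟩ := List.mem_map.mp hx'
      by_cases hjσ : j ∈ σ
      · simp [c, hjσ] at h
      · simp only [c, hjσ, dite_false] at h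
        exact hjσ (Sum.inl_injective h ▸ i.2)
  have hreg := (ht.mvPolynomial σ).isWeaklyRegular hL
  rw [List.map_cons, RingTheory.Sequence.isWeaklyRegular_cons_iff'] at hreg
  rw [RingTheory.Sequence.isWeaklyRegular_cons_iff']
  refine ⟨hreg.1, ?_⟩
  refine (congrArg (RingTheory.Sequence.IsWeaklyRegular _) ?_).mp hreg.2
  simp only [List.map_append, List.map_map, fs]
  congr 1
  · refine List.map_congr_left fun i _ ↦ ?_
    refine Ideal.Quotient.eq.mpr ?_
    simp only [Function.comp, Sum.elim_inl, sub_sub_cancel]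
    exact Ideal.mul_mem_right _ _ (Ideal.mem_span_singleton_self _)
  · refine List.map_congr_left fun j _ ↦ ?_
    simp only [Function.comp]
    exact congrArg _ (hc j)

/-- The ideal is the kernel of the map to the fraction field of A/(t_j, j ∈ S) with Xᵢ ↦ tᵢ/t_w,
which makes sense because t_w is nonzero there. -/
lemma IsPrimeFamily.isPrime_chartLiftIdeal_of_notMem [Finite ι] [IsNoetherianRing A]
    (ht : IsPrimeFamily t) (hw : w ∉ σ) {S : Set ι}
    (hwS : w ∉ S) : (chartLiftIdeal t σ w S).IsPrime ∧
      ∀ j ∉ S, chartLift t σ j ∉ chartLiftIdeal t σ w S := by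
  let p := Ideal.span (t '' S)
  have hp : p.IsPrime := ht.isPrime S
  let F := FractionRing (A ⧸ p)
  let ι₀ : A →+* F := (algebraMap (A ⧸ p) F).comp (Ideal.Quotient.mk p)
  have hι₀ (a : A) : ι₀ a = 0 ↔ a ∈ p := by
    rw [← Ideal.Quotient.eq_zero_iff_mem]
    exact map_eq_zero_iff _ (IsFractionRing.injective (A ⧸ p) F)
  have hι₀j (j : ι) (hj : j ∉ S) : ι₀ (t j) ≠ 0 := fun h ↦ ht.notMem S j hj ((hι₀ _).mp h)
  let φ : MvPolynomial σ A →+* F := MvPolynomial.eval₂Hom ι₀ fun i ↦ ι₀ (t i) / ι₀ (t w)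
  have hC (a : A) : φ (MvPolynomial.C a) = ι₀ a := by simp [φ]
  have hX (i : σ) : φ (MvPolynomial.X i) = ι₀ (t i) / ι₀ (t w) := by simp [φ]
  have hK : chartIdeal t σ w ≤ RingHom.ker φ := by
    rw [Ideal.span_le]
    rintro _ ⟨i, rfl⟩
    rw [SetLike.mem_coe, RingHom.mem_ker, map_sub, map_mul, hC, hC, hX,
      mul_div_cancel₀ _ (hι₀j w hwS), sub_self]
  have hker : chartLiftIdeal t σ w S = RingHom.ker φ := by
    refine le_antisymm (sup_le ?_ hK) ?_
    · rw [Ideal.span_le]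
      rintro _ ⟨j, hj, rfl⟩
      have h0 : ι₀ (t j) = 0 := (hι₀ _).mpr (Ideal.subset_span ⟨j, hj, rfl⟩)
      rw [SetLike.mem_coe, RingHom.mem_ker]
      by_cases h : j ∈ σ
      · rw [chartLift_of_mem h, hX, h0, zero_div]
      · rw [chartLift_of_notMem h, hC, h0]
    · intro b hb
      -- A kernel element times a power of t_w is congruent to a constant a, which must lie in p.
      -- The power of t_w is then cancelled one factor at a time.
      obtain ⟨n, a, h⟩ := exists_pow_mul_sub_mem_chartIdeal (t := t) (w := w) b
      have ha : a ∈ p := by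
        rw [← hι₀, ← hC]
        have := hK h
        rwa [RingHom.mem_ker, map_sub, map_mul, (RingHom.mem_ker).mp hb, mul_zero, zero_sub,
          neg_eq_zero] at this
      have ha' : MvPolynomial.C a ∈ chartLiftIdeal t σ w S := by
        have : p ≤ (chartLiftIdeal t σ w S).comap MvPolynomial.C := by
          rw [Ideal.span_le]
          rintro _ ⟨j, hj, rfl⟩
          exact C_mem_chartLiftIdeal hj
        exact this ha
      have hn : MvPolynomial.C (t w) ^ n * b ∈ chartLiftIdeal t σ w S := by
        have := Ideal.add_mem _ (Ideal.mem_sup_right h : _ ∈ chartLiftIdeal t σ w S) ha'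
        rwa [sub_add_cancel] at this
      clear h
      induction n with
      | zero => simpa using hn
      | succ n ih =>
        rw [pow_succ', mul_assoc] at hn
        exact ih (ht.mem_chartLiftIdeal_of_mul_mem hw hwS hn)
  rw [hker]
  refine ⟨RingHom.ker_isPrime φ, fun j hj ↦ ?_⟩
  rw [RingHom.mem_ker]
  by_cases h : j ∈ σ
  · rw [chartLift_of_mem h, hX]
    exact div_ne_zero (hι₀j j hj) (hι₀j w hwS)
  · rw [chartLift_of_notMem h, hC]
    exact hι₀j j hj

/-- The coordinates of a chart of the blowup along some members of a prime family form a prime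
family. -/
lemma IsPrimeFamily.chartCoord [Finite ι] [IsNoetherianRing A] (ht : IsPrimeFamily t)
    (hw : w ∉ σ) : IsPrimeFamily (chartCoord t σ w) := by
  have key (S : Set ι) : (chartLiftIdeal t σ w S).IsPrime ∧
      ∀ j ∉ S, chartLift t σ j ∉ chartLiftIdeal t σ w S := by
    by_cases hwS : w ∈ S
    · exact ht.isPrime_chartLiftIdeal_of_mem hwS
    · exact ht.isPrime_chartLiftIdeal_of_notMem hw hwS
  have hspan (S : Set ι) : Ideal.span (MotivicSerre.chartCoord t σ w '' S) =
      (chartLiftIdeal t σ w S).map (Ideal.Quotient.mk (chartIdeal t σ w)) := by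
    rw [chartLiftIdeal, Ideal.map_sup, Ideal.map_quotient_self, sup_bot_eq, Ideal.map_span,
      Set.image_image]
    rfl
  have hcomap (S : Set ι) : ((chartLiftIdeal t σ w S).map
      (Ideal.Quotient.mk (chartIdeal t σ w))).comap (Ideal.Quotient.mk (chartIdeal t σ w)) =
        chartLiftIdeal t σ w S := by
    rw [Ideal.comap_map_of_surjective' _ Ideal.Quotient.mk_surjective, Ideal.mk_ker, sup_eq_left]
    exact le_sup_right
  refine ⟨fun S ↦ ?_, fun S j hj hmem ↦ ?_⟩
  · rw [hspan]
    have := (key S).1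
    refine Ideal.map_isPrime_of_surjective Ideal.Quotient.mk_surjective ?_
    rw [Ideal.mk_ker]
    exact le_sup_right
  · refine (key S).2 j hj ?_
    rw [← hcomap, Ideal.mem_comap, ← hspan]
    exact hmem

end ChartRing

/-! ### Classes of affine varieties -/

section AffineVarieties

variable {k : Type u} [Field k]

lemma AlgVar.cls_eq_of_iso (V W : AlgVar k) (e : V.carrier ≅ W.carrier)
    (he : e.hom ≫ W.hom = V.hom) : V.cls = W.cls := by
  rw [AlgVar.cls, AlgVar.cls, Ideal.Quotient.eq]
  exact Ideal.subset_span (K0Rel.iso V W e he)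

/-- The spectrum of a finitely generated algebra, as a variety. -/
def AlgVar.spec (D : Type u) [CommRing D] [Algebra k D] [Algebra.FiniteType k D] : AlgVar k where
  carrier := Spec (CommRingCat.of D)
  hom := Spec.map (CommRingCat.ofHom (algebraMap k D))
  locallyOfFiniteType := by
    rw [HasRingHomProperty.Spec_iff (P := @LocallyOfFiniteType)]
    change (algebraMap k D).FiniteType
    rw [RingHom.finiteType_algebraMap]
    infer_instance

variable (D D' : Type u) [CommRing D] [Algebra k D] [Algebra.FiniteType k D]
  [CommRing D'] [Algebra k D'] [Algebra.FiniteType k D']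

lemma AlgVar.spec_cls_congr {D D'} [CommRing D] [Algebra k D] [Algebra.FiniteType k D]
    [CommRing D'] [Algebra k D'] [Algebra.FiniteType k D'] (e : D ≃ₐ[k] D') :
    (AlgVar.spec (k := k) D).cls = (AlgVar.spec (k := k) D').cls := by
  refine AlgVar.cls_eq_of_iso _ _ (Scheme.Spec.mapIso e.toRingEquiv.toCommRingCatIso.symm.op) ?_
  change Spec.map (CommRingCat.ofHom (e.symm : D' →+* D)) ≫
    Spec.map (CommRingCat.ofHom (algebraMap k D')) = Spec.map (CommRingCat.ofHom (algebraMap k D))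
  rw [← Spec.map_comp, ← CommRingCat.ofHom_comp]
  congr 2
  exact e.symm.toAlgHom.comp_algebraMap

lemma AlgVar.spec_mvPolynomial_pUnit_cls :
    (AlgVar.spec (k := k) (MvPolynomial PUnit.{u + 1} D)).cls =
      lefschetz k * (AlgVar.spec (k := k) D).cls := by
  rw [lefschetz, ← AlgVar.cls_prod]
  let f : Spec (CommRingCat.of D) ⟶ Spec (CommRingCat.of k) :=
    Spec.map (CommRingCat.ofHom (algebraMap k D))
  have hp := AffineSpace.isPullback_map (n := PUnit.{u + 1}) f
  refine AlgVar.cls_eq_of_iso _ _ ((AffineSpace.SpecIso PUnit.{u + 1} (.of D)).symm ≪≫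
    hp.isoPullback) ?_
  change ((AffineSpace.SpecIso PUnit.{u + 1} (.of D)).inv ≫ hp.isoPullback.hom) ≫
    pullback.fst _ _ ≫ (AffineSpace PUnit.{u + 1} (Spec (CommRingCat.of k)) ↘
      Spec (CommRingCat.of k)) = _
  rw [Category.assoc, hp.isoPullback_hom_fst_assoc, AffineSpace.map_over,
    AffineSpace.SpecIso_inv_over_assoc, ← Spec.map_comp]
  rfl

lemma AlgVar.spec_mvPolynomial_cls (τ : Type) [Finite τ] :
    (AlgVar.spec (k := k) (MvPolynomial τ D)).cls =
      lefschetz k ^ Nat.card τ * (AlgVar.spec (k := k) D).cls := by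
  have key : ∀ _ : Finite τ, (AlgVar.spec (k := k) (MvPolynomial τ D)).cls =
      lefschetz k ^ Nat.card τ * (AlgVar.spec (k := k) D).cls := by
    refine Finite.induction_empty_option (P := fun τ ↦ ∀ _ : Finite τ,
      (AlgVar.spec (k := k) (MvPolynomial τ D)).cls =
        lefschetz k ^ Nat.card τ * (AlgVar.spec (k := k) D).cls) ?_ ?_ ?_ τ
    · intro α β e h hβ
      have hα := Finite.of_equiv _ e.symm
      rw [← Nat.card_congr e, ← h hα]
      exact (AlgVar.spec_cls_congr ((MvPolynomial.renameEquiv D e).restrictScalars k)).symm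
    · intro _
      rw [Nat.card_of_isEmpty, pow_zero, one_mul]
      exact AlgVar.spec_cls_congr ((MvPolynomial.isEmptyAlgEquiv D PEmpty).restrictScalars k)
    · intro τ _ h _
      rw [Finite.card_option, pow_succ', mul_assoc, ← h inferInstance,
        ← AlgVar.spec_mvPolynomial_pUnit_cls]
      exact AlgVar.spec_cls_congr (((MvPolynomial.optionEquivLeft D τ).restrictScalars k).trans
        ((MvPolynomial.uniqueAlgEquiv (MvPolynomial τ D) PUnit.{u + 1}).symm.restrictScalars k))
  exact key inferInstance

/-- The subset of an affine space where the coordinates in `J` vanish and the coordinates in `G` do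
not. -/
def coordSet {σ : Type} (J G : Set σ) : Set (PrimeSpectrum (MvPolynomial σ D)) :=
  {q | (∀ i ∈ J, MvPolynomial.X i ∈ q.asIdeal) ∧ ∀ i ∈ G, MvPolynomial.X i ∉ q.asIdeal}

variable {σ : Type} [Finite σ]

lemma isLocallyClosed_coordSet (J G : Set σ) : IsLocallyClosed (coordSet D J G) := by
  have : coordSet D J G = PrimeSpectrum.zeroLocus (MvPolynomial.X '' J) ∩
      ⋂ i ∈ G, (PrimeSpectrum.zeroLocus {MvPolynomial.X i})ᶜ := by
    ext q
    simp [coordSet, PrimeSpectrum.mem_zeroLocus, Set.subset_def]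
  rw [this]
  refine (PrimeSpectrum.isClosed_zeroLocus _).isLocallyClosed.inter (IsOpen.isLocallyClosed ?_)
  exact (Set.toFinite G).isOpen_biInter fun i _ ↦
    (PrimeSpectrum.isClosed_zeroLocus _).isOpen_compl

/-- The set is a copy of the affine space on the remaining coordinates, embedded by the surjection φ
that sets the variables in J to 0. -/
lemma AlgVar.setCls_coordSet_empty (J : Set σ) :
    (AlgVar.spec (k := k) (MvPolynomial σ D)).setCls (coordSet D J ∅) =
      lefschetz k ^ (Jᶜ.ncard) * (AlgVar.spec (k := k) D).cls := by
  classical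
  rw [← Nat.card_coe_set_eq, ← AlgVar.spec_mvPolynomial_cls]
  let φ : MvPolynomial σ D →ₐ[D] MvPolynomial (Jᶜ : Set σ) D :=
    MvPolynomial.aeval fun i ↦ if h : i ∈ J then 0 else MvPolynomial.X ⟨i, h⟩
  let ψ : MvPolynomial (Jᶜ : Set σ) D →ₐ[D] MvPolynomial σ D := MvPolynomial.rename Subtype.val
  have hφψ : φ.comp ψ = AlgHom.id D _ := by
    refine MvPolynomial.algHom_ext fun i ↦ ?_
    have := i.2
    simp [φ, ψ, show ¬ (i.1 ∈ J) from this]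
  have hφ : Function.Surjective φ := fun p ↦ ⟨ψ p, congr($hφψ p)⟩
  have hker : RingHom.ker φ.toRingHom = Ideal.span (MvPolynomial.X '' J) := by
    refine le_antisymm ?_ ?_
    · intro p hp
      let I : Ideal (MvPolynomial σ D) := Ideal.span (MvPolynomial.X '' J)
      have h2 : (Ideal.Quotient.mkₐ D I).comp (ψ.comp φ) = Ideal.Quotient.mkₐ D I := by
        refine MvPolynomial.algHom_ext fun i ↦ ?_
        by_cases h : i ∈ J
        · simp only [φ, AlgHom.comp_apply, MvPolynomial.aeval_X, dif_pos h, map_zero]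
          exact (Ideal.Quotient.eq_zero_iff_mem.mpr
            (Ideal.subset_span (Set.mem_image_of_mem _ h))).symm
        · simp [φ, ψ, h]
      have h3 : Ideal.Quotient.mk I (ψ (φ p)) = Ideal.Quotient.mk I p := congr($h2 p)
      have h4 : φ p = 0 := hp
      rw [h4, map_zero, map_zero] at h3
      exact Ideal.Quotient.eq_zero_iff_mem.mp h3.symm
    · rw [Ideal.span_le]
      rintro _ ⟨i, hi, rfl⟩
      change φ (MvPolynomial.X i) = 0
      simp [φ, hi]
  have hrange : Set.range (Spec.map (CommRingCat.ofHom φ.toRingHom)) = coordSet D J ∅ := by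
    refine (range_comap_of_surjective _ φ.toRingHom hφ).trans ?_
    rw [hker, PrimeSpectrum.zeroLocus_span]
    ext q
    simp [coordSet, PrimeSpectrum.mem_zeroLocus, Set.subset_def]
  rw [← hrange]
  have hcl : IsClosedImmersion (Spec.map (CommRingCat.ofHom φ.toRingHom)) :=
    IsClosedImmersion.spec_of_surjective _ hφ
  have him : IsImmersion (Spec.map (CommRingCat.ofHom φ.toRingHom)) := inferInstance
  refine AlgVar.setCls_range (AlgVar.spec (k := k) (MvPolynomial (Jᶜ : Set σ) D))
    (AlgVar.spec (k := k) (MvPolynomial σ D))   (Spec.map (CommRingCat.ofHom φ.toRingHom)) him ?_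
  change Spec.map _ ≫ Spec.map _ = Spec.map _
  rw [← Spec.map_comp, ← CommRingCat.ofHom_comp]
  congr 2
  exact (φ.restrictScalars k).comp_algebraMap

/-- Induction on G: the locus where a further coordinate does not vanish is the difference of two
known ones, and 𝕃^(n+1) - 𝕃^n = 𝕃^n(𝕃 - 1). -/
lemma AlgVar.setCls_coordSet (J G : Set σ) (h : Disjoint J G) :
    (AlgVar.spec (k := k) (MvPolynomial σ D)).setCls (coordSet D J G) =
      lefschetz k ^ ((J ∪ G)ᶜ.ncard) * (lefschetz k - 1) ^ G.ncard *
        (AlgVar.spec (k := k) D).cls := by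
  induction G, Set.toFinite G using Set.Finite.induction_on generalizing J with
  | empty => simp [AlgVar.setCls_coordSet_empty]
  | @insert g G hg hfin ih =>
    rw [Set.disjoint_insert_right] at h
    let F := {q : PrimeSpectrum (MvPolynomial σ D) | MvPolynomial.X g ∈ q.asIdeal}
    have hF : IsClosed F := by
      convert! PrimeSpectrum.isClosed_zeroLocus ({MvPolynomial.X g} : Set (MvPolynomial σ D))
      ext; simp [PrimeSpectrum.mem_zeroLocus, F]
    have h2 : coordSet D J G ∩ F = coordSet D (insert g J) G := by
      ext q; simp [coordSet, F]; tauto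
    have h3 : coordSet D J G \ F = coordSet D J (insert g G) := by
      ext q; simp [coordSet, F]; tauto
    have h1 : (AlgVar.spec (k := k) (MvPolynomial σ D)).setCls (coordSet D J G) =
        (AlgVar.spec (k := k) (MvPolynomial σ D)).setCls (coordSet D (insert g J) G) +
        (AlgVar.spec (k := k) (MvPolynomial σ D)).setCls (coordSet D J (insert g G)) :=
      ((AlgVar.spec (k := k) (MvPolynomial σ D)).setCls_closed_open
        (isLocallyClosed_coordSet D J G) hF).trans
          (congrArg₂ (fun a b ↦ AlgVar.setCls _ a + AlgVar.setCls _ b) h2 h3)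
    rw [ih J h.2, ih (insert g J) (Set.disjoint_insert_left.mpr ⟨hg, h.2⟩)] at h1
    have h4 : (J ∪ G)ᶜ.ncard = (J ∪ insert g G)ᶜ.ncard + 1 := by
      rw [← Set.ncard_insert_of_notMem (a := g) (by simp)]
      congr 1
      ext x
      by_cases hx : x = g
      · subst hx; simp [h.1, hg]
      · simp [hx]
    rw [Set.insert_union, ← Set.union_insert, h4, pow_succ] at h1
    rw [Set.ncard_insert_of_notMem hg, pow_succ]
    linear_combination -h1

end AffineVarieties

/-! ### Pulling back ideal sheaves to affine schemes -/

section Pull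

variable {X Y : Scheme.{u}}

/-- The ideal of `R` that defines the pullback of an ideal sheaf along `g : Spec R ⟶ X`. -/
def pull (I : X.IdealSheafData) {R : CommRingCat.{u}} (g : Spec R ⟶ X) : Ideal R :=
  ((I.comap g).ideal ⟨⊤, isAffineOpen_top _⟩).map (Scheme.ΓSpecIso R).hom.hom

lemma pull_comap (I : X.IdealSheafData) (f : Y ⟶ X) {R : CommRingCat.{u}} (g : Spec R ⟶ Y) :
    pull (I.comap f) g = pull I (g ≫ f) := by
  rw [pull, pull, Scheme.IdealSheafData.comap_comp]

/-- Both inclusions come from the adjunction between `comap` and `map` of ideal sheaves, since `map`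
along an affine morphism is preimage of ideals. -/
lemma ideal_comap_top [IsAffine X] [IsAffine Y] (I : X.IdealSheafData) (f : Y ⟶ X) :
    (I.comap f).ideal ⟨⊤, isAffineOpen_top _⟩ =
      (I.ideal ⟨⊤, isAffineOpen_top _⟩).map f.appTop.hom := by
  refine le_antisymm ?_ ?_
  · let K : Y.IdealSheafData :=
      .ofIdealTop ((I.ideal ⟨⊤, isAffineOpen_top _⟩).map f.appTop.hom)
    have hK : K.ideal ⟨⊤, isAffineOpen_top _⟩ =
        (I.ideal ⟨⊤, isAffineOpen_top _⟩).map f.appTop.hom :=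
      congr(($(Scheme.IdealSheafData.equivOfIsAffine.apply_symm_apply _)))
    rw [← hK]
    have : I.comap f ≤ K := by
      rw [← Scheme.IdealSheafData.le_map_iff_comap_le]
      refine Scheme.IdealSheafData.le_of_isAffine ?_
      rw [Scheme.IdealSheafData.ideal_map_of_isAffineHom, ← Ideal.map_le_iff_le_comap]
      exact hK.ge
    exact this _
  · rw [Ideal.map_le_iff_le_comap]
    have := Scheme.IdealSheafData.le_map_comap (J := I) (f := f) ⟨⊤, isAffineOpen_top _⟩
    rwa [Scheme.IdealSheafData.ideal_map_of_isAffineHom] at this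

/-- This turns the pullback of centers into extension of ideals along ring homomorphisms. -/
lemma pull_SpecMap_comp (I : X.IdealSheafData) {R S : CommRingCat.{u}} (φ : R ⟶ S)
    (g : Spec R ⟶ X) : pull I (Spec.map φ ≫ g) = (pull I g).map φ.hom := by
  rw [← pull_comap, pull, pull, ideal_comap_top, Ideal.map_map, Ideal.map_map,
    ← CommRingCat.hom_comp, ← CommRingCat.hom_comp, Scheme.ΓSpecIso_naturality]

lemma pull_of_isOpenImmersion (I : X.IdealSheafData) {R : CommRingCat.{u}} (g : Spec R ⟶ X)
    [IsOpenImmersion g] (U : X.affineOpens) (h : ⊤ ≤ g ⁻¹ᵁ U.1) :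
    pull I g = (I.ideal U).map (g.appLE U.1 ⊤ h ≫ (Scheme.ΓSpecIso R).hom).hom := by
  rw [pull, Scheme.IdealSheafData.ideal_comap_of_isOpenImmersion]
  have h' : (⟨g ''ᵁ ⊤, (isAffineOpen_top _).image_of_isOpenImmersion g⟩ : X.affineOpens) ≤ U := by
    change g ''ᵁ ⊤ ≤ U.1
    exact (g.image_mono h).trans (g.image_preimage_eq_opensRange_inf _ ▸ inf_le_right)
  rw [← I.map_ideal h']
  let e := (g.appIso ⊤).commRingCatIsoToRingEquiv
  have h1 (K : Ideal Γ(X, g ''ᵁ ⊤)) : K.comap (g.appIso ⊤).inv.hom = K.map (g.appIso ⊤).hom.hom :=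
    Ideal.comap_symm e
  rw [h1, Ideal.map_map, Ideal.map_map, ← CommRingCat.hom_comp, ← CommRingCat.hom_comp,
    Scheme.Hom.appIso_hom', Scheme.Hom.map_appLE_assoc]

lemma pull_fromSpec (I : X.IdealSheafData) {U : X.Opens} (hU : IsAffineOpen U) :
    pull I hU.fromSpec = I.ideal ⟨U, hU⟩ := by
  rw [pull_of_isOpenImmersion I hU.fromSpec ⟨U, hU⟩ hU.fromSpec_preimage_self.ge]
  have : hU.fromSpec.appLE U ⊤ hU.fromSpec_preimage_self.ge ≫
      (Scheme.ΓSpecIso Γ(X, U)).hom = 𝟙 _ := by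
    rw [Scheme.Hom.appLE, hU.fromSpec_app_self]
    simp only [Category.assoc, ← Functor.map_comp_assoc]
    rw [Iso.inv_comp_eq, Category.comp_id]
    exact (congrArg (· ≫ _) ((Spec _).presheaf.map_id _)).trans (Category.id_comp _)
  rw [this]
  exact Ideal.map_id _

end Pull

/-! ### Charts of a blowup -/

section Blowup

variable {X Y : Scheme.{u}}

/-- Locally, a morphism from an affine scheme factors through an affine open subscheme. -/
lemma exists_away_factor {B C : CommRingCat.{u}} (g : Spec B ⟶ Y) (j : Spec C ⟶ Y)
    [IsOpenImmersion j] (q : Spec B) (hq : g q ∈ Set.range j) :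
    ∃ (f : B) (q' : Spec (.of (Localization.Away f))),
      Spec.map (CommRingCat.ofHom (algebraMap B (Localization.Away f))) q' = q ∧
      ∃ φ : C ⟶ .of (Localization.Away f),
        Spec.map (CommRingCat.ofHom (algebraMap B (Localization.Away f))) ≫ g = Spec.map φ ≫ j := by
  obtain ⟨_, ⟨f, rfl⟩, hqf, hf⟩ :=
    PrimeSpectrum.isTopologicalBasis_basic_opens.exists_subset_of_mem_open
      (show q ∈ g ⁻¹' (Set.range j) from hq)
      (j.isOpenEmbedding.isOpen_range.preimage g.continuous)
  have hrange := PrimeSpectrum.localization_away_comap_range (Localization.Away f) f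
  obtain ⟨q', hq'⟩ := hrange.ge hqf
  refine ⟨f, q', hq', ?_⟩
  have hle : Set.range (Spec.map (CommRingCat.ofHom (algebraMap B (Localization.Away f))) ≫ g) ⊆
      Set.range j := by
    rintro _ ⟨p, rfl⟩
    rw [Scheme.Hom.comp_apply]
    exact hf (hrange.le ⟨p, rfl⟩)
  refine ⟨Spec.preimage (IsOpenImmersion.lift j _ hle), ?_⟩
  rw [Spec.map_preimage, IsOpenImmersion.lift_fac]

lemma isEffectiveCartier_comap_of_pull {I : X.IdealSheafData} {R : CommRingCat.{u}}
    {g : Spec R ⟶ X} {a : R} (ha : a ∈ nonZeroDivisors R) (h : pull I g = Ideal.span {a}) :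
    IsEffectiveCartier (I.comap g) := by
  let e := (Scheme.ΓSpecIso R).commRingCatIsoToRingEquiv
  refine fun x ↦ ⟨⟨⊤, isAffineOpen_top _⟩, trivial, e.symm a, ?_, ?_⟩
  · rw [mem_nonZeroDivisors_iff_right] at ha ⊢
    intro x hx
    have := ha (e x) (by rw [← map_zero e, ← hx, map_mul, e.apply_symm_apply])
    exact (map_eq_zero_iff e e.injective).mp this
  · have h1 : ((I.comap g).ideal ⟨⊤, isAffineOpen_top _⟩).map (e : _ →+* R) = Ideal.span {a} := h
    have h2 := congrArg (Ideal.map (e.symm : R →+* Γ(Spec R, ⊤))) h1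
    rw [Ideal.map_map, Ideal.map_span, Set.image_singleton] at h2
    rw [RingEquiv.symm_comp, Ideal.map_id] at h2
    exact h2

lemma exists_pull_eq_of_isEffectiveCartier {J : Y.IdealSheafData} (hJ : IsEffectiveCartier J)
    (y : Y) : ∃ (B : CommRingCat.{u}) (j : Spec B ⟶ Y), IsOpenImmersion j ∧ y ∈ Set.range j ∧
      ∃ a ∈ nonZeroDivisors B, pull J j = Ideal.span {a} := by
  obtain ⟨V, hyV, a, ha, h⟩ := hJ y
  have hV : IsAffineOpen V.1 := V.2
  refine ⟨Γ(Y, V), hV.fromSpec, inferInstance, ?_, a, ha, ?_⟩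
  · rw [hV.range_fromSpec]; exact hyV
  · rw [pull_fromSpec]; exact h

/-- This is the uniqueness half of the universal property, for affine test schemes. -/
lemma IsBlowup.hom_ext {b : Y ⟶ X} {I : X.IdealSheafData} (hb : IsBlowup b I)
    {R : CommRingCat.{u}} {g₁ g₂ : Spec R ⟶ Y} (h : g₁ ≫ b = g₂ ≫ b) {a : R}
    (ha : a ∈ nonZeroDivisors R) (ha' : pull I (g₁ ≫ b) = Ideal.span {a}) : g₁ = g₂ := by
  have hc := isEffectiveCartier_comap_of_pull ha ha'
  exact (hb.existsUnique_lift _ _ hc).unique rfl h.symm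

lemma mem_nonZeroDivisors_away {B : Type*} [CommRing B] (f : B) {a : B}
    (ha : a ∈ nonZeroDivisors B) :
    algebraMap B (Localization.Away f) a ∈ nonZeroDivisors (Localization.Away f) :=
  IsLocalization.map_nonZeroDivisors_le (.powers f) (Localization.Away f)
    (Submonoid.mem_map_of_mem _ ha)

variable {A : CommRingCat.{u}} {ι : Type} (t : ι → A) (σ : Set ι) (w : ι)

/-- The structure morphism of a chart. -/
def chartHom (v : Spec A ⟶ X) : Spec (.of (ChartRing t σ w)) ⟶ X :=
  Spec.map (CommRingCat.ofHom (algebraMap A (ChartRing t σ w))) ≫ v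

/-- On the chart each tᵢ is a multiple of t_w, so the center pulls back to the divisor of t_w. -/
lemma pull_chartHom {I : X.IdealSheafData} {v : Spec A ⟶ X}
    (hv : pull I v = Ideal.span (t '' insert w σ)) :
    pull I (chartHom t σ w v) = Ideal.span {algebraMap A (ChartRing t σ w) (t w)} := by
  rw [chartHom, pull_SpecMap_comp, hv, Ideal.map_span]
  refine le_antisymm ?_ ?_
  · rw [Ideal.span_le]
    rintro _ ⟨_, ⟨j, hj, rfl⟩, rfl⟩
    rw [SetLike.mem_coe, Ideal.mem_span_singleton]
    rcases hj with rfl | hj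
    · exact dvd_rfl
    · exact ⟨_, algebraMap_eq_mul_chartCoord hj⟩
  · rw [Ideal.span_singleton_le_iff_mem]
    exact Ideal.subset_span ⟨t w, ⟨w, Set.mem_insert _ _, rfl⟩, rfl⟩

variable {t σ w}

/-- Since tᵢ = t_w Xᵢ, the image of Xᵢ is determined as soon as the image of t_w is a
nonzerodivisor. -/
lemma ChartRing.hom_ext {B : CommRingCat.{u}} {φ₁ φ₂ : .of (ChartRing t σ w) ⟶ B}
    (h : CommRingCat.ofHom (algebraMap A (ChartRing t σ w)) ≫ φ₁ =
      CommRingCat.ofHom (algebraMap A (ChartRing t σ w)) ≫ φ₂)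
    (hnz : φ₁ (algebraMap A (ChartRing t σ w) (t w)) ∈ nonZeroDivisors B) : φ₁ = φ₂ := by
  have halg (a : A) : φ₁ (algebraMap A (ChartRing t σ w) a) =
      φ₂ (algebraMap A (ChartRing t σ w) a) := congr($h a)
  apply CommRingCat.hom_ext
  refine Ideal.Quotient.ringHom_ext (MvPolynomial.ringHom_ext halg fun i ↦ ?_)
  have hx : Ideal.Quotient.mk _ (MvPolynomial.X i) = chartCoord t σ w i := by
    rw [chartCoord, chartLift_of_mem i.2]
  change φ₁ (Ideal.Quotient.mk _ (MvPolynomial.X i)) = φ₂ (Ideal.Quotient.mk _ (MvPolynomial.X i))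
  rw [hx, ← mul_cancel_left_mem_nonZeroDivisors hnz]
  have h1 := halg (t i)
  rw [algebraMap_eq_mul_chartCoord i.2, map_mul, map_mul] at h1
  rw [h1, halg]

/-- A morphism to the base that makes `t w` a generator of the ideal lifts to the chart. -/
lemma exists_chart_lift {B : CommRingCat.{u}} (ψ : A ⟶ B) (h : ∀ i ∈ σ, ψ (t w) ∣ ψ (t i)) :
    ∃ m : .of (ChartRing t σ w) ⟶ B,
      CommRingCat.ofHom (algebraMap A (ChartRing t σ w)) ≫ m = ψ := by
  choose! x hx using h
  let m : ChartRing t σ w →+* B := Ideal.Quotient.lift _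
    (MvPolynomial.eval₂Hom ψ.hom fun i : σ ↦ x i) (by
      intro a ha
      have : chartIdeal t σ w ≤ RingHom.ker (MvPolynomial.eval₂Hom ψ.hom fun i : σ ↦ x i) := by
        rw [Ideal.span_le]
        rintro _ ⟨i, rfl⟩
        rw [SetLike.mem_coe, RingHom.mem_ker]
        simp [hx i i.2]
      exact this ha)
  refine ⟨CommRingCat.ofHom m, ?_⟩
  ext a
  change m (Ideal.Quotient.mk _ (MvPolynomial.C a)) = ψ a
  exact (Ideal.Quotient.lift_mk _ _ _).trans (MvPolynomial.eval₂_C ψ.hom _ a)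


variable {b : Y ⟶ X} {I : X.IdealSheafData} {v : Spec A ⟶ X}

lemma IsBlowup.exists_chart (hb : IsBlowup b I) (hv : pull I v = Ideal.span (t '' insert w σ))
    (hnz : algebraMap A (ChartRing t σ w) (t w) ∈ nonZeroDivisors (ChartRing t σ w)) :
    ∃ h : Spec (.of (ChartRing t σ w)) ⟶ Y, h ≫ b = chartHom t σ w v :=
  (hb.existsUnique_lift _ (chartHom t σ w v)
    (isEffectiveCartier_comap_of_pull hnz (pull_chartHom t σ w hv))).exists

/-- An affine open subscheme of a blowup over an affine open subscheme of the base. -/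
lemma IsBlowup.exists_local [IsOpenImmersion v] (hb : IsBlowup b I) {y : Y} (hy : b y ∈ Set.range v) :
    ∃ (B : CommRingCat.{u}) (j : Spec B ⟶ Y), IsOpenImmersion j ∧ y ∈ Set.range j ∧
      ∃ ψ : A ⟶ B, j ≫ b = Spec.map ψ ≫ v ∧
        ∃ a ∈ nonZeroDivisors B, pull I (j ≫ b) = Ideal.span {a} := by
  obtain ⟨B, j, hj, ⟨q, rfl⟩, a, ha, h⟩ :=
    exists_pull_eq_of_isEffectiveCartier hb.isEffectiveCartier y
  rw [pull_comap] at h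
  -- A neighbourhood on which the center becomes principal is shrunk until it maps into the given
  -- affine open of the base.
  obtain ⟨f, q', hq', ψ, hψ⟩ := exists_away_factor (j ≫ b) v q hy
  refine ⟨.of (Localization.Away f),
    Spec.map (CommRingCat.ofHom (algebraMap B (Localization.Away f))) ≫ j, inferInstance,
    ⟨q', ?_⟩, ψ, ?_, algebraMap B _ a, mem_nonZeroDivisors_away f ha, ?_⟩
  · rw [Scheme.Hom.comp_apply, hq']
  · rw [Category.assoc, hψ]
  · rw [Category.assoc, pull_SpecMap_comp, h, Ideal.map_span, Set.image_singleton]; rfl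

/-- An affine open subscheme of a blowup in which `t w` generates the inverse image ideal. -/
structure IsLocalChart (b : Y ⟶ X) (I : X.IdealSheafData) (v : Spec A ⟶ X) (a : A)
    {B : CommRingCat.{u}} (j : Spec B ⟶ Y) (ψ : A ⟶ B) : Prop where
  isOpenImmersion : IsOpenImmersion j
  comp_eq : j ≫ b = Spec.map ψ ≫ v
  mem : ψ a ∈ nonZeroDivisors B
  pull_eq : pull I (j ≫ b) = Ideal.span {ψ a}

lemma IsLocalChart.exists_hom (hv : pull I v = Ideal.span (t '' insert w σ))
    {B : CommRingCat.{u}} {j : Spec B ⟶ Y} {ψ : A ⟶ B} (hj : IsLocalChart b I v (t w) j ψ) :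
    ∃ m : .of (ChartRing t σ w) ⟶ B,
      CommRingCat.ofHom (algebraMap A (ChartRing t σ w)) ≫ m = ψ := by
  refine exists_chart_lift ψ fun i hi ↦ ?_
  rw [← Ideal.mem_span_singleton, ← hj.pull_eq, hj.comp_eq, pull_SpecMap_comp, hv]
  exact Ideal.mem_map_of_mem _ (Ideal.subset_span ⟨i, Set.mem_insert_of_mem _ hi, rfl⟩)

/-- Both sides lift the same morphism to the base, so the uniqueness in the universal property
applies. -/
lemma IsLocalChart.SpecMap_comp (hb : IsBlowup b I) {B : CommRingCat.{u}} {j : Spec B ⟶ Y}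
    {ψ : A ⟶ B} (hj : IsLocalChart b I v (t w) j ψ) {h : Spec (.of (ChartRing t σ w)) ⟶ Y}
    (hh : h ≫ b = chartHom t σ w v) {m : .of (ChartRing t σ w) ⟶ B}
    (hm : CommRingCat.ofHom (algebraMap A (ChartRing t σ w)) ≫ m = ψ) :
    Spec.map m ≫ h = j := by
  have h1 : j ≫ b = (Spec.map m ≫ h) ≫ b := by
    rw [Category.assoc, hh, chartHom, ← Spec.map_comp_assoc, hm, hj.comp_eq]
  exact (hb.hom_ext h1 hj.mem hj.pull_eq).symm

/-- Where the cofactor d is invertible, the image of c generates the same ideal as a. -/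
lemma exists_isLocalChart_of_mul {B : CommRingCat.{u}} {j : Spec B ⟶ Y} [IsOpenImmersion j]
    {ψ : A ⟶ B} (hj : j ≫ b = Spec.map ψ ≫ v) {a : B} (ha : a ∈ nonZeroDivisors B)
    (hp : pull I (j ≫ b) = Ideal.span {a}) {c : A} {d : B} (hd : ψ c = d * a) (q : Spec B)
    (hq : d ∉ q.asIdeal) :
    ∃ (B' : CommRingCat.{u}) (j' : Spec B' ⟶ Y) (ψ' : A ⟶ B'), IsLocalChart b I v c j' ψ' ∧
      j q ∈ Set.range j' := by
  have hrange := PrimeSpectrum.localization_away_comap_range (Localization.Away d) d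
  obtain ⟨q', hq'⟩ := hrange.ge hq
  let α : B ⟶ .of (Localization.Away d) :=
    CommRingCat.ofHom (algebraMap B (Localization.Away d))
  have hu : IsUnit (α d) := IsLocalization.Away.algebraMap_isUnit d
  have hα : α (ψ c) = α d * α a := by rw [hd, map_mul]
  have : IsOpenImmersion (Spec.map α) :=
    inferInstanceAs (IsOpenImmersion (Spec.map (CommRingCat.ofHom
      (algebraMap B (Localization.Away d)))))
  refine ⟨_, Spec.map α ≫ j, ψ ≫ α, ⟨inferInstance, ?_, ?_, ?_⟩, ⟨q', ?_⟩⟩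
  · rw [Category.assoc, hj, Spec.map_comp, Category.assoc]
  · rw [CommRingCat.comp_apply, hα]
    exact mul_mem hu.mem_nonZeroDivisors (mem_nonZeroDivisors_away d ha)
  · rw [Category.assoc, pull_SpecMap_comp, hp, Ideal.map_span, Set.image_singleton,
      CommRingCat.comp_apply, hα]
    exact (Ideal.span_singleton_mul_left_unit hu _).symm
  · exact (Scheme.Hom.comp_apply _ _ _).trans (congrArg j hq')

/-- The charts of a blowup cover it. -/
lemma IsBlowup.exists_isLocalChart [IsOpenImmersion v] (hb : IsBlowup b I) {W : Set ι}
    (hv : pull I v = Ideal.span (t '' W)) {y : Y} (hy : b y ∈ Set.range v) :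
    ∃ w ∈ W, ∃ (B : CommRingCat.{u}) (j : Spec B ⟶ Y) (ψ : A ⟶ B),
      IsLocalChart b I v (t w) j ψ ∧ y ∈ Set.range j := by
  obtain ⟨B, j, hj, ⟨q, rfl⟩, ψ, hψ, a, ha, h⟩ := hb.exists_local hy
  have h1 : Ideal.span {a} = Ideal.span ((fun i ↦ ψ (t i)) '' W) := by
    rw [← h, hψ, pull_SpecMap_comp, hv, Ideal.map_span, Set.image_image]
  have h2 (w) (hw : w ∈ W) : ∃ d, ψ (t w) = d * a := by
    have : ψ (t w) ∈ Ideal.span {a} := h1 ▸ Ideal.subset_span ⟨w, hw, rfl⟩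
    obtain ⟨d, hd⟩ := Ideal.mem_span_singleton'.mp this
    exact ⟨d, hd.symm⟩
  choose! d hd using h2
  -- If every cofactor lay in q, then a = za with z ∈ q, and cancelling a would give 1 ∈ q.
  obtain ⟨w, hw, hdw⟩ : ∃ w ∈ W, d w ∉ q.asIdeal := by
    by_contra hcon
    push Not at hcon
    have h3 : a ∈ q.asIdeal * Ideal.span {a} := by
      have : Ideal.span ((fun i ↦ ψ (t i)) '' W) ≤ q.asIdeal * Ideal.span {a} := by
        rw [Ideal.span_le]
        rintro _ ⟨w, hw, rfl⟩
        rw [SetLike.mem_coe]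
        simp only [hd w hw]
        exact Ideal.mul_mem_mul (hcon w hw) (Ideal.mem_span_singleton_self a)
      exact this (h1 ▸ Ideal.mem_span_singleton_self a)
    obtain ⟨z, hz, hza⟩ := Ideal.mem_mul_span_singleton.mp h3
    have h4 : z = 1 := by
      rw [← mul_cancel_right_mem_nonZeroDivisors ha, hza, one_mul]
    exact q.2.ne_top ((Ideal.eq_top_iff_one _).mpr (h4 ▸ hz))
  obtain ⟨B', j', ψ', h', hq⟩ := exists_isLocalChart_of_mul hψ ha h (hd w hw) q hdw
  exact ⟨w, hw, B', j', ψ', h', hq⟩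

end Blowup

section Blowup

variable {X Y : Scheme.{u}}

lemma exists_away_lift {R B : Type*} [CommRing R] [CommRing B] {m : R →+* B} {f : R}
    {φ : B →+* Localization.Away f} (hmφ : φ.comp m = algebraMap R (Localization.Away f)) :
    ∃ (φ' : Localization.Away (m f) →+* Localization.Away f)
      (m' : Localization.Away f →+* Localization.Away (m f)),
      φ'.comp (algebraMap B (Localization.Away (m f))) = φ ∧
      m'.comp (algebraMap R (Localization.Away f)) =
        (algebraMap B (Localization.Away (m f))).comp m ∧ φ'.comp m' = RingHom.id _ := by
  have hu : IsUnit (φ (m f)) := by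
    have : φ (m f) = algebraMap R (Localization.Away f) f := congr($hmφ f)
    rw [this]
    exact IsLocalization.Away.algebraMap_isUnit f
  have hu' : IsUnit (((algebraMap B (Localization.Away (m f))).comp m) f) :=
    IsLocalization.Away.algebraMap_isUnit (m f)
  refine ⟨IsLocalization.Away.lift (m f) hu, IsLocalization.Away.lift f hu',
    IsLocalization.Away.lift_comp .., IsLocalization.Away.lift_comp .., ?_⟩
  refine IsLocalization.ringHom_ext (.powers f) ?_
  rw [RingHom.comp_assoc, IsLocalization.Away.lift_comp, ← RingHom.comp_assoc,
    IsLocalization.Away.lift_comp, hmφ, RingHom.id_comp]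

/-- Near the point, φ is a one-sided inverse of m. After localizing B at the image of f it becomes
an isomorphism, so the basic open D(f) is identified with an open part of Spec B and hence of Y. -/
lemma isOpenImmersion_away_comp {R B : CommRingCat.{u}} {h : Spec R ⟶ Y} {j : Spec B ⟶ Y}
    [IsOpenImmersion j] {m : R ⟶ B} (hm : Spec.map m ≫ h = j) {f : R}
    {φ : B ⟶ .of (Localization.Away f)}
    (hφ : Spec.map (CommRingCat.ofHom (algebraMap R (Localization.Away f))) ≫ h = Spec.map φ ≫ j)
    (hmφ : m ≫ φ = CommRingCat.ofHom (algebraMap R (Localization.Away f))) :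
    IsOpenImmersion (Spec.map (CommRingCat.ofHom (algebraMap R (Localization.Away f))) ≫ h) := by
  obtain ⟨φ₀, m₀, hφ₀, hm₀, h₀⟩ :=
    exists_away_lift (m := m.hom) (φ := φ.hom) congr(CommRingCat.Hom.hom $hmφ)
  let α : R ⟶ .of (Localization.Away f) := CommRingCat.ofHom (algebraMap R (Localization.Away f))
  let β : B ⟶ .of (Localization.Away (m.hom f)) :=
    CommRingCat.ofHom (algebraMap B (Localization.Away (m.hom f)))
  have : IsOpenImmersion (Spec.map β) :=
    inferInstanceAs (IsOpenImmersion (Spec.map (CommRingCat.ofHom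
      (algebraMap B (Localization.Away (m.hom f))))))
  let φ' : .of (Localization.Away (m.hom f)) ⟶ CommRingCat.of (Localization.Away f) :=
    CommRingCat.ofHom φ₀
  let m' : .of (Localization.Away f) ⟶ CommRingCat.of (Localization.Away (m.hom f)) :=
    CommRingCat.ofHom m₀
  have hφ' : β ≫ φ' = φ := CommRingCat.hom_ext hφ₀
  have hm' : α ≫ m' = m ≫ β := CommRingCat.hom_ext hm₀
  have h1 : m' ≫ φ' = 𝟙 _ := CommRingCat.hom_ext h₀
  have h2 : φ' ≫ m' = 𝟙 _ := by
    apply CommRingCat.hom_ext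
    refine IsLocalization.ringHom_ext (.powers (m.hom f)) ?_
    -- An equality of ring homomorphisms can be checked after composing the morphisms of spectra
    -- with the monomorphism j.
    have h3 : φ ≫ m' = β := by
      apply Spec.map_injective
      rw [← cancel_mono j, Spec.map_comp, Category.assoc, ← hφ]
      change Spec.map m' ≫ Spec.map α ≫ h = _
      rw [← Spec.map_comp_assoc, hm', Spec.map_comp_assoc, hm]
    have : β ≫ φ' ≫ m' = β := by rw [reassoc_of% hφ', h3]
    exact congr(CommRingCat.Hom.hom $this)
  have hiso : IsIso φ' := ⟨m', h2, h1⟩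
  rw [hφ, ← hφ', Spec.map_comp, Category.assoc]
  infer_instance

variable {A : CommRingCat.{u}} {ι : Type} {t : ι → A} {σ : Set ι} {w : ι}
  {b : Y ⟶ X} {I : X.IdealSheafData} {v : Spec A ⟶ X} [IsOpenImmersion v]
  {h : Spec (.of (ChartRing t σ w)) ⟶ Y}

lemma exists_away_factor_of_chart (hh : h ≫ b = chartHom t σ w v)
    {B : CommRingCat.{u}} {j : Spec B ⟶ Y} [IsOpenImmersion j]
    {ψ : A ⟶ B} (hj : j ≫ b = Spec.map ψ ≫ v) (q : Spec (.of (ChartRing t σ w)))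
    (hq : h q ∈ Set.range j) :
    ∃ (f : ChartRing t σ w) (q' : Spec (.of (Localization.Away f))),
      Spec.map (CommRingCat.ofHom (algebraMap (ChartRing t σ w) (Localization.Away f))) q' = q ∧
      ∃ φ : B ⟶ .of (Localization.Away f),
        Spec.map (CommRingCat.ofHom (algebraMap (ChartRing t σ w) (Localization.Away f))) ≫ h =
          Spec.map φ ≫ j ∧
        ψ ≫ φ = CommRingCat.ofHom (algebraMap A (ChartRing t σ w)) ≫
          CommRingCat.ofHom (algebraMap (ChartRing t σ w) (Localization.Away f)) := by
  obtain ⟨f, q', hq', φ, hφ⟩ := exists_away_factor h j q hq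
  refine ⟨f, q', hq', φ, hφ, ?_⟩
  apply Spec.map_injective
  rw [← cancel_mono v, Spec.map_comp, Category.assoc, ← hj, ← Category.assoc, ← hφ, Category.assoc,
    hh, chartHom, Spec.map_comp, Category.assoc]

/-- Near the image of q the inverse image of the center has some generator a, with t_w = da. Pulled
back to the chart, t_w and a both generate it, so d is a unit at q and t_w is a generator near the
image as well. -/
lemma IsBlowup.exists_isLocalChart_of_chart (hb : IsBlowup b I)
    (hv : pull I v = Ideal.span (t '' insert w σ))
    (hnz : algebraMap A (ChartRing t σ w) (t w) ∈ nonZeroDivisors (ChartRing t σ w))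
    (hh : h ≫ b = chartHom t σ w v) (q : Spec (.of (ChartRing t σ w))) :
    ∃ (B : CommRingCat.{u}) (j : Spec B ⟶ Y) (ψ : A ⟶ B), IsLocalChart b I v (t w) j ψ ∧
      h q ∈ Set.range j := by
  have hy : b (h q) ∈ Set.range v := by
    rw [← Scheme.Hom.comp_apply, hh, chartHom, Scheme.Hom.comp_apply]
    exact ⟨_, rfl⟩
  obtain ⟨B, j, hj, ⟨q₀, hq₀⟩, ψ, hψ, a, ha, hp⟩ := hb.exists_local hy
  obtain ⟨f, q', hq', φ, hφ, hψφ⟩ := exists_away_factor_of_chart hh hψ q ⟨q₀, hq₀⟩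
  have hw (R : CommRingCat.{u}) (γ : A ⟶ R) : γ (t w) ∈
      (Ideal.span (t '' insert w σ)).map γ.hom :=
    Ideal.mem_map_of_mem _ (Ideal.subset_span ⟨w, Set.mem_insert _ _, rfl⟩)
  obtain ⟨d, hd⟩ : ∃ d, ψ (t w) = d * a := by
    have : ψ (t w) ∈ Ideal.span {a} := by
      rw [← hp, hψ, pull_SpecMap_comp, hv]
      exact hw _ ψ
    obtain ⟨d, hd⟩ := Ideal.mem_span_singleton'.mp this
    exact ⟨d, hd.symm⟩
  have hspan : Ideal.span {φ a} = Ideal.span {φ (ψ (t w))} := by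
    have h1 : pull I (Spec.map φ ≫ j ≫ b) = Ideal.span {φ a} := by
      rw [pull_SpecMap_comp, hp, Ideal.map_span, Set.image_singleton]
    have h2 := congrArg (pull I) (congrArg (· ≫ b) hφ)
    simp only [Category.assoc] at h2
    rw [h1, hh, pull_SpecMap_comp, pull_chartHom t σ w hv, Ideal.map_span,
      Set.image_singleton] at h2
    rw [← h2]
    exact congrArg (fun x ↦ Ideal.span {x}) congr($hψφ (t w)).symm
  have hnz' : φ (ψ (t w)) ∈ nonZeroDivisors (Localization.Away f) := by
    have : φ (ψ (t w)) = algebraMap _ (Localization.Away f)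
      (algebraMap A (ChartRing t σ w) (t w)) := congr($hψφ (t w))
    rw [this]
    exact mem_nonZeroDivisors_away f hnz
  have hu : IsUnit (φ d) := by
    obtain ⟨e, he⟩ := Ideal.mem_span_singleton'.mp
      (hspan ▸ Ideal.mem_span_singleton_self (φ a) : φ a ∈ Ideal.span {φ (ψ (t w))})
    refine IsUnit.of_mul_eq_one e ?_
    rw [← mul_cancel_right_mem_nonZeroDivisors hnz', mul_assoc, he, one_mul, ← map_mul, hd]
  refine hq₀ ▸ exists_isLocalChart_of_mul hψ ha hp hd q₀ fun hdq ↦ ?_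
  have h3 : Spec.map φ q' = q₀ := by
    apply j.isOpenEmbedding.injective
    rw [hq₀, ← Scheme.Hom.comp_apply, ← hφ, Scheme.Hom.comp_apply, hq']
  rw [← h3] at hdq
  exact q'.2.ne_top (Ideal.eq_top_of_isUnit_mem _ hdq hu)

/-- The ring homomorphism m is a candidate local inverse of the chart. On a small basic open, m
followed by φ is the localization map, since both agree on A and t_w is a nonzerodivisor. -/
lemma IsBlowup.exists_factor_eq (hb : IsBlowup b I) (hv : pull I v = Ideal.span (t '' insert w σ))
    (hnz : algebraMap A (ChartRing t σ w) (t w) ∈ nonZeroDivisors (ChartRing t σ w))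
    (hh : h ≫ b = chartHom t σ w v)
    {B : CommRingCat.{u}} {j : Spec B ⟶ Y} {ψ : A ⟶ B} (hj : IsLocalChart b I v (t w) j ψ) :
    ∃ m : .of (ChartRing t σ w) ⟶ B, Spec.map m ≫ h = j ∧
      ∀ (q : Spec (.of (ChartRing t σ w))) (_ : h q ∈ Set.range j),
        ∃ (f : ChartRing t σ w) (q' : Spec (.of (Localization.Away f))),
        Spec.map (CommRingCat.ofHom (algebraMap (ChartRing t σ w) (Localization.Away f))) q' = q ∧
        ∃ φ : B ⟶ .of (Localization.Away f),
          Spec.map (CommRingCat.ofHom (algebraMap (ChartRing t σ w) (Localization.Away f))) ≫ h =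
            Spec.map φ ≫ j ∧
          m ≫ φ = CommRingCat.ofHom (algebraMap (ChartRing t σ w) (Localization.Away f)) := by
  obtain ⟨m, hm⟩ := hj.exists_hom hv
  refine ⟨m, hj.SpecMap_comp hb hh hm, fun q hq ↦ ?_⟩
  have := hj.isOpenImmersion
  obtain ⟨f, q', hq', φ, hφ, hψφ⟩ := exists_away_factor_of_chart hh hj.comp_eq q hq
  refine ⟨f, q', hq', φ, hφ, ChartRing.hom_ext ?_ ?_⟩
  · rw [reassoc_of% hm, hψφ]
  · have : (m ≫ φ) (algebraMap A (ChartRing t σ w) (t w)) = algebraMap _ (Localization.Away f)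
        (algebraMap A (ChartRing t σ w) (t w)) := by
      rw [← hm, Category.assoc] at hψφ
      exact congr($hψφ (t w))
    rw [this]
    exact mem_nonZeroDivisors_away f hnz

/-- The charts of a blowup are open subschemes. -/
lemma IsBlowup.isOpenImmersion_chart (hb : IsBlowup b I)
    (hv : pull I v = Ideal.span (t '' insert w σ))
    (hnz : algebraMap A (ChartRing t σ w) (t w) ∈ nonZeroDivisors (ChartRing t σ w))
    (hh : h ≫ b = chartHom t σ w v) : IsOpenImmersion h := by
  refine IsOpenImmersion.of_forall_source_exists h ?_ ?_
  · intro q₁ q₂ hq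
    obtain ⟨B, j, ψ, hj, q₀, hq₀⟩ := hb.exists_isLocalChart_of_chart hv hnz hh q₁
    obtain ⟨m, hm, H⟩ := hb.exists_factor_eq hv hnz hh hj
    have hoi := hj.isOpenImmersion
    -- Injectivity: q is recovered from its image through m.
    have key (q) (hq : h q = j q₀) : q = Spec.map m q₀ := by
      obtain ⟨f, q', hq', φ, hφ, hmφ⟩ := H q ⟨q₀, hq.symm⟩
      have h3 : Spec.map φ q' = q₀ := by
        apply j.isOpenEmbedding.injective
        rw [← hq, ← Scheme.Hom.comp_apply, ← hφ, Scheme.Hom.comp_apply, hq']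
      rw [← h3, ← Scheme.Hom.comp_apply, ← Spec.map_comp, hmφ, hq']
    rw [key q₁ hq₀.symm, key q₂ (hq ▸ hq₀.symm)]
  · intro q
    obtain ⟨B, j, ψ, hj, hq⟩ := hb.exists_isLocalChart_of_chart hv hnz hh q
    obtain ⟨m, hm, H⟩ := hb.exists_factor_eq hv hnz hh hj
    obtain ⟨f, q', hq', φ, hφ, hmφ⟩ := H q hq
    have hoi := hj.isOpenImmersion
    exact ⟨_, Spec.map (CommRingCat.ofHom (algebraMap (ChartRing t σ w) (Localization.Away f))),
      inferInstance, ⟨q', hq'⟩, isOpenImmersion_away_comp hm hφ hmφ⟩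

/-- A point of a chart lies in another chart if and only if the corresponding coordinate does not
vanish there. -/
lemma IsBlowup.mem_range_chart_iff (hb : IsBlowup b I)
    (hv : pull I v = Ideal.span (t '' insert w σ))
    (hnz : algebraMap A (ChartRing t σ w) (t w) ∈ nonZeroDivisors (ChartRing t σ w))
    (hh : h ≫ b = chartHom t σ w v) {w' : ι} {σ' : Set ι} (hσ : insert w σ = insert w' σ')
    (hw' : w' ∈ σ)
    (hnz' : algebraMap A (ChartRing t σ' w') (t w') ∈ nonZeroDivisors (ChartRing t σ' w'))
    {h' : Spec (.of (ChartRing t σ' w')) ⟶ Y} (hh' : h' ≫ b = chartHom t σ' w' v)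
    (q : Spec (.of (ChartRing t σ w))) :
    h q ∈ Set.range h' ↔ chartCoord t σ w w' ∉ q.asIdeal := by
  have hv' := hσ ▸ hv
  have hoi := hb.isOpenImmersion_chart hv hnz hh
  have hoi' := hb.isOpenImmersion_chart hv' hnz' hh'
  have hmul := algebraMap_eq_mul_chartCoord (t := t) (w := w) hw'
  constructor
  -- On the overlap t_w and t_w' generate the same ideal, and t_w' is t_w times the coordinate, so
  -- the coordinate is a unit there. For the converse, where the coordinate is invertible t_w'
  -- generates the ideal, and that locus factors through the other chart.
  · intro hq hxq
    obtain ⟨f, q', hq', φ, hφ, hψφ⟩ := exists_away_factor_of_chart hh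
      (ψ := CommRingCat.ofHom (algebraMap A (ChartRing t σ' w'))) hh' q hq
    have h1 := congrArg (pull I) (congrArg (· ≫ b) hφ)
    simp only [Category.assoc] at h1
    rw [hh, hh', pull_SpecMap_comp, pull_SpecMap_comp, pull_chartHom t σ w hv,
      pull_chartHom t σ' w' hv', Ideal.map_span, Ideal.map_span, Set.image_singleton,
      Set.image_singleton] at h1
    have h2 : φ (algebraMap A (ChartRing t σ' w') (t w')) = algebraMap _ (Localization.Away f)
        (algebraMap A (ChartRing t σ w) (t w')) := congr($hψφ (t w'))
    have h3 : algebraMap _ (Localization.Away f) (algebraMap A (ChartRing t σ w) (t w)) ∈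
        Ideal.span {algebraMap _ (Localization.Away f)
          (algebraMap A (ChartRing t σ w) (t w'))} := by
      rw [← h2]
      exact h1 ▸ Ideal.mem_span_singleton_self _
    obtain ⟨e, he⟩ := Ideal.mem_span_singleton'.mp h3
    rw [hmul, map_mul] at he
    have hu : IsUnit (algebraMap _ (Localization.Away f) (chartCoord t σ w w')) := by
      refine IsUnit.of_mul_eq_one e ?_
      rw [← mul_cancel_left_mem_nonZeroDivisors (mem_nonZeroDivisors_away f hnz), mul_one]
      linear_combination he
    rw [← hq'] at hxq
    exact q'.2.ne_top (Ideal.eq_top_of_isUnit_mem _ hxq hu)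
  · intro hxq
    have hu : IsUnit (algebraMap _ (Localization.Away (chartCoord t σ w w'))
        (chartCoord t σ w w')) := IsLocalization.Away.algebraMap_isUnit _
    have hmem := mem_nonZeroDivisors_away (chartCoord t σ w w') hnz
    let α : .of (ChartRing t σ w) ⟶ CommRingCat.of (Localization.Away (chartCoord t σ w w')) :=
      CommRingCat.ofHom (algebraMap _ (Localization.Away (chartCoord t σ w w')))
    have hαi : IsOpenImmersion (Spec.map α) :=
      inferInstanceAs (IsOpenImmersion (Spec.map (CommRingCat.ofHom
        (algebraMap (ChartRing t σ w) (Localization.Away (chartCoord t σ w w'))))))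
    have hα : (CommRingCat.ofHom (algebraMap A (ChartRing t σ w)) ≫ α) (t w') =
        algebraMap _ (Localization.Away (chartCoord t σ w w'))
          (algebraMap A (ChartRing t σ w) (t w)) * algebraMap _ _ (chartCoord t σ w w') := by
      rw [← map_mul, ← hmul]; rfl
    have hj : IsLocalChart b I v (t w') (Spec.map α ≫ h)
        (CommRingCat.ofHom (algebraMap A (ChartRing t σ w)) ≫ α) := by
      refine ⟨inferInstance, ?_, ?_, ?_⟩
      · rw [Category.assoc, hh, chartHom, Spec.map_comp, Category.assoc]
      · rw [hα]
        exact mul_mem hmem hu.mem_nonZeroDivisors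
      · rw [Category.assoc, hh, pull_SpecMap_comp, pull_chartHom t σ w hv, Ideal.map_span,
          Set.image_singleton, hα]
        exact (Ideal.span_singleton_mul_right_unit hu _).symm
    obtain ⟨m, hm, -⟩ := hb.exists_factor_eq hv' hnz' hh' hj
    have hrange := PrimeSpectrum.localization_away_comap_range
      (Localization.Away (chartCoord t σ w w')) (chartCoord t σ w w')
    obtain ⟨q', hq'⟩ := hrange.ge hxq
    have h1 : (Spec.map m ≫ h') q' = h q :=
      (congr($hm q')).trans ((Scheme.Hom.comp_apply _ _ _).trans (congrArg h hq'))
    exact ⟨Spec.map m q', (Scheme.Hom.comp_apply _ _ _).symm.trans h1⟩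

/-- Every point of the blowup over the base lies in a chart. -/
lemma IsBlowup.exists_mem_range_chart (hb : IsBlowup b I) {W : Set ι}
    (hv : pull I v = Ideal.span (t '' W)) {y : Y} (hy : b y ∈ Set.range v) :
    ∃ w ∈ W, ∀ (σ : Set ι) (_ : insert w σ = W)
      (_ : algebraMap A (ChartRing t σ w) (t w) ∈ nonZeroDivisors (ChartRing t σ w))
      (h : Spec (.of (ChartRing t σ w)) ⟶ Y) (_ : h ≫ b = chartHom t σ w v),
      y ∈ Set.range h := by
  obtain ⟨w, hw, B, j, ψ, hj, q, hq⟩ := hb.exists_isLocalChart hv hy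
  refine ⟨w, hw, fun σ hσ hnz h hh ↦ ?_⟩
  obtain ⟨m, hm, -⟩ := hb.exists_factor_eq (hσ ▸ hv) hnz hh hj
  exact ⟨Spec.map m q, by rw [← Scheme.Hom.comp_apply, hm, hq]⟩

end Blowup

/-! ### Local rings and multiplicities of the special fiber -/

section Stalks

variable {X : Scheme.{u}}

instance {R : CommRingCat.{u}} (q : Spec R) : q.asIdeal.IsPrime := PrimeSpectrum.isPrime q

/-- All affine neighbourhoods extend to the same ideal of the local ring, so the supremum defining
`stalkIdeal` is attained at each of them. -/
lemma stalkIdeal_eq_pull (I : X.IdealSheafData) (x : X) :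
    stalkIdeal I x = pull I (X.fromSpecStalk x) := by
  have key (U : X.Opens) (hU : IsAffineOpen U) (hx : x ∈ U) :
      (I.ideal ⟨U, hU⟩).map (X.presheaf.germ U x hx).hom = pull I (X.fromSpecStalk x) := by
    rw [← pull_fromSpec, ← pull_SpecMap_comp, ← hU.fromSpecStalk_eq_fromSpecStalk hx]
    rfl
  obtain ⟨_, ⟨U, hU, rfl⟩, hxU, -⟩ :=
    X.isBasis_affineOpens.exists_subset_of_mem_open (Set.mem_univ x) isOpen_univ
  refine le_antisymm (iSup₂_le fun V hV ↦ (key V.1 V.2 hV).le) ?_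
  rw [← key U hU hxU]
  exact le_iSup₂ (f := fun (V : X.affineOpens) (hV : x ∈ V.1) ↦
    (I.ideal V).map (X.presheaf.germ V.1 x hV).hom) ⟨U, hU⟩ hxU

/-- The local ring at a point of an affine open subscheme is a localization. -/
lemma exists_stalkHom_comp {O : Type u} [CommRing O] {p : X ⟶ Spec (.of O)}
    {R : CommRingCat.{u}} (g : Spec R ⟶ X) [IsOpenImmersion g]
    {φ : .of O ⟶ R} (hφ : g ≫ p = Spec.map φ) (q : Spec R) {x : X} (hx : g q = x) :
    ∃ κ : R ⟶ X.presheaf.stalk x,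
      (letI := κ.hom.toAlgebra; IsLocalization.AtPrime (X.presheaf.stalk x) q.asIdeal) ∧
      Spec.map κ ≫ g = X.fromSpecStalk x ∧
      (Scheme.ΓSpecIso (.of O)).inv ≫ p.appTop ≫ X.presheaf.germ ⊤ x trivial = φ ≫ κ := by
  subst hx
  let κ : R ⟶ X.presheaf.stalk (g q) :=
    (Scheme.ΓSpecIso R).inv ≫ (Spec R).presheaf.germ ⊤ q trivial ≫ inv (g.stalkMap q)
  refine ⟨κ, ?_, ?_, ?_⟩
  · let : Algebra R (X.presheaf.stalk (g q)) := κ.hom.toAlgebra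
    let : Algebra R ((Spec R).presheaf.stalk q) := StructureSheaf.stalkAlgebra R q
    have h0 : IsLocalization.AtPrime ((Spec R).presheaf.stalk q) q.asIdeal :=
      StructureSheaf.IsLocalization.to_stalk R q
    let e : (Spec R).presheaf.stalk q ≃ₐ[R] X.presheaf.stalk (g q) :=
      { (asIso (g.stalkMap q)).symm.commRingCatIsoToRingEquiv with
        commutes' := fun r ↦ rfl }
    exact IsLocalization.isLocalization_of_algEquiv q.asIdeal.primeCompl e
  · have h1 : Spec.map ((Scheme.ΓSpecIso R).inv ≫ (Spec R).presheaf.germ ⊤ q trivial) =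
        (Spec R).fromSpecStalk q := by
      rw [Spec.fromSpecStalk_eq]
    have h2 : Spec.map κ = Spec.map (inv (g.stalkMap q)) ≫ (Spec R).fromSpecStalk q := by
      rw [← h1, ← Spec.map_comp, Category.assoc]
    rw [h2, Category.assoc,
      ← Scheme.SpecMap_stalkMap_fromSpecStalk, ← Spec.map_comp_assoc, IsIso.hom_inv_id,
      Spec.map_id, Category.id_comp]
  · rw [← cancel_mono (g.stalkMap q)]
    have h2 := congrArg Scheme.Hom.appTop hφ
    rw [Scheme.Hom.comp_appTop] at h2
    simp only [κ, Category.assoc, IsIso.inv_hom_id, Category.comp_id]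
    rw [Scheme.ΓSpecIso_inv_naturality_assoc, ← h2]
    simp only [Category.assoc]
    congr 2
    exact Scheme.Hom.germ_stalkMap g ⊤ q trivial

lemma exists_stalkHom {O : Type u} [CommRing O] [IsLocalRing O] {p : X ⟶ Spec (.of O)}
    {R : CommRingCat.{u}} (g : Spec R ⟶ X) [IsOpenImmersion g]
    {φ : .of O ⟶ R} (hφ : g ≫ p = Spec.map φ) (q : Spec R) {x : X} (hx : g q = x) :
    ∃ κ : R ⟶ X.presheaf.stalk x,
      (letI := κ.hom.toAlgebra; IsLocalization.AtPrime (X.presheaf.stalk x) q.asIdeal) ∧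
      Spec.map κ ≫ g = X.fromSpecStalk x ∧
      specialFiberIdeal p x = ((maximalIdeal O).map φ.hom).map κ.hom := by
  obtain ⟨κ, hloc, hκ, hφκ⟩ := exists_stalkHom_comp g hφ q hx
  refine ⟨κ, hloc, hκ, ?_⟩
  rw [specialFiberIdeal, hφκ, Ideal.map_map]
  rfl

lemma pull_ker_SpecMap {R S : CommRingCat.{u}} (φ : R ⟶ S) :
    pull (Spec.map φ).ker (𝟙 _) = RingHom.ker φ.hom := by
  let e := (Scheme.ΓSpecIso R).commRingCatIsoToRingEquiv
  rw [pull, Scheme.IdealSheafData.comap_id, Scheme.Hom.ker_apply]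
  change (RingHom.ker (Spec.map φ).appTop.hom).map (e : Γ(Spec R, ⊤) →+* R) = _
  have h0 : (RingHom.ker (Spec.map φ).appTop.hom).map (e : Γ(Spec R, ⊤) →+* R) =
      (RingHom.ker (Spec.map φ).appTop.hom).comap (e.symm : R →+* Γ(Spec R, ⊤)) :=
    Ideal.map_comap_of_equiv e
  rw [h0, RingHom.comap_ker]
  have h1 : (Scheme.ΓSpecIso R).inv ≫ (Spec.map φ).appTop = φ ≫ (Scheme.ΓSpecIso S).inv :=
    (Scheme.ΓSpecIso_inv_naturality φ).symm
  have h2 : (Spec.map φ).appTop.hom.comp (e.symm : R →+* Γ(Spec R, ⊤)) =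
      (Scheme.ΓSpecIso S).inv.hom.comp φ.hom := congr(CommRingCat.Hom.hom $h1)
  rw [h2]
  exact RingHom.ker_comp_of_injective _
    (Scheme.ΓSpecIso S).symm.commRingCatIsoToRingEquiv.injective

/-- The kernel of the map of local rings of a closed immersion. -/
lemma ker_stalkMap {Z : Scheme.{u}} (i : Z ⟶ X) [IsClosedImmersion i] (z : Z) :
    RingHom.ker (i.stalkMap z).hom = pull i.ker (X.fromSpecStalk (i z)) := by
  have key (U : X.Opens) (hU : IsAffineOpen U) (hz : i z ∈ U) :
      (RingHom.ker (i.app U).hom).map (X.presheaf.germ U (i z) hz).hom =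
        pull i.ker (X.fromSpecStalk (i z)) := by
    have h1 : i.ker.ideal ⟨U, hU⟩ = RingHom.ker (i.app U).hom := i.ker_apply ⟨U, hU⟩
    rw [← h1, ← pull_fromSpec, ← pull_SpecMap_comp, ← hU.fromSpecStalk_eq_fromSpecStalk hz]
    rfl
  refine le_antisymm ?_ ?_
  · intro a ha
    obtain ⟨U, hzU, s, rfl⟩ := X.presheaf.exists_germ_eq a
    have h0 : Z.presheaf.germ (i ⁻¹ᵁ U) z hzU (i.app U s) = Z.presheaf.germ (i ⁻¹ᵁ U) z hzU 0 := by
      rw [map_zero, ← Scheme.Hom.germ_stalkMap_apply]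
      exact ha
    -- A germ that dies on Z dies on a neighbourhood W of z. As i is an embedding, W contains the
    -- preimage of an affine open V of X, on which the section lies in the kernel.
    obtain ⟨W, hzW, hWU, hWU', hres⟩ := Z.presheaf.germ_eq z hzU hzU _ _ h0
    obtain ⟨U', hU', hW⟩ := i.isEmbedding.isInducing.isOpen_iff.mp W.2
    obtain ⟨_, ⟨V, hV, rfl⟩, hzV, hVle⟩ := X.isBasis_affineOpens.exists_subset_of_mem_open
      (show i z ∈ (U : Set X) ∩ U' from ⟨hzU, by
        have : z ∈ i ⁻¹' U' := hW ▸ hzW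
        exact this⟩) (U.2.inter hU')
    have hVU : V ≤ U := fun x hx ↦ (hVle hx).1
    have hVW : i ⁻¹ᵁ V ≤ W := by
      intro x hx
      have : x ∈ i ⁻¹' U' := (hVle hx).2
      rw [hW] at this
      exact this
    rw [← key V hV hzV, ← X.presheaf.germ_res_apply (homOfLE hVU) (i z) hzV]
    refine Ideal.mem_map_of_mem _ ?_
    rw [RingHom.mem_ker]
    change (X.presheaf.map (homOfLE hVU).op ≫ i.app V) s = 0
    rw [i.naturality, CommRingCat.comp_apply]
    have hle : i ⁻¹ᵁ V ≤ i ⁻¹ᵁ U := fun x hx ↦ hVU hx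
    have h1 : Z.presheaf.map (homOfLE hle).op (i.app U s) =
        Z.presheaf.map (homOfLE hVW).op (Z.presheaf.map hWU.op (i.app U s)) := by
      rw [show Z.presheaf.map (homOfLE hle).op =
        Z.presheaf.map hWU.op ≫ Z.presheaf.map (homOfLE hVW).op from Z.presheaf.map_comp _ _]
      rfl
    refine h1.trans ?_
    rw [hres, map_zero, map_zero]
  · obtain ⟨_, ⟨U, hU, rfl⟩, hzU, -⟩ :=
      X.isBasis_affineOpens.exists_subset_of_mem_open (Set.mem_univ (i z)) isOpen_univ
    rw [← key U hU hzU, Ideal.map_le_iff_le_comap]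
    intro s hs
    rw [Ideal.mem_comap, RingHom.mem_ker]
    change i.stalkMap z (X.presheaf.germ U (i z) hzU s) = 0
    rw [Scheme.Hom.germ_stalkMap_apply, (RingHom.mem_ker).mp hs, map_zero]

end Stalks

section SpecialFiber

variable {O : Type u} [CommRing O] [IsLocalRing O] {K : Type u} [Field K] [Algebra O K]
  {X : Scheme.{u}} {f : X ⟶ Spec (CommRingCat.of K)}

namespace RegularSncModel

variable (𝒳 : RegularSncModel O f)

instance : IsClosedImmersion (Spec.map (CommRingCat.ofHom (residue O))) :=
  IsClosedImmersion.spec_of_surjective _ residue_surjective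

instance : IsClosedImmersion 𝒳.specialFiberι :=
  inferInstanceAs (IsClosedImmersion (pullback.fst _ _))

lemma specialFiberι_hom : 𝒳.specialFiberι ≫ 𝒳.hom =
    𝒳.specialFiber.hom ≫ Spec.map (CommRingCat.ofHom (residue O)) :=
  pullback.condition

lemma range_residue :
    Set.range (Spec.map (CommRingCat.ofHom (residue O))) = {closedPoint O} := by
  refine Set.Subset.antisymm ?_ ?_
  · rintro _ ⟨q, rfl⟩
    exact PrimeSpectrum.comap_residue O q
  · rintro _ rfl
    exact ⟨(⊥ : PrimeSpectrum (ResidueField O)), PrimeSpectrum.comap_residue O ⊥⟩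

lemma range_specialFiberι : Set.range 𝒳.specialFiberι = 𝒳.hom ⁻¹' {closedPoint O} := by
  rw [← range_residue]
  exact Scheme.Pullback.range_fst _ _

lemma hom_specialFiberι (z : 𝒳.specialFiber.carrier) :
    𝒳.hom (𝒳.specialFiberι z) = closedPoint O := by
  have : 𝒳.specialFiberι z ∈ 𝒳.hom ⁻¹' {closedPoint O} :=
    𝒳.range_specialFiberι ▸ ⟨z, rfl⟩
  exact this

/-- The special fiber is the base change of the closed point of Spec O, so its ideal is extended
from the maximal ideal. -/
lemma pull_ker_specialFiberι {R : CommRingCat.{u}} (g : Spec R ⟶ 𝒳.carrier)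
    {φ : CommRingCat.of O ⟶ R} (hφ : g ≫ 𝒳.hom = Spec.map φ) :
    pull 𝒳.specialFiberι.ker g = (maximalIdeal O).map φ.hom := by
  have h1 : 𝒳.specialFiberι.ker =
      (Spec.map (CommRingCat.ofHom (residue O))).ker.comap 𝒳.hom :=
    Scheme.IdealSheafData.ker_fst_of_isClosedImmersion _ _
  rw [h1, pull_comap, hφ, ← Category.comp_id (Spec.map φ), pull_SpecMap_comp, pull_ker_SpecMap]
  exact congrArg (Ideal.map φ.hom) (IsLocalRing.ker_residue)

lemma ker_stalkMap_specialFiberι (z : 𝒳.specialFiber.carrier) :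
    RingHom.ker (𝒳.specialFiberι.stalkMap z).hom =
      specialFiberIdeal 𝒳.hom (𝒳.specialFiberι z) := by
  obtain ⟨_, ⟨U, hU, rfl⟩, hxU, -⟩ := 𝒳.carrier.isBasis_affineOpens.exists_subset_of_mem_open
    (Set.mem_univ (𝒳.specialFiberι z)) isOpen_univ
  have hU : IsAffineOpen U := hU
  have hxU' : 𝒳.specialFiberι z ∈ Set.range hU.fromSpec := by rwa [hU.range_fromSpec]
  obtain ⟨q, hq⟩ := hxU'
  obtain ⟨φ, hφ⟩ := Spec.map_surjective (hU.fromSpec ≫ 𝒳.hom)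
  obtain ⟨κ, -, hκ, h⟩ := exists_stalkHom hU.fromSpec hφ.symm q hq
  rw [ker_stalkMap, ← hκ, pull_SpecMap_comp, 𝒳.pull_ker_specialFiberι _ hφ.symm, h]

/-- If an affine open subscheme `Spec R` of a model is such that the special fiber is cut out by a
monomial in a prime family `e`, then the multiplicities at its points are the exponents of those
members of the family that vanish there. -/
lemma mults_eq {R : CommRingCat.{u}} (g : Spec R ⟶ 𝒳.carrier) [IsOpenImmersion g]
    {φ : CommRingCat.of O ⟶ R} (hφ : g ≫ 𝒳.hom = Spec.map φ) {ι : Type} [Fintype ι] {e : ι → R}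
    (he : IsPrimeFamily e) (c : ι → ℕ)
    (hc : (maximalIdeal O).map φ.hom = Ideal.span {∏ j, e j ^ c j})
    (z : 𝒳.specialFiber.carrier) (q : Spec R) (hz : g q = 𝒳.specialFiberι z)
    (V : Finset ι) (hV : ∀ j, j ∈ V ↔ e j ∈ q.asIdeal ∧ c j ≠ 0) :
    𝒳.specialFiber.mults z = V.val.map c := by
  classical
  obtain ⟨κ, hloc, -, hsf⟩ := exists_stalkHom g hφ q hz
  let := κ.hom.toAlgebra
  have hloc : IsLocalization.AtPrime (𝒳.carrier.presheaf.stalk (𝒳.specialFiberι z)) q.asIdeal :=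
    hloc
  have hdomR := he.isDomain
  have hdom : IsDomain (𝒳.carrier.presheaf.stalk (𝒳.specialFiberι z)) :=
    IsLocalization.isDomain_of_le_nonZeroDivisors _ q.asIdeal.primeCompl_le_nonZeroDivisors
  -- Only the members vanishing at q remain a prime family in the local ring; the others turn into
  -- units and drop out of the monomial.
  have he' : IsPrimeFamily fun j : {j // e j ∈ q.asIdeal} ↦ algebraMap R
      (𝒳.carrier.presheaf.stalk (𝒳.specialFiberι z)) (e j) := by
    refine (he.comp Subtype.val_injective).localization q.asIdeal.primeCompl fun m hm hm' ↦ hm ?_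
    refine (Ideal.span_le.mpr ?_) hm'
    rintro _ ⟨j, rfl⟩
    exact j.2
  refine AlgVar.mults_eq_of_stalk _ z (𝒳.specialFiberι.stalkMap z).hom
    (𝒳.specialFiberι.stalkMap_surjective z) V (fun j ↦ algebraMap R
      (𝒳.carrier.presheaf.stalk (𝒳.specialFiberι z)) (e j)) c (fun j hj ↦ ((hV j).mp hj).2)
    ?_ (fun j hj ↦ he'.prime ⟨j, ((hV j).mp hj).1⟩) fun i hi j hj hij ↦ ?_
  · rw [ker_stalkMap_specialFiberι, hsf, hc, Ideal.map_span, Set.image_singleton, map_prod]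
    rw [Ideal.span_singleton_eq_span_singleton,
      ← Finset.prod_mul_prod_compl V]
    have hu : IsUnit (∏ j ∈ Vᶜ, κ.hom (e j ^ c j)) := by
      rw [IsUnit.prod_iff]
      intro j hj
      rw [Finset.mem_compl, hV, not_and_not_right] at hj
      by_cases h0 : c j = 0
      · rw [h0, pow_zero, map_one]; exact isUnit_one
      · rw [map_pow]
        exact (IsLocalization.map_units (M := q.asIdeal.primeCompl)
          (𝒳.carrier.presheaf.stalk (𝒳.specialFiberι z)) ⟨e j, fun h ↦ h0 (hj h)⟩).pow _
    simp only [map_pow] at hu ⊢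
    exact associated_mul_unit_left _ _ hu
  · have := he'.eq_of_dvd (i := ⟨i, ((hV i).mp hi).1⟩) (j := ⟨j, ((hV j).mp hj).1⟩) hij
    exact congrArg Subtype.val this

end RegularSncModel

end SpecialFiber

/-! ### Spreading out a regular system of parameters -/

section Algebra

lemma span_image_congr {ι R : Type*} [CommRing R] {s t : ι → R} (h : ∀ i, Associated (s i) (t i))
    (W : Set ι) : Ideal.span (s '' W) = Ideal.span (t '' W) := by
  refine le_antisymm (Ideal.span_le.mpr ?_) (Ideal.span_le.mpr ?_)
  · rintro _ ⟨i, hi, rfl⟩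
    exact Ideal.mem_of_dvd _ (h i).symm.dvd (Ideal.subset_span ⟨i, hi, rfl⟩)
  · rintro _ ⟨i, hi, rfl⟩
    exact Ideal.mem_of_dvd _ (h i).dvd (Ideal.subset_span ⟨i, hi, rfl⟩)

lemma span_singleton_congr {R : Type*} [CommRing R] {x y : R} (h : Associated x y) :
    Ideal.span {x} = Ideal.span {y} :=
  le_antisymm (Ideal.span_singleton_le_span_singleton.mpr h.symm.dvd)
    (Ideal.span_singleton_le_span_singleton.mpr h.dvd)

variable {R : Type u} [CommRing R] [IsNoetherianRing R] (p : Ideal R) [p.IsPrime]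
  {R' : Type u} [CommRing R'] [Algebra R R'] [IsLocalization.AtPrime R' p]

/-- Finitely many generators need only one common denominator. -/
lemma exists_mul_mem_of_map_le {J₁ J₂ : Ideal R}
    (h : J₁.map (algebraMap R R') ≤ J₂.map (algebraMap R R')) :
    ∃ g ∉ p, ∀ x ∈ J₁, g * x ∈ J₂ := by
  obtain ⟨s, rfl⟩ := IsNoetherian.noetherian J₁
  have hx (x : s) : ∃ m ∉ p, m * x.1 ∈ J₂ :=
    (IsLocalization.algebraMap_mem_map_algebraMap_iff p.primeCompl R' J₂ x.1).mp
      (h (Ideal.mem_map_of_mem _ (Ideal.subset_span x.2)))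
  choose m hm hmJ using hx
  refine ⟨∏ x, m x, fun h ↦ ?_, fun x hx ↦ ?_⟩
  · obtain ⟨x, -, hx⟩ := (Ideal.IsPrime.prod_mem_iff).mp h
    exact hm x hx
  · have : Submodule.span R (s : Set R) ≤
        Submodule.comap (LinearMap.lsmul R R (∏ x, m x)) J₂ := by
      refine Submodule.span_le.mpr fun y hy ↦ ?_
      change (∏ x, m x) * y ∈ J₂
      obtain ⟨c, hc⟩ := Finset.dvd_prod_of_mem m (Finset.mem_univ (⟨y, hy⟩ : s))
      rw [hc, mul_right_comm]
      exact J₂.mul_mem_right _ (hmJ ⟨y, hy⟩)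
    exact this hx

/-- Two ideals that agree in the local ring at `p` agree near `p`. -/
lemma exists_map_eq_of_map_eq {J₁ J₂ : Ideal R}
    (h : J₁.map (algebraMap R R') = J₂.map (algebraMap R R')) :
    ∃ g ∉ p, ∀ (A : Type u) [CommRing A] [Algebra R A], IsUnit (algebraMap R A g) →
      J₁.map (algebraMap R A) = J₂.map (algebraMap R A) := by
  obtain ⟨g₁, h₁, H₁⟩ := exists_mul_mem_of_map_le p h.le
  obtain ⟨g₂, h₂, H₂⟩ := exists_mul_mem_of_map_le p h.ge
  refine ⟨g₁ * g₂, fun h ↦ (Ideal.IsPrime.mem_or_mem ‹_› h).elim h₁ h₂, fun A _ _ hu ↦ ?_⟩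
  rw [map_mul, IsUnit.mul_iff] at hu
  refine le_antisymm (Ideal.map_le_iff_le_comap.mpr fun x hx ↦ ?_)
    (Ideal.map_le_iff_le_comap.mpr fun x hx ↦ ?_)
  · have := Ideal.mem_map_of_mem (algebraMap R A) (H₁ x hx)
    rw [map_mul] at this
    exact (Ideal.unit_mul_mem_iff_mem _ hu.1).mp this
  · have := Ideal.mem_map_of_mem (algebraMap R A) (H₂ x hx)
    rw [map_mul] at this
    exact (Ideal.unit_mul_mem_iff_mem _ hu.2).mp this

/-- A regular system of parameters in the local ring at `p` spreads out to a prime family in a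
neighbourhood of any generization `p₀` of `p`, if the members not vanishing at `p₀` are dropped;
and so do descriptions of ideals by it. -/
lemma exists_primeFamily_away [IsLocalRing R'] {d : ℕ} {t : Fin d → R'}
    (ht : IsRegularSystemOfParameters t) {p₀ : Ideal R} [p₀.IsPrime] (hp : p₀ ≤ p)
    {h₀ : R} (hh₀ : h₀ ∉ p₀) {M N : Ideal R} {a : Fin d → ℕ}
    (hM : M.map (algebraMap R R') = Ideal.span {∏ i, t i ^ a i})
    (hN : N.map (algebraMap R R') = ⊤ ∨
      ∃ W : Set (Fin d), N.map (algebraMap R R') = Ideal.span (t '' W)) :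
    ∃ F ∉ p₀, h₀ ∣ F ∧ ∃ (A : Type u) (_ : CommRing A) (_ : Algebra R A)
      (_ : IsLocalization.Away F A) (ι : Type) (_ : Fintype ι) (s : ι → R) (c : ι → ℕ), (∀ i, s i ∈ p₀) ∧
      IsPrimeFamily (fun i ↦ algebraMap R A (s i)) ∧
      M.map (algebraMap R A) =
        Ideal.span {∏ i, algebraMap R A (s i) ^ c i} ∧
      (N.map (algebraMap R A) = ⊤ ∨ ∃ W : Set ι,
        N.map (algebraMap R A) =
          Ideal.span ((fun i ↦ algebraMap R A (s i)) '' W)) := by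
  classical
  -- Parameters are replaced by their numerators, which changes them only by units.
  have hlift (i : Fin d) : ∃ s : R, Associated (t i) (algebraMap R R' s) := by
    obtain ⟨⟨s, m⟩, hs⟩ := IsLocalization.surj p.primeCompl (t i)
    exact ⟨s, hs ▸ (associated_mul_unit_right _ _ (IsLocalization.map_units R' m))⟩
  choose s hs using hlift
  have hspan := span_image_congr hs
  have hR' : IsNoetherianRing R' := IsLocalization.isNoetherianRing p.primeCompl R' inferInstance
  have hs' : IsRegularSystemOfParameters fun i ↦ algebraMap R R' (s i) := by
    refine ⟨?_, ht.card_eq⟩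
    rw [← ht.span_range, ← Set.image_univ, ← Set.image_univ, hspan]
  have hsp (i : Fin d) : s i ∈ p := by
    rw [← IsLocalization.AtPrime.to_map_mem_maximal_iff R' p, ← hs'.span_range]
    exact Ideal.subset_span ⟨i, rfl⟩
  obtain ⟨f, hf, hfam⟩ := IsPrimeFamily.exists_away p hsp hs'.isParameterFamily.isPrimeFamily
  obtain ⟨g, hg, hgM⟩ := exists_map_eq_of_map_eq p (R' := R') (J₁ := M)
    (J₂ := Ideal.span {∏ i, s i ^ a i}) (by
      rw [hM, Ideal.map_span, Set.image_singleton, map_prod]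
      refine span_singleton_congr (Associated.prod _ _ _ fun i _ ↦ by
      rw [map_pow]
      exact (hs i).pow_pow))
  obtain ⟨N', hNN', hN'⟩ : ∃ N' : Ideal R, (N.map (algebraMap R R') = N'.map (algebraMap R R')) ∧
      (N' = ⊤ ∨ ∃ W : Set (Fin d), N' = Ideal.span (s '' W)) := by
    obtain h | ⟨W, h⟩ := hN
    · exact ⟨⊤, by rw [h, Ideal.map_top], .inl rfl⟩
    · exact ⟨_, by rw [h, hspan, Ideal.map_span, Set.image_image], .inr ⟨W, rfl⟩⟩
  obtain ⟨g', hg', hgN⟩ := exists_map_eq_of_map_eq p hNN'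
  -- The factors of r make the two ideals agree with their local descriptions, make the
  -- neighbourhood small, and invert the parameters that do not vanish at p₀.
  let r : R := g * g' * h₀ * ∏ i with s i ∉ p₀, s i
  have hr : r ∉ p₀ := by
    simp only [r, Ideal.IsPrime.mul_mem_iff_mem_or_mem, Ideal.IsPrime.prod_mem_iff]
    rintro (((h | h) | h) | ⟨i, hi, h⟩)
    · exact hg (hp h)
    · exact hg' (hp h)
    · exact hh₀ h
    · exact (Finset.mem_filter.mp hi).2 h
  let F := f * r
  let A₁ := Localization.Away f
  let A := Localization.Away (algebraMap R A₁ r)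
  have hA : IsLocalization.Away F A := IsLocalization.Away.mul' A₁ A f r
  have hu {x : R} (hx : x ∣ F) : IsUnit (algebraMap R A x) :=
    isUnit_of_dvd_unit (map_dvd _ hx) (IsLocalization.Away.algebraMap_isUnit F)
  have hur {x : R} (hx : x ∣ r) : IsUnit (algebraMap R A x) := hu (hx.mul_left f)
  have hunit (i : Fin d) (hi : s i ∉ p₀) : IsUnit (algebraMap R A (s i)) :=
    hur ((Finset.dvd_prod_of_mem s (Finset.mem_filter.mpr ⟨Finset.mem_univ i, hi⟩)).mul_left _)
  refine ⟨F, fun h ↦ (Ideal.IsPrime.mem_or_mem ‹_› h).elim (fun h ↦ hf (hp h)) hr,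
    (Dvd.intro_left _ rfl : h₀ ∣ g * g' * h₀).mul_right _ |>.mul_left f,
    A, inferInstance, inferInstance, hA, {i : Fin d // s i ∈ p₀}, inferInstance, fun i ↦ s i, fun i ↦ a i, fun i ↦ i.2, ?_, ?_, ?_⟩
  · have h1 : IsPrimeFamily fun i ↦ algebraMap R A₁ (s i) := hfam A₁
    have h3 := ((h1.comp (f := fun i : {i // s i ∈ p₀} ↦ i.1)
      Subtype.val_injective).localization (R' := A) (.powers (algebraMap R A₁ r)) ?_)
    · refine Eq.subst (motive := IsPrimeFamily) ?_ h3
      funext i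
      exact (IsScalarTower.algebraMap_apply R A₁ A _).symm
    · rintro _ ⟨n, rfl⟩ hn
      have : Ideal.span (Set.range fun i : {i // s i ∈ p₀} ↦ algebraMap R A₁ (s i)) ≤
          p₀.map (algebraMap R A₁) := by
        refine Ideal.span_le.mpr ?_
        rintro _ ⟨i, rfl⟩
        exact Ideal.mem_map_of_mem _ i.2
      have hn := this hn
      dsimp only at hn
      rw [← map_pow, IsLocalization.algebraMap_mem_map_algebraMap_iff (.powers f)] at hn
      obtain ⟨_, ⟨m, rfl⟩, hm⟩ := hn
      obtain hm | hm := Ideal.IsPrime.mem_or_mem ‹_› hm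
      · exact hf (hp (Ideal.IsPrime.mem_of_pow_mem ‹_› _ hm))
      · exact hr (Ideal.IsPrime.mem_of_pow_mem ‹_› _ hm)
  · rw [hgM A (hur (((dvd_mul_right g g').mul_right _).mul_right _)), Ideal.map_span,
      Set.image_singleton, map_prod,
      ← Finset.prod_filter_mul_prod_filter_not _ (fun i ↦ s i ∈ p₀),
      Finset.prod_subtype (p := fun i ↦ s i ∈ p₀) _ (by simp)]
    simp only [map_pow]
    refine span_singleton_congr (associated_mul_unit_left _ _ ?_)
    rw [IsUnit.prod_iff]
    exact fun i hi ↦ (hunit i (Finset.mem_filter.mp hi).2).pow _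
  · rw [hgN A (hur (((dvd_mul_left g' g).mul_right _).mul_right _))]
    obtain rfl | ⟨W, rfl⟩ := hN'
    · exact .inl (Ideal.map_top _)
    -- If a generator of the center does not vanish at p₀, it has become a unit and the center is
    -- empty in the neighbourhood.
    by_cases hW : ∃ i ∈ W, s i ∉ p₀
    · obtain ⟨i, hi, his⟩ := hW
      refine .inl (Ideal.eq_top_of_isUnit_mem _ (Ideal.mem_map_of_mem _
        (Ideal.subset_span ⟨i, hi, rfl⟩)) (hunit i his))
    · push Not at hW
      refine .inr ⟨Subtype.val ⁻¹' W, ?_⟩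
      rw [Ideal.map_span, Set.image_image]
      congr 1
      ext y
      constructor
      · rintro ⟨i, hi, rfl⟩
        exact ⟨⟨i, hW i hi⟩, hi, rfl⟩
      · rintro ⟨i, hi, rfl⟩
        exact ⟨i.1, hi, rfl⟩

end Algebra

section SpecialFiber

variable {O : Type u} [CommRing O] [IsLocalRing O] {K : Type u} [Field K] [Algebra O K]
  {X : Scheme.{u}} {f : X ⟶ Spec (CommRingCat.of K)}

namespace RegularSncModel

variable (𝒳 : RegularSncModel O f)

lemma stalkIdeal_eq_top_of_notMem_support {X : Scheme.{u}} {I : X.IdealSheafData} {x : X}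
    (hx : x ∉ I.support) : stalkIdeal I x = ⊤ := by
  obtain ⟨_, ⟨U, hU, rfl⟩, hxU, -⟩ :=
    X.isBasis_affineOpens.exists_subset_of_mem_open (Set.mem_univ x) isOpen_univ
  rw [Scheme.IdealSheafData.mem_support_iff_of_mem (U := ⟨U, hU⟩) hxU,
    Scheme.mem_zeroLocus_iff] at hx
  push Not at hx
  obtain ⟨s, hs, hxs⟩ := hx
  rw [Scheme.mem_basicOpen _ _ _ hxU] at hxs
  exact top_le_iff.mp ((Ideal.eq_top_of_isUnit_mem _ (Ideal.mem_map_of_mem _ hs) hxs).ge.trans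
    (le_iSup₂ (f := fun (V : X.affineOpens) (hV : x ∈ V.1) ↦
      (I.ideal V).map (X.presheaf.germ V.1 x hV).hom) ⟨U, hU⟩ hxU))

/-- Every point of the special fiber of a model has an affine neighbourhood, as small as one
likes, in which the special fiber and a given center with normal crossings are described by a
prime family of functions that vanish at the point. -/
lemma exists_chart {I : 𝒳.carrier.IdealSheafData} (hI : HasNormalCrossings 𝒳.hom I)
    (η : 𝒳.specialFiber.carrier) {S : Set 𝒳.specialFiber.carrier} (hS : IsOpen S) (hη : η ∈ S) :
    ∃ (A : CommRingCat.{u}) (_ : IsNoetherianRing A) (v : Spec A ⟶ 𝒳.carrier)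
      (_ : IsOpenImmersion v) (φ : CommRingCat.of O ⟶ A) (_ : v ≫ 𝒳.hom = Spec.map φ) (q : Spec A)
      (ι : Type) (_ : Fintype ι) (t : ι → A) (a : ι → ℕ),
      v q = 𝒳.specialFiberι η ∧ 𝒳.specialFiberι ⁻¹' Set.range v ⊆ S ∧ IsPrimeFamily t ∧
      (∀ i, t i ∈ q.asIdeal) ∧ (maximalIdeal O).map φ.hom = Ideal.span {∏ i, t i ^ a i} ∧
      (pull I v = ⊤ ∨ ∃ W : Set ι, pull I v = Ideal.span (t '' W)) := by
  have hN := 𝒳.isRegular.isLocallyNoetherian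
  have : CompactSpace 𝒳.carrier := QuasiCompact.compactSpace_of_compactSpace 𝒳.hom
  set y := 𝒳.specialFiberι η with hy
  -- Normal crossings are given at closed points only, so the parameters are taken at a closed
  -- specialization x of y and then spread out to a neighbourhood of y.
  obtain ⟨x, hxy, hx⟩ := (isClosed_closure (s := {y})).exists_closed_singleton
    ⟨y, subset_closure rfl⟩
  have hyx : y ⤳ x := specializes_iff_mem_closure.mpr hxy
  have hpx : 𝒳.hom x = closedPoint O := by
    have h1 : closedPoint O ⤳ 𝒳.hom x := by
      rw [← 𝒳.hom_specialFiberι η]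
      exact hyx.map 𝒳.hom.continuous
    exact (specializes_iff_mem_closure.mp h1 : _ ∈ closure {closedPoint O}) |>
      fun h ↦ by rwa [(isClosed_singleton_closedPoint O).closure_eq] at h
  obtain ⟨d, t, ht, ⟨a, ha⟩, hW⟩ := hI x hx hpx
  obtain ⟨_, ⟨U, hU, rfl⟩, hxU, -⟩ := 𝒳.carrier.isBasis_affineOpens.exists_subset_of_mem_open
    (Set.mem_univ x) isOpen_univ
  have hU : IsAffineOpen U := hU
  have hNU : IsNoetherianRing Γ(𝒳.carrier, U) := IsLocallyNoetherian.component_noetherian ⟨U, hU⟩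
  obtain ⟨p, hp⟩ : x ∈ Set.range hU.fromSpec := by rwa [hU.range_fromSpec]
  obtain ⟨p₀, hp₀⟩ : y ∈ Set.range hU.fromSpec := by
    rw [hU.range_fromSpec]; exact hyx.mem_open U.2 hxU
  have hle : p₀.asIdeal ≤ p.asIdeal := by
    have : p₀ ⤳ p := by
      rw [← hU.fromSpec.isOpenEmbedding.isInducing.specializes_iff, hp, hp₀]
      exact hyx
    exact (PrimeSpectrum.le_iff_specializes p₀ p).mpr this
  obtain ⟨S', hS', rfl⟩ := 𝒳.specialFiberι.isEmbedding.isInducing.isOpen_iff.mp hS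
  obtain ⟨_, ⟨h₀, rfl⟩, hh₀, hh₀S⟩ :=
    PrimeSpectrum.isTopologicalBasis_basic_opens.exists_subset_of_mem_open
    (show p₀ ∈ hU.fromSpec ⁻¹' S' by rw [Set.mem_preimage, hp₀]; exact hη)
    (hS'.preimage hU.fromSpec.continuous)
  obtain ⟨φ, hφ⟩ := Spec.map_surjective (hU.fromSpec ≫ 𝒳.hom)
  obtain ⟨κ, hloc, hκ, hsf⟩ := exists_stalkHom hU.fromSpec hφ.symm p hp
  let := κ.hom.toAlgebra
  have hloc : IsLocalization.AtPrime (𝒳.carrier.presheaf.stalk x) p.asIdeal := hloc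
  have hstalk : stalkIdeal I x = (pull I hU.fromSpec).map κ.hom := by
    rw [stalkIdeal_eq_pull, ← hκ, pull_SpecMap_comp]
  obtain ⟨F, hF, hF₀, A, _, _, _, ι, _, s, c, hs, hfam, hM, hN⟩ :=
    exists_primeFamily_away p.asIdeal ht (p₀ := p₀.asIdeal) hle hh₀
      (M := (maximalIdeal O).map φ.hom) (N := pull I hU.fromSpec) (a := a)
      (hsf.symm.trans ha) (by
        by_cases hxI : x ∈ I.support
        · exact .inr ((hW hxI).imp fun W hW ↦ hstalk.symm.trans hW)
        · exact .inl (hstalk.symm.trans (stalkIdeal_eq_top_of_notMem_support hxI)))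
  let α : Γ(𝒳.carrier, U) ⟶ CommRingCat.of A :=
    CommRingCat.ofHom (algebraMap Γ(𝒳.carrier, U) A)
  have hα : IsOpenImmersion (Spec.map α) := IsOpenImmersion.of_isLocalization F
  have hrange : Set.range (Spec.map α) =
      (PrimeSpectrum.basicOpen F : Set (PrimeSpectrum Γ(𝒳.carrier, U))) :=
    PrimeSpectrum.localization_away_comap_range A F
  obtain ⟨q, hq⟩ : p₀ ∈ Set.range (Spec.map α) := hrange ▸ hF
  refine ⟨.of A, IsLocalization.isNoetherianRing (.powers F) A inferInstance,
    Spec.map α ≫ hU.fromSpec, inferInstance, φ ≫ α, ?_, q, ι, inferInstance,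
    fun i ↦ α (s i), c, ?_, ?_, hfam, ?_, ?_, ?_⟩
  · rw [Category.assoc, ← hφ, Spec.map_comp]
  · rw [Scheme.Hom.comp_apply, hq, hp₀]
  · rintro z ⟨q', hq'⟩
    change 𝒳.specialFiberι z ∈ S'
    rw [← hq', Scheme.Hom.comp_apply]
    refine hh₀S ?_
    have : Spec.map α q' ∈ (PrimeSpectrum.basicOpen F : Set (PrimeSpectrum _)) :=
      hrange ▸ ⟨q', rfl⟩
    exact fun h ↦ this (Ideal.mem_of_dvd _ hF₀ h)
  · intro i
    have := hs i
    rw [← hq] at this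
    exact this
  · rw [CommRingCat.hom_comp, ← Ideal.map_map]
    exact hM
  · rw [pull_SpecMap_comp]
    exact hN

end RegularSncModel

end SpecialFiber

/-! ### The weights of the strata of a blowup -/

section Weight

variable {k : Type u} [Field k] {A : Type*} [CommRing A] [Algebra ℚ A] {θ : K0 k →+* A}

lemma weight_of_three_le {m : Multiset ℕ} (hm : 3 ≤ m.card) : weight θ m = 0 := by
  have h1 : m ≠ {1} := by rintro rfl; simp at hm
  rw [weight, if_neg h1, if_neg (by omega), add_zero]

lemma weight_singleton (n : ℕ) : weight θ {n} = if n = 1 then 1 else 0 := by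
  simp [weight]

lemma weight_pair (a b : ℕ) : weight θ {a, b} =
    if Nat.gcd a b = 1 then ((1 : ℚ) / (a * b)) • (1 - θ (lefschetz k)) else 0 := by
  have : ({a, b} : Multiset ℕ).gcd = Nat.gcd a b := by
    simp only [Multiset.insert_eq_cons, Multiset.gcd_cons, Multiset.gcd_singleton, normalize_eq]
    rfl
  rw [weight, this, if_neg (fun h ↦ by simpa using congrArg Multiset.card h), zero_add]
  simp

/-- Apart from the multiset `{1}`, every weight is a rational multiple of 1 - 𝕃, which a second such
factor annihilates. -/
lemma mul_weight_of_two_le (hθ : (1 - θ (lefschetz k)) ^ 2 = 0)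
    {m : Multiset ℕ} (hm : 2 ≤ m.card) :
    (θ (lefschetz k) - 1) * weight θ m = 0 := by
  have h1 : m ≠ {1} := by rintro rfl; simp at hm
  rw [weight, if_neg h1, zero_add]
  split_ifs
  · rw [mul_smul_comm, show (θ (lefschetz k) - 1) * (1 - θ (lefschetz k)) =
      - (1 - θ (lefschetz k)) ^ 2 by ring, hθ, neg_zero, smul_zero]
  · rw [mul_zero]

variable {ι : Type*}

/-- The exponents of the members of a finite set that are nonzero. -/
def posPart (a : ι → ℕ) (S : Finset ι) : Multiset ℕ := (S.filter (a · ≠ 0)).val.map a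

lemma card_posPart (a : ι → ℕ) (S : Finset ι) :
    (posPart a S).card = (S.filter (a · ≠ 0)).card :=
  Multiset.card_map _ _

variable [DecidableEq ι]

lemma posPart_union (a : ι → ℕ) {S T : Finset ι} (h : Disjoint S T) :
    posPart a (S ∪ T) = posPart a S + posPart a T := by
  rw [posPart, Finset.filter_union, ← Finset.disjUnion_eq_union _ _
    (Finset.disjoint_filter_filter h), Finset.disjUnion_val, Multiset.map_add]
  rfl

/-- Let i be the only member of W with nonzero exponent. Pairing each G not containing i with G ∪
{i}, the two terms cancel unless G is empty, and then G ∪ {i} gives the right-hand side. -/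
lemma sum_weight_of_card_eq_one (hθ : (1 - θ (lefschetz k)) ^ 2 = 0)
    (a : ι → ℕ) (W : Finset ι) (M : Multiset ℕ)
    (hW : (W.filter (a · ≠ 0)).card = 1) :
    ∑ G ∈ W.powerset.erase ∅, (θ (lefschetz k) - 1) ^ (G.card - 1) *
      weight θ ((∑ j ∈ W, a j) ::ₘ (posPart a (W \ G) + M)) = weight θ (posPart a W + M) := by
  obtain ⟨i, hi⟩ := Finset.card_eq_one.mp hW
  have hiW : i ∈ W ∧ a i ≠ 0 := Finset.mem_filter.mp (hi ▸ Finset.mem_singleton_self i)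
  have h0 {j : ι} (hj : j ∈ W) (hji : j ≠ i) : a j = 0 := by
    by_contra h
    exact hji (Finset.mem_singleton.mp (hi ▸ Finset.mem_filter.mpr ⟨hj, h⟩))
  have hsum : ∑ j ∈ W, a j = a i := Finset.sum_eq_single i (fun j hj hji ↦ h0 hj hji)
    (fun h ↦ absurd hiW.1 h)
  have hpos : posPart a W = {a i} := by rw [posPart, hi]; rfl
  have hin {G : Finset ι} (hG : i ∈ G) : posPart a (W \ G) = 0 := by
    rw [posPart, Finset.filter_false_of_mem]
    · rfl
    · intro j hj
      rw [Finset.mem_sdiff] at hj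
      rw [not_not]
      exact h0 hj.1 fun h ↦ hj.2 (h ▸ hG)
  have hout {G : Finset ι} (hG : i ∉ G) : posPart a (W \ G) = {a i} := by
    have : (W \ G).filter (a · ≠ 0) = {i} := by
      rw [Finset.sdiff_eq_filter, Finset.filter_filter]
      ext j
      simp only [Finset.mem_filter, Finset.mem_singleton]
      constructor
      · rintro ⟨hj, -, h⟩
        exact by_contra fun hji ↦ h (h0 hj hji)
      · rintro rfl
        exact ⟨hiW.1, hG, hiW.2⟩
    rw [posPart, this]
    rfl
  -- For M = 0 and aᵢ = 1 this is (1 - 𝕃) + (𝕃 - 1) = 0. For M = 0 and aᵢ ≠ 1 neither multiset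
  -- counts. For M ≠ 0 the first has at least three elements and the second a weight killed by 𝕃 -
  -- 1.
  have hcancel : weight θ (a i ::ₘ ({a i} + M)) +
      (θ (lefschetz k) - 1) * weight θ (a i ::ₘ M) = 0 := by
    by_cases hM : M = 0
    · subst hM
      rw [add_zero]
      have h1 := weight_pair (θ := θ) (a i) (a i)
      have h2 := weight_singleton (θ := θ) (a i)
      simp only [Nat.gcd_self] at h1
      rw [show (a i ::ₘ {a i} : Multiset ℕ) = {a i, a i} from rfl, h1,
        show (a i ::ₘ 0 : Multiset ℕ) = {a i} from rfl, h2]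
      split_ifs with h
      · rw [h]; simp
      · simp
    · have h1 : 1 ≤ M.card := Multiset.card_pos.mpr hM
      rw [weight_of_three_le (by simp; omega), mul_weight_of_two_le hθ (by simp; omega), add_zero]
  -- Extended by 0 at the empty set, the sum runs over the full power set and can be split according
  -- to whether i belongs to G.
  let F (G : Finset ι) : A := if G = ∅ then 0 else (θ (lefschetz k) - 1) ^ (G.card - 1) *
      weight θ ((∑ j ∈ W, a j) ::ₘ (posPart a (W \ G) + M))
  have hF : ∑ G ∈ W.powerset.erase ∅, (θ (lefschetz k) - 1) ^ (G.card - 1) *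
      weight θ ((∑ j ∈ W, a j) ::ₘ (posPart a (W \ G) + M)) = ∑ G ∈ W.powerset, F G := by
    rw [← Finset.sum_erase (a := ∅) W.powerset (if_pos rfl : F ∅ = 0)]
    refine Finset.sum_congr rfl fun G hG ↦ ?_
    rw [show F G = _ from if_neg (Finset.ne_of_mem_erase hG)]
  rw [hF, ← Finset.insert_erase hiW.1, Finset.sum_powerset_insert (Finset.notMem_erase i W),
    ← Finset.sum_add_distrib, Finset.insert_erase hiW.1, Finset.sum_eq_single ∅]
  · rw [show F ∅ = 0 from if_pos rfl, zero_add,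
      show F (insert i ∅) = _ from if_neg (Finset.insert_ne_empty i ∅), hsum, hin (by simp), hpos]
    simp
  · intro G hG hne
    have hiG : i ∉ G := fun h ↦ Finset.notMem_erase i W (Finset.mem_powerset.mp hG h)
    rw [show F G = _ from if_neg hne,
      show F (insert i G) = _ from if_neg (Finset.insert_ne_empty i G), hsum,
      hin (Finset.mem_insert_self i G), hout hiG, Finset.card_insert_of_notMem hiG, zero_add, Nat.add_sub_cancel]
    obtain ⟨n, hn⟩ := Nat.exists_eq_succ_of_ne_zero (Finset.card_ne_zero.mpr
      (Finset.nonempty_iff_ne_empty.mpr hne))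
    rw [hn, Nat.succ_sub_one, pow_succ, mul_assoc, ← mul_add, hcancel, mul_zero]
  · exact fun h ↦ absurd (Finset.empty_mem_powerset _) h

/-- For |G| = 1 the multiset has at least three elements. For |G| = 2 the factor 𝕃 - 1 kills the
weight. For |G| ≥ 3 there is a factor (𝕃 - 1)². The hypothesis `h` excludes the surviving terms:
exactly two nonzero exponents, with G consisting of one of these components. -/
lemma term_eq_zero (hθ : (1 - θ (lefschetz k)) ^ 2 = 0)
    (a : ι → ℕ) (W : Finset ι) (M : Multiset ℕ)
    (hW : 2 ≤ (W.filter (a · ≠ 0)).card) {G : Finset ι} (hGW : G ⊆ W) (hG : G ≠ ∅)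
    (h : ∀ i, a i ≠ 0 → G = {i} → 2 < (W.filter (a · ≠ 0)).card) :
    (θ (lefschetz k) - 1) ^ (G.card - 1) *
      weight θ ((∑ j ∈ W, a j) ::ₘ (posPart a (W \ G) + M)) = 0 := by
  have hG1 : G.card ≠ 0 := Finset.card_ne_zero.mpr (Finset.nonempty_iff_ne_empty.mpr hG)
  obtain h1 | h1 | h1 : G.card = 1 ∨ G.card = 2 ∨ 3 ≤ G.card := by omega
  · obtain ⟨z, rfl⟩ := Finset.card_eq_one.mp h1
    rw [weight_of_three_le, mul_zero]
    simp only [Multiset.card_cons, Multiset.card_add, card_posPart]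
    have : 2 ≤ ((W \ {z}).filter (a · ≠ 0)).card := by
      rw [Finset.sdiff_singleton_eq_erase, Finset.filter_erase]
      by_cases hz : a z = 0
      · rw [Finset.erase_eq_of_notMem (by simp [hz])]
        exact hW
      · have := h z hz rfl
        have := Finset.pred_card_le_card_erase (s := W.filter (a · ≠ 0)) (a := z)
        omega
    omega
  · rw [h1, show 2 - 1 = 1 from rfl, pow_one]
    by_cases h2 : 2 ≤ ((∑ j ∈ W, a j) ::ₘ (posPart a (W \ G) + M)).card
    · exact mul_weight_of_two_le hθ h2
    · have h3 : (posPart a (W \ G) + M) = 0 := by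
        rw [Multiset.card_cons] at h2
        rw [← Multiset.card_eq_zero]
        omega
      -- If only the exceptional divisor passes through, its multiplicity is a sum with at least two
      -- positive terms, so it is not 1.
      have h4 : 2 ≤ ∑ j ∈ W, a j := by
        refine hW.trans ?_
        rw [Finset.card_eq_sum_ones, ← Finset.sum_filter_ne_zero W]
        refine Finset.sum_le_sum fun j hj ↦ ?_
        exact Nat.one_le_iff_ne_zero.mpr (Finset.mem_filter.mp hj).2
      rw [h3, show (∑ j ∈ W, a j) ::ₘ 0 = ({∑ j ∈ W, a j} : Multiset ℕ) from rfl,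
        weight_singleton, if_neg (by omega), mul_zero]
  · obtain ⟨n, hn⟩ := Nat.exists_eq_add_of_le h1
    rw [show G.card - 1 = 2 + n by omega, pow_add,
      show (θ (lefschetz k) - 1) ^ 2 = (1 - θ (lefschetz k)) ^ 2 by ring, hθ, zero_mul, zero_mul]

/-- The identity between the weights of the strata of an exceptional divisor and the weight of the
stratum they lie over. -/
lemma sum_weight (hθ : (1 - θ (lefschetz k)) ^ 2 = 0)
    (a : ι → ℕ) (W : Finset ι) (M : Multiset ℕ)
    (hW : ∃ i ∈ W, a i ≠ 0) :
    ∑ G ∈ W.powerset.erase ∅, (θ (lefschetz k) - 1) ^ (G.card - 1) *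
      weight θ ((∑ j ∈ W, a j) ::ₘ (posPart a (W \ G) + M)) = weight θ (posPart a W + M) := by
  obtain ⟨i₀, hi₀, hai₀⟩ := hW
  have hpos : 0 < (W.filter (a · ≠ 0)).card :=
    Finset.card_pos.mpr ⟨i₀, Finset.mem_filter.mpr ⟨hi₀, hai₀⟩⟩
  obtain h1 | h1 | h1 : (W.filter (a · ≠ 0)).card = 1 ∨ (W.filter (a · ≠ 0)).card = 2 ∨
    3 ≤ (W.filter (a · ≠ 0)).card := by omega
  · exact sum_weight_of_card_eq_one hθ a W M h1
  · obtain ⟨i, j, hij, hV⟩ := Finset.card_eq_two.mp h1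
    have hi : i ∈ W ∧ a i ≠ 0 :=
      Finset.mem_filter.mp (show i ∈ W.filter (a · ≠ 0) by rw [hV]; simp)
    have hj : j ∈ W ∧ a j ≠ 0 :=
      Finset.mem_filter.mp (show j ∈ W.filter (a · ≠ 0) by rw [hV]; simp)
    have hsum : ∑ j ∈ W, a j = a i + a j := by
      rw [← Finset.sum_filter_ne_zero, hV, Finset.sum_pair hij]
    have hpi : posPart a (W \ {i}) = {a j} := by
      rw [posPart, Finset.sdiff_singleton_eq_erase, Finset.filter_erase, hV,
        Finset.erase_insert (by simpa using hij)]
      rfl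
    have hpj : posPart a (W \ {j}) = {a i} := by
      rw [posPart, Finset.sdiff_singleton_eq_erase, Finset.filter_erase, hV, Finset.pair_comm,
        Finset.erase_insert (by simpa using hij.symm)]
      rfl
    have hpW : posPart a W = {a i, a j} := by
      rw [posPart, hV, Finset.insert_val_of_notMem (by simpa using hij)]
      rfl
    -- With exactly two components through the center, only G = {i} and G = {j} survive.
    rw [Finset.sum_eq_add {i} {j} (by simpa using hij)]
    · rw [hpi, hpj, hpW, hsum, Finset.card_singleton, Finset.card_singleton]
      simp only [Nat.sub_self, pow_zero, one_mul]
      by_cases hM0 : M = 0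
      · subst hM0
        simp only [add_zero]
        rw [show (a i + a j) ::ₘ {a j} = {a i + a j, a j} from rfl,
          show (a i + a j) ::ₘ {a i} = {a i + a j, a i} from rfl, weight_pair, weight_pair,
          weight_pair]
        have g1 : Nat.gcd (a i + a j) (a j) = Nat.gcd (a i) (a j) := by simp
        have g2 : Nat.gcd (a i + a j) (a i) = Nat.gcd (a i) (a j) := by
          rw [Nat.gcd_self_add_left, Nat.gcd_comm]
        simp only [g1, g2]
        split_ifs with h
        -- This is 1/((a+b)b) + 1/((a+b)a) = 1/(ab).
        · rw [← add_smul]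
          congr 1
          have hi' : (a i : ℚ) ≠ 0 := by exact_mod_cast hi.2
          have hj' : (a j : ℚ) ≠ 0 := by exact_mod_cast hj.2
          have hij' : (a i : ℚ) + a j ≠ 0 := by
            have := hi.2
            exact_mod_cast (by omega : a i + a j ≠ 0)
          push_cast
          field_simp
        · rw [add_zero]
      · have h2 : 1 ≤ M.card := Multiset.card_pos.mpr hM0
        rw [weight_of_three_le (by simp; omega), weight_of_three_le (by simp; omega),
          weight_of_three_le (by simp; omega), add_zero]
    · intro G hG hne
      rw [Finset.mem_erase, Finset.mem_powerset] at hG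
      refine term_eq_zero hθ a W M h1.ge hG.2 hG.1 fun z hz hGz ↦ ?_
      subst hGz
      have : z ∈ W.filter (a · ≠ 0) := Finset.mem_filter.mpr ⟨hG.2 (by simp), hz⟩
      rw [hV] at this
      simp only [Finset.mem_insert, Finset.mem_singleton] at this
      obtain rfl | rfl := this
      · exact absurd rfl hne.1
      · exact absurd rfl hne.2
    · exact fun h ↦ absurd (Finset.mem_erase.mpr ⟨by simp, by simpa using hi.1⟩) h
    · exact fun h ↦ absurd (Finset.mem_erase.mpr ⟨by simp, by simpa using hj.1⟩) h
  · rw [weight_of_three_le (by rw [Multiset.card_add, card_posPart]; omega)]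
    refine Finset.sum_eq_zero fun G hG ↦ ?_
    rw [Finset.mem_erase, Finset.mem_powerset] at hG
    exact term_eq_zero hθ a W M (by omega) hG.2 hG.1 fun _ _ _ ↦ h1

end Weight

/-! ### Contributions of affine strata -/

section SpecialFiber

variable {O : Type u} [CommRing O] [IsLocalRing O] {K : Type u} [Field K] [Algebra O K]
  {X : Scheme.{u}} {f : X ⟶ Spec (CommRingCat.of K)}

namespace RegularSncModel

variable (𝒳 : RegularSncModel O f) {R : CommRingCat.{u}} (g : Spec R ⟶ 𝒳.carrier)
  [IsOpenImmersion g] {φ : CommRingCat.of O ⟶ R} (hφ : g ≫ 𝒳.hom = Spec.map φ)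
  {B : Type u} [CommRing B] [Algebra (ResidueField O) B] {π : R →+* B}
  (hsurj : Function.Surjective π)
  (hπ : π.comp φ.hom = (algebraMap (ResidueField O) B).comp (residue O))

-- A closed subscheme of the chart on which the maximal ideal of O acts as 0 factors through the
-- special fiber, and the factorization is again an immersion.
include hφ hsurj hπ in
lemma exists_immersion : ∃ d : Spec (.of B) ⟶ 𝒳.specialFiber.carrier, IsImmersion d ∧
    d ≫ 𝒳.specialFiber.hom =
      Spec.map (CommRingCat.ofHom (algebraMap (ResidueField O) B)) ∧
    d ≫ 𝒳.specialFiberι = Spec.map (CommRingCat.ofHom π) ≫ g := by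
  have h : (Spec.map (CommRingCat.ofHom π) ≫ g) ≫ 𝒳.hom =
      Spec.map (CommRingCat.ofHom (algebraMap (ResidueField O) B)) ≫
        Spec.map (CommRingCat.ofHom (residue O)) := by
    rw [Category.assoc, hφ, ← Spec.map_comp, ← Spec.map_comp]
    congr 1
    exact CommRingCat.hom_ext hπ
  let d : Spec (.of B) ⟶ 𝒳.specialFiber.carrier := pullback.lift _ _ h
  have h1 : d ≫ 𝒳.specialFiberι = Spec.map (CommRingCat.ofHom π) ≫ g :=
    pullback.lift_fst _ _ _
  have : IsClosedImmersion (Spec.map (CommRingCat.ofHom π)) :=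
    IsClosedImmersion.spec_of_surjective _ hsurj
  have : IsImmersion (d ≫ 𝒳.specialFiberι) := by
    rw [h1]; infer_instance
  exact ⟨d, IsImmersion.of_comp _ 𝒳.specialFiberι, pullback.lift_snd _ _ _, h1⟩

include hφ hsurj hπ in
lemma finiteType_of_surjective : Algebra.FiniteType (ResidueField O) B := by
  obtain ⟨d, hd, hd', -⟩ := 𝒳.exists_immersion g hφ hsurj hπ
  have h : LocallyOfFiniteType (Spec.map (CommRingCat.ofHom (algebraMap (ResidueField O) B))) := by
    rw [← hd']
    infer_instance
  rw [HasRingHomProperty.Spec_iff (P := @LocallyOfFiniteType)] at h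
  exact RingHom.finiteType_algebraMap.mp h

variable {A : Type*} [CommRing A] [Algebra ℚ A] (θ : K0 (ResidueField O) →+* A)

include hφ hsurj hπ in
/-- The contribution of a stratum that is isomorphic to a locally closed subset of an affine
variety. -/
lemma contr_eq_weight_mul [Algebra.FiniteType (ResidueField O) B]
    {ι : Type} [Fintype ι] {e : ι → R} (he : IsPrimeFamily e) (c : ι → ℕ)
    (hc : (maximalIdeal O).map φ.hom = Ideal.span {∏ j, e j ^ c j})
    {G : Set (PrimeSpectrum B)} (hG : IsLocallyClosed G) {S : Set 𝒳.specialFiber.carrier}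
    (hS : ∀ z, z ∈ S ↔ ∃ q ∈ G, g (PrimeSpectrum.comap π q) = 𝒳.specialFiberι z)
    (V : Finset ι) (hV : ∀ q ∈ G, ∀ j, j ∈ V ↔ π (e j) ∈ q.asIdeal ∧ c j ≠ 0) :
    𝒳.specialFiber.contr θ S = weight θ (V.val.map c) *
      θ ((AlgVar.spec (k := ResidueField O) B).setCls G) := by
  obtain ⟨d, hd, hd', hdι⟩ := 𝒳.exists_immersion g hφ hsurj hπ
  have hdq (q : PrimeSpectrum B) : 𝒳.specialFiberι (d q) = g (PrimeSpectrum.comap π q) :=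
    congr($hdι q)
  have hSd : S = d '' G := by
    ext z
    rw [hS]
    constructor
    · rintro ⟨q, hq, hqz⟩
      refine ⟨q, hq, 𝒳.specialFiberι.isEmbedding.injective ?_⟩
      rw [hdq, hqz]
    · rintro ⟨q, hq, rfl⟩
      exact ⟨q, hq, (hdq q).symm⟩
  have hSl : IsLocallyClosed S := hSd ▸ hG.image d.isEmbedding.isInducing d.isLocallyClosed_range
  rw [𝒳.specialFiber.contr_eq_of_mults_eq θ hSl (m := V.val.map c)]
  · congr 2
    rw [hSd]
    exact (AlgVar.spec (k := ResidueField O) B).setCls_image 𝒳.specialFiber d hd hd' hG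
  · intro z hz
    obtain ⟨q, hq, hqz⟩ := (hS z).mp hz
    exact 𝒳.mults_eq g hφ he c hc z (PrimeSpectrum.comap π q) hqz V (hV q hq)

end RegularSncModel

/-- Away from its center, a blowup is an isomorphism. -/
lemma IsBlowup.exists_section {X Y : Scheme.{u}} {b : Y ⟶ X} {I : X.IdealSheafData}
    (hb : IsBlowup b I) {A : CommRingCat.{u}} {v : Spec A ⟶ X} [IsOpenImmersion v]
    (hv : pull I v = ⊤) :
    ∃ h : Spec A ⟶ Y, IsOpenImmersion h ∧ h ≫ b = v ∧ ∀ y, b y ∈ Set.range v → y ∈ Set.range h := by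
  have hv1 : pull I v = Ideal.span {1} := by rw [hv, Ideal.span_singleton_one]
  obtain ⟨h, hh⟩ := (hb.existsUnique_lift _ v
    (isEffectiveCartier_comap_of_pull (one_mem _) hv1)).exists
  have hsurj (y) (hy : b y ∈ Set.range v) : y ∈ Set.range h := by
    obtain ⟨B, j, hj, ⟨q, rfl⟩, ψ, hψ, a, ha, ha'⟩ := hb.exists_local hy
    have : j = Spec.map ψ ≫ h :=
      hb.hom_ext (by rw [hψ, Category.assoc, hh]) ha ha'
    exact ⟨Spec.map ψ q, by rw [← Scheme.Hom.comp_apply, ← this]⟩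
  refine ⟨h, ?_, hh, hsurj⟩
  let U := b ⁻¹ᵁ v.opensRange
  have hU : Set.range (U.ι ≫ b) ⊆ Set.range v := by
    rintro _ ⟨y, rfl⟩
    rw [Scheme.Hom.comp_apply]
    exact y.2
  have hhU : Set.range h ⊆ Set.range U.ι := by
    rintro _ ⟨q, rfl⟩
    rw [Scheme.Opens.range_ι]
    exact ⟨q, by rw [← Scheme.Hom.comp_apply, hh]⟩
  let r := IsOpenImmersion.lift v (U.ι ≫ b) hU
  let s := IsOpenImmersion.lift U.ι h hhU
  have hr : r ≫ v = U.ι ≫ b := IsOpenImmersion.lift_fac v _ hU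
  have hs : s ≫ U.ι = h := IsOpenImmersion.lift_fac U.ι _ hhU
  have hsr : s ≫ r = 𝟙 _ := by
    rw [← cancel_mono v, Category.assoc, hr, reassoc_of% hs, hh, Category.id_comp]
  have hrs : r ≫ s = 𝟙 _ := by
    -- Over the chart the center is empty, so its pullback to U is the unit ideal, which is Cartier.
    -- The uniqueness in the universal property then identifies both morphisms to Y.
    rw [← cancel_mono U.ι, Category.assoc, hs, Category.id_comp]
    have htop : I.comap v = ⊤ := by
      refine Scheme.IdealSheafData.ext_of_isAffine ?_
      have := congrArg (Ideal.comap (Scheme.ΓSpecIso A).commRingCatIsoToRingEquiv) hv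
      rw [pull] at this
      refine (Ideal.comap_map_of_bijective _
        (Scheme.ΓSpecIso A).commRingCatIsoToRingEquiv.bijective).symm.trans (this.trans ?_)
      rfl
    refine (hb.existsUnique_lift _ (U.ι ≫ b) fun x ↦ ?_).unique (by rw [Category.assoc, hh, hr]) rfl
    obtain ⟨_, ⟨V, hV, rfl⟩, hxV, -⟩ :=
      U.toScheme.isBasis_affineOpens.exists_subset_of_mem_open (Set.mem_univ x) isOpen_univ
    refine ⟨⟨V, hV⟩, hxV, 1, one_mem _, ?_⟩
    rw [← hr, Scheme.IdealSheafData.comap_comp, htop, Ideal.span_singleton_one,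
      Scheme.IdealSheafData.comap_top]
    rfl
  have : IsIso s := ⟨r, hsr, hrs⟩
  rw [← hs]
  infer_instance

end SpecialFiber

/-! ### Strata of the charts of a blowup -/

section Charts

variable {A : Type*} [CommRing A] {ι : Type} {t : ι → A}

/-- The restriction of a chart to a closed subscheme `Spec D` of the center. -/
def chartRestrict (t : ι → A) (σ : Set ι) (w : ι) {D : Type*} [CommRing D] (ρ : A →+* D)
    (hw : ρ (t w) = 0) (hσ : ∀ i ∈ σ, ρ (t i) = 0) : ChartRing t σ w →+* MvPolynomial σ D :=
  Ideal.Quotient.lift _ (MvPolynomial.map ρ) (by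
    intro a ha
    have : chartIdeal t σ w ≤ RingHom.ker (MvPolynomial.map (σ := σ) ρ) := by
      rw [Ideal.span_le]
      rintro _ ⟨i, rfl⟩
      rw [SetLike.mem_coe, RingHom.mem_ker]
      simp [hw, hσ i i.2]
    exact this ha)

variable {σ : Set ι} {w : ι} {D : Type*} [CommRing D] {ρ : A →+* D}
  (hw : ρ (t w) = 0) (hσ : ∀ i ∈ σ, ρ (t i) = 0)

lemma chartRestrict_mk (a : MvPolynomial σ A) :
    chartRestrict t σ w ρ hw hσ (Ideal.Quotient.mk _ a) = MvPolynomial.map ρ a :=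
  Ideal.Quotient.lift_mk _ _ _

lemma chartRestrict_algebraMap (a : A) :
    chartRestrict t σ w ρ hw hσ (algebraMap A _ a) = MvPolynomial.C (ρ a) :=
  (chartRestrict_mk hw hσ (MvPolynomial.C a)).trans (MvPolynomial.map_C _ _)

lemma chartRestrict_chartCoord_of_mem {j : ι} (hj : j ∈ σ) :
    chartRestrict t σ w ρ hw hσ (chartCoord t σ w j) = MvPolynomial.X ⟨j, hj⟩ := by
  rw [chartCoord, chartRestrict_mk, chartLift_of_mem hj, MvPolynomial.map_X]

lemma chartRestrict_chartCoord_of_notMem {j : ι} (hj : j ∉ σ) :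
    chartRestrict t σ w ρ hw hσ (chartCoord t σ w j) = MvPolynomial.C (ρ (t j)) := by
  rw [chartCoord_of_notMem hj, chartRestrict_algebraMap]

lemma chartRestrict_surjective (hρ : Function.Surjective ρ) :
    Function.Surjective (chartRestrict t σ w ρ hw hσ) :=
  Ideal.Quotient.lift_surjective_of_surjective _ _ (MvPolynomial.map_surjective ρ hρ)

/-- The points of a chart that lie over the closed subscheme `Spec D`. -/
lemma exists_comap_chartRestrict (hρ : Function.Surjective ρ)
    (q : PrimeSpectrum (ChartRing t σ w))
    (hq : RingHom.ker ρ ≤ q.asIdeal.comap (algebraMap A _)) :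
    ∃ q', PrimeSpectrum.comap (chartRestrict t σ w ρ hw hσ) q' = q := by
  have : q ∈ Set.range (PrimeSpectrum.comap (chartRestrict t σ w ρ hw hσ)) := by
    rw [range_comap_of_surjective _ _ (chartRestrict_surjective hw hσ hρ)]
    intro x hx
    obtain ⟨a, rfl⟩ := Ideal.Quotient.mk_surjective x
    have ha : a ∈ RingHom.ker (MvPolynomial.map (σ := σ) ρ) := by
      rw [RingHom.mem_ker, ← chartRestrict_mk hw hσ]
      exact hx
    rw [MvPolynomial.ker_map] at ha
    have h1 : (RingHom.ker ρ).map (MvPolynomial.C (σ := σ)) ≤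
        q.asIdeal.comap (Ideal.Quotient.mk _) := by
      rw [Ideal.map_le_iff_le_comap]
      exact hq
    exact h1 ha
  exact this

open Classical in
/-- The exponents in the total transform of a monomial. -/
def chartExp (a : ι → ℕ) (W : Finset ι) (w : ι) (j : ι) : ℕ := if j = w then ∑ i ∈ W, a i else a j

/-- The total transform of a monomial. -/
lemma prod_chartCoord_pow [Fintype ι] (a : ι → ℕ) {W : Finset ι} (hW : (W : Set ι) = insert w σ)
    (hwσ : w ∉ σ) :
    algebraMap A (ChartRing t σ w) (∏ j, t j ^ a j) =
      ∏ j, chartCoord t σ w j ^ chartExp a W w j := by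
  classical
  have hmem (j : ι) : j ∈ W ↔ j = w ∨ j ∈ σ := by
    rw [← Finset.mem_coe, hW, Set.mem_insert_iff]
  -- For j in W, the power t_j^a_j contributes a_j to the exponent of the exceptional coordinate, on
  -- top of its strict transform.
  have h1 (j : ι) : algebraMap A (ChartRing t σ w) (t j ^ a j) =
      (if j ∈ W then chartCoord t σ w w ^ a j else 1) *
        (if j = w then 1 else chartCoord t σ w j ^ a j) := by
    rw [map_pow]
    by_cases hjw : j = w
    · subst hjw
      rw [if_pos ((hmem j).mpr (.inl rfl)), if_pos rfl, mul_one, chartCoord_of_notMem hwσ]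
    · rw [if_neg hjw]
      by_cases hj : j ∈ σ
      · rw [if_pos ((hmem j).mpr (.inr hj)), algebraMap_eq_mul_chartCoord hj, mul_pow,
          chartCoord_of_notMem hwσ]
      · rw [if_neg (fun h ↦ ((hmem j).mp h).elim hjw hj), one_mul, chartCoord_of_notMem hj]
  have h2 (j : ι) : chartCoord t σ w j ^ chartExp a W w j =
      (if j = w then chartCoord t σ w w ^ (∑ i ∈ W, a i) else 1) *
        (if j = w then 1 else chartCoord t σ w j ^ a j) := by
    rw [chartExp]
    split_ifs with h
    · rw [h, mul_one]
    · rw [one_mul]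
  rw [map_prod, Finset.prod_congr rfl fun j _ ↦ h1 j, Finset.prod_congr rfl fun j _ ↦ h2 j,
    Finset.prod_mul_distrib, Finset.prod_mul_distrib]
  congr 1
  rw [Finset.prod_ite_mem, Finset.univ_inter, Finset.prod_pow_eq_pow_sum, Finset.prod_ite_eq',
    if_pos (Finset.mem_univ w)]

/-- The left side lists the components through a point of the torus of G as seen in the chart w: the
exceptional divisor, whose coordinate is that of w, and the strict transforms with index outside G.
-/
lemma map_chartExp [Fintype ι] [DecidableEq ι] (a : ι → ℕ) {W G : Finset ι} (hGW : G ⊆ W)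
    (hwG : w ∈ G) (hW : ∃ i ∈ W, a i ≠ 0) :
    (Finset.univ.filter fun j ↦ (j ∉ G ∨ j = w) ∧ chartExp a W w j ≠ 0).val.map
        (chartExp a W w) =
      (∑ i ∈ W, a i) ::ₘ (posPart a (W \ G) + posPart a Wᶜ) := by
  have hN : ∑ i ∈ W, a i ≠ 0 := by
    obtain ⟨i, hi, hai⟩ := hW
    exact fun h ↦ hai (Finset.sum_eq_zero_iff.mp h i hi)
  have hw : chartExp a W w w = ∑ i ∈ W, a i := if_pos rfl
  have h1 : (Finset.univ.filter fun j ↦ (j ∉ G ∨ j = w) ∧ chartExp a W w j ≠ 0) =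
      insert w ((Gᶜ).filter (a · ≠ 0)) := by
    ext j
    simp only [Finset.mem_filter, Finset.mem_univ, true_and, Finset.mem_insert, Finset.mem_compl]
    by_cases hj : j = w
    · subst hj; simp [hw, hN]
    · simp [hj, chartExp]
  have hGc : Gᶜ = (W \ G) ∪ Wᶜ := by
    ext j
    have := @hGW j
    simp only [Finset.mem_compl, Finset.mem_union, Finset.mem_sdiff]
    tauto
  have hdisj : Disjoint (W \ G) Wᶜ :=
    Finset.disjoint_of_subset_left Finset.sdiff_subset disjoint_compl_right
  rw [h1, Finset.insert_val_of_notMem (by simp [hwG]), Multiset.map_cons, hw,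
    ← posPart_union a hdisj, ← hGc, posPart]
  congr 1
  refine Multiset.map_congr rfl fun j hj ↦ if_neg ?_
  rintro rfl
  have := Finset.mem_filter.mp hj
  exact Finset.mem_compl.mp this.1 hwG

end Charts

/-! ### Invariance under blowups -/

section Blowup

lemma isLocallyClosed_preimage_of_mem_iff {T ι : Type*} [TopologicalSpace T] [Finite ι]
    {U : ι → Set T} (hU : ∀ i, IsOpen (U i)) {F : T → Finset ι} (hF : ∀ x i, i ∈ F x ↔ x ∈ U i)
    (G : Finset ι) : IsLocallyClosed (F ⁻¹' {G}) := by
  have : F ⁻¹' {G} =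
      (⋂ i ∈ (G : Set ι), U i) ∩ ⋂ i ∈ ((G : Set ι))ᶜ, (U i)ᶜ := by
    ext x
    simp only [Set.mem_preimage, Set.mem_singleton_iff, Finset.ext_iff, hF, Set.mem_inter_iff, Set.mem_iInter, Finset.mem_coe,
      Set.mem_compl_iff]
    exact ⟨fun h ↦ ⟨fun i ↦ (h i).2, fun i hi hx ↦ hi ((h i).1 hx)⟩,
      fun h i ↦ ⟨fun hx ↦ by_contra fun hi ↦ h.2 i hi hx, h.1 i⟩⟩
  rw [this]
  exact ((Set.toFinite _).isOpen_biInter fun i _ ↦ hU i).isLocallyClosed.inter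
    (isClosed_biInter fun i _ ↦ (hU i).isClosed_compl).isLocallyClosed

variable {O : Type u} [CommRing O] [IsLocalRing O] {K : Type u} [Field K] [Algebra O K]
  {X : Scheme.{u}} {f : X ⟶ Spec (CommRingCat.of K)}

namespace RegularSncModel

variable {𝒳 𝒴 : RegularSncModel O f} {A : Type*} [CommRing A] [Algebra ℚ A]
  (θ : K0 (ResidueField O) →+* A)
  {R : CommRingCat.{u}} {v : Spec R ⟶ 𝒳.carrier} [IsOpenImmersion v]
  {φ : CommRingCat.of O ⟶ R}
  {ι : Type} [Fintype ι] {t : ι → R} {a : ι → ℕ}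
  {D : Type u} [CommRing D] [Algebra (ResidueField O) D] [Algebra.FiniteType (ResidueField O) D]
  {ρ : R →+* D} {C : Set 𝒳.specialFiber.carrier}

open Classical in
/-- The contribution of a stratum in a model. -/
lemma contr_stratum (hφ : v ≫ 𝒳.hom = Spec.map φ) (ht : IsPrimeFamily t)
    (hφt : (maximalIdeal O).map φ.hom = Ideal.span {∏ i, t i ^ a i})
    (hsurj : Function.Surjective ρ)
    (hρ : ρ.comp φ.hom = (algebraMap (ResidueField O) D).comp (residue O))
    (hρt : ∀ i, ρ (t i) = 0)
    (hC : ∀ z, z ∈ C ↔ ∃ q : PrimeSpectrum D, v (PrimeSpectrum.comap ρ q) = 𝒳.specialFiberι z) :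
    𝒳.specialFiber.contr θ C =
      weight θ (posPart a Finset.univ) * θ (AlgVar.spec (k := ResidueField O) D).cls := by
  have hu : IsLocallyClosed (Set.univ : Set (PrimeSpectrum D)) := isOpen_univ.isLocallyClosed
  rw [𝒳.contr_eq_weight_mul v hφ hsurj hρ θ ht a hφt hu (S := C) (fun z ↦ by simpa using hC z)
    (Finset.univ.filter (a · ≠ 0)) (fun q _ j ↦ by simp [hρt])]
  congr 2
  exact AlgVar.setCls_univ _

/-- The contribution of the preimage of a stratum in the blowup of a model. -/
lemma contr_preimage_stratum {b : 𝒴.carrier ⟶ 𝒳.carrier} (hbp : b ≫ 𝒳.hom = 𝒴.hom)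
    {I : 𝒳.carrier.IdealSheafData} (hb : IsBlowup b I) [IsNoetherianRing R]
    (hθ : (1 - θ (lefschetz (ResidueField O))) ^ 2 = 0)
    (hφ : v ≫ 𝒳.hom = Spec.map φ) (ht : IsPrimeFamily t)
    (hφt : (maximalIdeal O).map φ.hom = Ideal.span {∏ i, t i ^ a i})
    (hsurj : Function.Surjective ρ)
    (hρ : ρ.comp φ.hom = (algebraMap (ResidueField O) D).comp (residue O))
    (hρt : ∀ i, ρ (t i) = 0)
    (hC : ∀ z, z ∈ C ↔ ∃ q : PrimeSpectrum D, v (PrimeSpectrum.comap ρ q) = 𝒳.specialFiberι z)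
    {W : Set ι} (hv : pull I v = Ideal.span (t '' W)) (hWa : ∃ i ∈ W, a i ≠ 0)
    {β : 𝒴.specialFiber.carrier ⟶ 𝒳.specialFiber.carrier}
    (hβ : β ≫ 𝒳.specialFiberι = 𝒴.specialFiberι ≫ b) (hCl : IsLocallyClosed C) :
    𝒴.specialFiber.contr θ (β ⁻¹' C) =
      weight θ (posPart a Finset.univ) * θ (AlgVar.spec (k := ResidueField O) D).cls := by
  classical
  have hβz (z) : 𝒳.specialFiberι (β z) = b (𝒴.specialFiberι z) := congr($hβ z)
  have hins (w) (hw : w ∈ W) : insert w (W \ {w}) = W := by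
    rw [Set.insert_sdiff_singleton, Set.insert_eq_of_mem hw]
  have hv' (w) (hw : w ∈ W) : pull I v = Ideal.span (t '' insert w (W \ {w})) := by
    rw [hins w hw, hv]
  have he (w) : IsPrimeFamily (chartCoord t (W \ {w}) w) := ht.chartCoord (by simp)
  have hnz (w) : algebraMap R (ChartRing t (W \ {w}) w) (t w) ∈
      nonZeroDivisors (ChartRing t (W \ {w}) w) := by
    have := (he w).isDomain
    refine mem_nonZeroDivisors_of_ne_zero ?_
    rw [← chartCoord_of_notMem (by simp)]
    exact (he w).ne_zero w
  choose h hh using fun w hw ↦ hb.exists_chart (hv' w hw) (hnz w)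
  have hoi (w) (hw : w ∈ W) : IsOpenImmersion (h w hw) :=
    hb.isOpenImmersion_chart (hv' w hw) (hnz w) (hh w hw)
  have hbh (w) (hw : w ∈ W) (r) : b (h w hw r) = v (PrimeSpectrum.comap (algebraMap R _) r) :=
    congr($(hh w hw) r)
  let U (w : ι) : Set 𝒴.specialFiber.carrier :=
    {z | ∃ hw : w ∈ W, 𝒴.specialFiberι z ∈ Set.range (h w hw)}
  have hU (w) : IsOpen (U w) := by
    by_cases hw : w ∈ W
    · have := hoi w hw
      have h1 : U w = 𝒴.specialFiberι ⁻¹' Set.range (h w hw) := by ext z; simp [U, hw]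
      rw [h1]
      exact (h w hw).isOpenEmbedding.isOpen_range.preimage 𝒴.specialFiberι.continuous
    · have h1 : U w = ∅ := by ext z; simp [U, hw]
      rw [h1]
      exact isOpen_empty
  let Wf : Finset ι := W.toFinset
  have hWf (i) : i ∈ Wf ↔ i ∈ W := Set.mem_toFinset
  -- `F z` is the set of charts that contain z, that is, the set of its nonzero homogeneous
  -- coordinates. Its fibers cut the preimage of C into tori over Spec D.
  let F (z : 𝒴.specialFiber.carrier) : Finset ι := Finset.univ.filter fun w ↦ z ∈ U w
  have hF (z) (w) : w ∈ F z ↔ z ∈ U w := by simp [F]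
  have hvC {z} (hz : z ∈ β ⁻¹' C) : b (𝒴.specialFiberι z) ∈ Set.range v := by
    obtain ⟨q, hq⟩ := (hC _).mp hz
    exact ⟨_, hq.trans (hβz z)⟩
  have hzero (G : Finset ι) (hG : G ∉ Wf.powerset.erase ∅) :
      𝒴.specialFiber.contr θ (β ⁻¹' C ∩ F ⁻¹' {G}) = 0 := by
    have : β ⁻¹' C ∩ F ⁻¹' {G} = ∅ := by
      ext z
      simp only [Set.mem_inter_iff, Set.mem_empty_iff_false, iff_false, not_and]
      intro hz hzG
      apply hG
      rw [← show F z = G from hzG, Finset.mem_erase, Finset.mem_powerset]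
      obtain ⟨w, hw, hwz⟩ := hb.exists_mem_range_chart hv (hvC hz)
      refine ⟨Finset.nonempty_iff_ne_empty.mp ⟨w, (hF z w).mpr ⟨hw, hwz _ (hins w hw) (hnz w) _
        (hh w hw)⟩⟩, fun w' hw' ↦ ?_⟩
      obtain ⟨hw', -⟩ := (hF z w').mp hw'
      exact (hWf w').mpr hw'
    rw [this, AlgVar.contr_empty]
  have key (G : Finset ι) (hG : G ∈ Wf.powerset.erase ∅) :
      𝒴.specialFiber.contr θ (β ⁻¹' C ∩ F ⁻¹' {G}) =
        (θ (lefschetz (ResidueField O)) - 1) ^ (G.card - 1) *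
          weight θ ((∑ j ∈ Wf, a j) ::ₘ (posPart a (Wf \ G) + posPart a Wfᶜ)) *
            θ (AlgVar.spec (k := ResidueField O) D).cls := by
    rw [Finset.mem_erase, Finset.mem_powerset] at hG
    obtain ⟨hGne, hGW⟩ := hG
    obtain ⟨w, hwG⟩ := Finset.nonempty_iff_ne_empty.mpr hGne
    have hw : w ∈ W := (hWf w).mp (hGW hwG)
    have := hoi w hw
    have hσt : ∀ i ∈ W \ {w}, ρ (t i) = 0 := fun i _ ↦ hρt i
    let π := chartRestrict t (W \ {w}) w ρ (hρt w) hσt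
    let α : R ⟶ CommRingCat.of (ChartRing t (W \ {w}) w) :=
      CommRingCat.ofHom (algebraMap R (ChartRing t (W \ {w}) w))
    have hφ' : h w hw ≫ 𝒴.hom = Spec.map (φ ≫ α) := by
      rw [← hbp, reassoc_of% hh w hw, chartHom, Category.assoc, hφ, Spec.map_comp]
    have hπ : π.comp (φ ≫ α).hom = (algebraMap (ResidueField O)
        (MvPolynomial (W \ {w} : Set ι) D)).comp (residue O) := by
      refine RingHom.ext fun o ↦ ?_
      change π (algebraMap R _ (φ.hom o)) = algebraMap (ResidueField O) _ (residue O o)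
      rw [MvPolynomial.algebraMap_apply]
      refine (chartRestrict_algebraMap _ _ _).trans ?_
      exact congrArg _ congr($hρ o)
    have hc : (maximalIdeal O).map (φ ≫ α).hom =
        Ideal.span {∏ j, chartCoord t (W \ {w}) w j ^ chartExp a Wf w j} := by
      rw [CommRingCat.hom_comp, ← Ideal.map_map, hφt, Ideal.map_span, Set.image_singleton,
        ← prod_chartCoord_pow a (W := Wf) (by rw [hins w hw]; exact Set.coe_toFinset W) (by simp)]
      rfl
    -- In the chart of any w in G, the piece of G is the torus where the coordinates in `J` vanish
    -- and those in `G'` do not. Its dimension is |G| - 1, as the coordinate of w is normalized to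
    -- 1.
    let J : Set (W \ {w} : Set ι) := {i | i.1 ∉ G}
    let G' : Set (W \ {w} : Set ι) := {i | i.1 ∈ G}
    have hS (z) : z ∈ β ⁻¹' C ∩ F ⁻¹' {G} ↔
        ∃ q ∈ coordSet D J G', h w hw (PrimeSpectrum.comap π q) = 𝒴.specialFiberι z := by
      have hFG (q : PrimeSpectrum (MvPolynomial (W \ {w} : Set ι) D))
          (hq : h w hw (PrimeSpectrum.comap π q) = 𝒴.specialFiberι z) :
          F z = G ↔ q ∈ coordSet D J G' := by
        have hmem (i : (W \ {w} : Set ι)) : i.1 ∈ F z ↔ MvPolynomial.X i ∉ q.asIdeal := by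
          have h1 := hb.mem_range_chart_iff (hv' w hw) (hnz w) (hh w hw)
            ((hins w hw).trans (hins i.1 i.2.1).symm) i.2 (hnz i) (hh i i.2.1)
            (PrimeSpectrum.comap π q)
          rw [hF, show z ∈ U i ↔ _ from ⟨fun ⟨_, h⟩ ↦ h, fun h ↦ ⟨i.2.1, h⟩⟩, ← hq, h1]
          rw [not_iff_not]
          change π (chartCoord t (W \ {w}) w i.1) ∈ q.asIdeal ↔ _
          rw [chartRestrict_chartCoord_of_mem _ _ i.2]
        constructor
        · intro hFz
          refine ⟨fun i hi ↦ ?_, fun i hi ↦ ?_⟩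
          · by_contra hX
            exact hi (hFz ▸ (hmem i).mpr hX)
          · exact (hmem i).mp (hFz ▸ hi)
        · rintro ⟨h1, h2⟩
          ext j
          by_cases hjw : j = w
          · subst hjw
            simp only [hwG, iff_true]
            exact (hF z j).mpr ⟨hw, _, hq⟩
          by_cases hj : j ∈ W
          · rw [hmem ⟨j, hj, hjw⟩]
            exact ⟨fun hX ↦ by_contra fun hjG ↦ hX (h1 ⟨j, hj, hjw⟩ hjG),
              fun hjG ↦ h2 ⟨j, hj, hjw⟩ hjG⟩
          · refine iff_of_false (fun hjF ↦ hj ((hF z j).mp hjF).1)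
              fun hjG ↦ hj ((hWf j).mp (hGW hjG))
      constructor
      · rintro ⟨hz, hzG⟩
        have hzw : w ∈ F z := (show F z = G from hzG) ▸ hwG
        obtain ⟨_, r, hr⟩ := (hF z w).mp hzw
        obtain ⟨q₀, hq₀⟩ := (hC _).mp hz
        have h1 : PrimeSpectrum.comap (algebraMap R _) r = PrimeSpectrum.comap ρ q₀ := by
          apply v.isOpenEmbedding.injective
          rw [← hbh w hw, hq₀, hβz, hr]
        -- A point of the chart over Spec D lies in the restricted chart, which is an affine space
        -- over Spec D because all t_j vanish on Spec D.
        obtain ⟨q, rfl⟩ := exists_comap_chartRestrict (hρt w) hσt hsurj r (by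
          have : RingHom.ker ρ ≤ (PrimeSpectrum.comap ρ q₀).asIdeal :=
            Ideal.comap_mono bot_le
          rw [← h1] at this
          exact this)
        exact ⟨q, (hFG q hr).mp hzG, hr⟩
      · rintro ⟨q, hq, hqz⟩
        refine ⟨(hC _).mpr ⟨PrimeSpectrum.comap MvPolynomial.C q, ?_⟩, (hFG q hqz).mpr hq⟩
        have h2 : PrimeSpectrum.comap ρ (PrimeSpectrum.comap MvPolynomial.C q) =
            PrimeSpectrum.comap (algebraMap R _) (PrimeSpectrum.comap π q) := by
          rw [← PrimeSpectrum.comap_comp_apply, ← PrimeSpectrum.comap_comp_apply]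
          congr 1
          exact RingHom.ext fun x ↦ (chartRestrict_algebraMap (hρt w) hσt x).symm
        exact (congrArg v h2).trans ((hbh w hw _).symm.trans ((congrArg b hqz).trans (hβz z).symm))
    have hV (q) (hq : q ∈ coordSet D J G') (j : ι) :
        j ∈ (Finset.univ.filter fun j ↦ (j ∉ G ∨ j = w) ∧ chartExp a Wf w j ≠ 0) ↔
          π (chartCoord t (W \ {w}) w j) ∈ q.asIdeal ∧ chartExp a Wf w j ≠ 0 := by
      simp only [Finset.mem_filter, Finset.mem_univ, true_and]
      refine and_congr_left fun _ ↦ ?_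
      by_cases hj : j ∈ W \ {w}
      · rw [chartRestrict_chartCoord_of_mem _ _ hj]
        have hjw : j ≠ w := hj.2
        simp only [hjw, or_false]
        exact ⟨fun hjG ↦ hq.1 ⟨j, hj⟩ hjG, fun hX hjG ↦ hq.2 ⟨j, hj⟩ hjG hX⟩
      · rw [chartRestrict_chartCoord_of_notMem _ _ hj, hρt, map_zero]
        simp only [zero_mem, iff_true]
        by_cases hjw : j = w
        · exact .inr hjw
        · exact .inl fun hjG ↦ hj ⟨(hWf j).mp (hGW hjG), hjw⟩
    have hdisj : Disjoint J G' := Set.disjoint_left.mpr fun i h1 h2 ↦ h1 h2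
    have hcard : G'.ncard = G.card - 1 := by
      rw [← Finset.card_erase_of_mem hwG, ← Set.ncard_coe_finset,
        ← Set.ncard_image_of_injective G' Subtype.val_injective]
      congr 1
      ext j
      simp only [Set.mem_image, Finset.mem_coe, Finset.mem_erase]
      constructor
      · rintro ⟨i, hi, rfl⟩
        exact ⟨i.2.2, hi⟩
      · rintro ⟨hjw, hjG⟩
        exact ⟨⟨j, (hWf j).mp (hGW hjG), hjw⟩, hjG, rfl⟩
    -- Every coordinate is prescribed to vanish or not to vanish, so no free affine factor is left.
    have hcompl : (J ∪ G')ᶜ = ∅ := by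
      ext i
      simp only [Set.mem_compl_iff, Set.mem_union, Set.mem_empty_iff_false, iff_false, not_not]
      exact (em (i.1 ∈ G)).symm
    rw [𝒴.contr_eq_weight_mul (h w hw) hφ' (chartRestrict_surjective (hρt w) hσt hsurj) hπ θ
      (he w) (chartExp a Wf w) hc (isLocallyClosed_coordSet D J G') hS _ hV,
      map_chartExp a hGW hwG (by simpa only [hWf] using hWa),
      AlgVar.setCls_coordSet D J G' hdisj, hcard, hcompl, Set.ncard_empty, pow_zero, one_mul,
      map_mul, map_pow, map_sub, map_one]
    ring
  rw [𝒴.specialFiber.contr_eq_sum θ F (isLocallyClosed_preimage_of_mem_iff hU hF)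
    (hCl.preimage β.continuous), ← Finset.sum_subset (Finset.subset_univ (Wf.powerset.erase ∅))
    (fun G _ hG ↦ hzero G hG), Finset.sum_congr rfl key, ← Finset.sum_mul,
    sum_weight hθ a Wf (posPart a Wfᶜ) (by simpa only [hWf] using hWa),
    ← posPart_union a disjoint_compl_right, Finset.union_compl]

end RegularSncModel

end Blowup

section Invariance

variable {O : Type u} [CommRing O] [IsLocalRing O] {K : Type u} [Field K] [Algebra O K]
  {X : Scheme.{u}} {f : X ⟶ Spec (CommRingCat.of K)}

namespace RegularSncModel

variable {𝒳 𝒴 : RegularSncModel O f}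

/-- Outside the support the stalk of the ideal sheaf is the unit ideal, which cannot lie in the
maximal ideal of the local ring. -/
lemma mem_support_of_pull_le {I : 𝒳.carrier.IdealSheafData} {R : CommRingCat.{u}}
    {v : Spec R ⟶ 𝒳.carrier} [IsOpenImmersion v] {φ : CommRingCat.of O ⟶ R}
    (hφ : v ≫ 𝒳.hom = Spec.map φ) (r : Spec R) (hr : pull I v ≤ r.asIdeal) :
    v r ∈ I.support := by
  by_contra h
  obtain ⟨κ, hloc, hκ, -⟩ := exists_stalkHom v hφ r rfl
  let := κ.hom.toAlgebra
  have hloc : IsLocalization.AtPrime (𝒳.carrier.presheaf.stalk (v r)) r.asIdeal := hloc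
  have h1 := stalkIdeal_eq_top_of_notMem_support h
  rw [stalkIdeal_eq_pull, ← hκ, pull_SpecMap_comp] at h1
  have h2 := h1.ge.trans (Ideal.map_mono (f := κ.hom) hr)
  have h3 := IsLocalization.AtPrime.map_eq_maximalIdeal r.asIdeal
    (𝒳.carrier.presheaf.stalk (v r))
  exact (maximalIdeal.isMaximal (𝒳.carrier.presheaf.stalk (v r))).ne_top
    (h3.symm.trans (top_le_iff.mp h2))

/-- A center contained in the special fiber lies in one of its components. -/
lemma exists_mem_exponent_ne_zero {I : 𝒳.carrier.IdealSheafData}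
    (hI : ∀ z ∈ I.support, 𝒳.hom z = closedPoint O) {R : CommRingCat.{u}}
    {v : Spec R ⟶ 𝒳.carrier} [IsOpenImmersion v] {φ : CommRingCat.of O ⟶ R}
    (hφ : v ≫ 𝒳.hom = Spec.map φ) {ι : Type} [Fintype ι] {t : ι → R} {a : ι → ℕ}
    (ht : IsPrimeFamily t)
    (hφt : (maximalIdeal O).map φ.hom = Ideal.span {∏ i, t i ^ a i}) {W : Set ι}
    (hv : pull I v = Ideal.span (t '' W)) : ∃ i ∈ W, a i ≠ 0 := by
  have hp := ht.isPrime W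
  -- At the generic point of the center, the equation ∏ tᵢ^aᵢ of the special fiber lies in the prime
  -- ideal of the center, so one of its factors with nonzero exponent does.
  let r : Spec R := (⟨Ideal.span (t '' W), hp⟩ : PrimeSpectrum R)
  have h1 := hI (v r) (mem_support_of_pull_le hφ r hv.le)
  have h2 : Spec.map φ r = closedPoint O := by
    rw [← hφ, Scheme.Hom.comp_apply, h1]
  have h3 : maximalIdeal O = (Ideal.span (t '' W)).comap φ.hom :=
    congrArg PrimeSpectrum.asIdeal h2.symm
  have h4 : ∏ i, t i ^ a i ∈ Ideal.span (t '' W) := by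
    have h5 := Ideal.map_le_iff_le_comap.mpr h3.le
    rw [hφt] at h5
    exact h5 (Ideal.mem_span_singleton_self _)
  obtain ⟨i, -, hi⟩ := Ideal.IsPrime.prod_mem_iff.mp h4
  refine ⟨i, ?_, ?_⟩
  · by_contra hiW
    exact ht.notMem W i hiW (hp.mem_of_pow_mem _ hi)
  · intro h0
    rw [h0, pow_zero] at hi
    exact hp.ne_top ((Ideal.eq_top_iff_one _).mpr hi)

/-- Noetherian induction on C reduces to a neighbourhood of the generic point η in its closure.
There the parameters describing the special fiber and the center can be chosen to vanish on the
whole piece. -/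
lemma contr_preimage_eq {b : 𝒴.carrier ⟶ 𝒳.carrier} (hbp : b ≫ 𝒳.hom = 𝒴.hom)
    {I : 𝒳.carrier.IdealSheafData} (hb : IsBlowup b I)
    (hI : ∀ z ∈ I.support, 𝒳.hom z = closedPoint O) (hnc : HasNormalCrossings 𝒳.hom I)
    {β : 𝒴.specialFiber.carrier ⟶ 𝒳.specialFiber.carrier}
    (hβ : β ≫ 𝒳.specialFiberι = 𝒴.specialFiberι ≫ b)
    {A : Type*} [CommRing A] [Algebra ℚ A] (θ : K0 (ResidueField O) →+* A)
    (hθ : (1 - θ (lefschetz (ResidueField O))) ^ 2 = 0)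
    {C : Set 𝒳.specialFiber.carrier} (hC : IsLocallyClosed C) :
    𝒴.specialFiber.contr θ (β ⁻¹' C) = 𝒳.specialFiber.contr θ C := by
  classical
  refine locallyClosed_induction
    (Q := fun C ↦ 𝒴.specialFiber.contr θ (β ⁻¹' C) = 𝒳.specialFiber.contr θ C) ?_ ?_ ?_ hC
  · rw [Set.preimage_empty, AlgVar.contr_empty, AlgVar.contr_empty]
  · intro C F hC hF h1 h2
    rw [𝒳.specialFiber.contr_closed_open θ hC hF, ← h1, ← h2, Set.preimage_inter,
      Set.preimage_inter, Set.preimage_compl]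
    exact 𝒴.specialFiber.contr_closed_open θ (hC.preimage β.continuous)
      (hF.preimage β.continuous)
  intro η S hS hη
  have hβz (z) : 𝒳.specialFiberι (β z) = b (𝒴.specialFiberι z) := congr($hβ z)
  obtain ⟨R, _, v, _, φ, hφ, q, ι, _, t, a, hq, hvS, ht, htq, hφt, hv⟩ :=
    𝒳.exists_chart hnc η hS hη
  let U : Set 𝒳.specialFiber.carrier := 𝒳.specialFiberι ⁻¹' Set.range v
  have hU : IsOpen U :=
    v.isOpenEmbedding.isOpen_range.preimage 𝒳.specialFiberι.continuous
  refine ⟨U, hvS, hU, ⟨q, hq⟩, ?_⟩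
  -- The closure of η within the chart is Spec D. The maximal ideal of O dies in D, which makes D an
  -- algebra over the residue field.
  let D := R ⧸ q.asIdeal
  have hφq : maximalIdeal O = q.asIdeal.comap φ.hom := by
    have h2 : Spec.map φ q = closedPoint O := by
      rw [← hφ, Scheme.Hom.comp_apply, hq, 𝒳.hom_specialFiberι]
    exact congrArg PrimeSpectrum.asIdeal h2.symm
  have hφ0 (o : O) (ho : o ∈ maximalIdeal O) :
      ((Ideal.Quotient.mk q.asIdeal).comp φ.hom) o = 0 :=
    Ideal.Quotient.eq_zero_iff_mem.mpr (hφq.le ho)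
  let ψ : ResidueField O →+* D := Ideal.Quotient.lift (maximalIdeal O) _ hφ0
  let : Algebra (ResidueField O) D := ψ.toAlgebra
  let ρ : R →+* D := Ideal.Quotient.mk q.asIdeal
  have hsurj : Function.Surjective ρ := Ideal.Quotient.mk_surjective
  have hρ : ρ.comp φ.hom = (algebraMap (ResidueField O) D).comp (residue O) :=
    RingHom.ext fun o ↦ (Ideal.Quotient.lift_mk (a := o) (maximalIdeal O) _ hφ0).symm
  have hρt (i) : ρ (t i) = 0 := Ideal.Quotient.eq_zero_iff_mem.mpr (htq i)
  have hD : Algebra.FiniteType (ResidueField O) D := 𝒳.finiteType_of_surjective v hφ hsurj hρ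
  have hrange (r : PrimeSpectrum R) :
      (∃ q', PrimeSpectrum.comap ρ q' = r) ↔ q.asIdeal ≤ r.asIdeal := by
    have := congrArg (r ∈ ·) (range_comap_of_surjective D ρ hsurj)
    rw [Ideal.mk_ker] at this
    exact this.to_iff
  have hCiff (z : 𝒳.specialFiber.carrier) : z ∈ closure {η} ∩ U ↔
      ∃ q' : PrimeSpectrum D, v (PrimeSpectrum.comap ρ q') = 𝒳.specialFiberι z := by
    have hspec (r : Spec R) (hr : v r = 𝒳.specialFiberι z) :
        z ∈ closure {η} ↔ q.asIdeal ≤ r.asIdeal := by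
      rw [← specializes_iff_mem_closure,
        ← 𝒳.specialFiberι.isEmbedding.isInducing.specializes_iff, ← hr, ← hq,
        v.isOpenEmbedding.isInducing.specializes_iff]
      exact (PrimeSpectrum.le_iff_specializes q r).symm
    constructor
    · rintro ⟨hz, r, hr⟩
      obtain ⟨q', rfl⟩ := (hrange r).mpr ((hspec r hr).mp hz)
      exact ⟨q', hr⟩
    · rintro ⟨q', hq'⟩
      exact ⟨(hspec _ hq').mpr ((hrange _).mp ⟨q', rfl⟩), _, hq'⟩
  have hCl : IsLocallyClosed (closure {η} ∩ U) :=
    isClosed_closure.isLocallyClosed.inter hU.isLocallyClosed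
  rw [contr_stratum θ hφ ht hφt hsurj hρ hρt hCiff]
  -- Either the center misses the chart, where the blowup is an isomorphism, or the computation with
  -- tori applies.
  obtain hv | ⟨W, hv⟩ := hv
  · obtain ⟨h, _, hh, hhr⟩ := hb.exists_section hv
    have hh' (r) : b (h r) = v r := congr($hh r)
    refine contr_stratum θ (v := h) (by rw [← hbp, reassoc_of% hh, hφ]) ht hφt hsurj hρ hρt
      fun z ↦ ?_
    change β z ∈ closure {η} ∩ U ↔ _
    rw [hCiff]
    refine exists_congr fun q' ↦ ?_
    rw [hβz]
    constructor
    · intro hq'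
      obtain ⟨r, hr⟩ := hhr _ ⟨_, hq'⟩
      rw [← hr, hh'] at hq'
      rw [v.isOpenEmbedding.injective hq', hr]
    · intro hq'
      exact (hh' _).symm.trans (congrArg b hq')
  · exact contr_preimage_stratum θ hbp hb hθ hφ ht hφt hsurj hρ hρt hCiff hv
      (exists_mem_exponent_ne_zero hI hφ ht hφt hv) hβ hCl

/-- Blowing up a center with normal crossings does not change the invariant. -/
theorem serreTilde_eq_of_isBlowupOf (h : 𝒴.IsBlowupOf 𝒳) : 𝒴.serreTilde = 𝒳.serreTilde := by
  obtain ⟨b, I, hbp, -, hb, -, hI, hnc⟩ := h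
  let β : 𝒴.specialFiber.carrier ⟶ 𝒳.specialFiber.carrier :=
    pullback.lift (𝒴.specialFiberι ≫ b) 𝒴.specialFiber.hom (by
      rw [Category.assoc, hbp]; exact 𝒴.specialFiberι_hom)
  have hβ : β ≫ 𝒳.specialFiberι = 𝒴.specialFiberι ≫ b := pullback.lift_fst _ _ _
  have := contr_preimage_eq hbp hb hI hnc hβ
    (A := K0Q (ResidueField O) ⧸ idealLQ (ResidueField O) 2) (toK0QQuot (ResidueField O)) toK0QQuot_sq
    (C := Set.univ) isOpen_univ.isLocallyClosed
  rw [Set.preimage_univ] at this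
  rw [serreTilde, serreTilde, AlgVar.serreTilde_eq_contr, AlgVar.serreTilde_eq_contr, this]

end RegularSncModel

end Invariance

/-! ### Surjections of regular local rings -/

section RegularQuotient

variable {P R : Type*} [CommRing P] [CommRing R]

lemma map_maximalIdeal_of_surjective [IsLocalRing P] [IsLocalRing R] {g : P →+* R}
    (hg : Function.Surjective g) : (maximalIdeal P).map g = maximalIdeal R := by
  have hl : IsLocalHom g := hg.isLocalHom
  have hc : (maximalIdeal R).comap g = maximalIdeal P := ((local_hom_TFAE g).out 0 4).mp hl
  rw [← hc, Ideal.map_comap_of_surjective g hg]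

/-- Lifts of generators of the maximal ideal of a quotient generate, together with the kernel. -/
lemma exists_finset_sup_ker [IsLocalRing P] [IsLocalRing R] [IsNoetherianRing R] {g : P →+* R}
    (hg : Function.Surjective g) :
    ∃ Z : Set P, Z.Finite ∧ Z.ncard ≤ (maximalIdeal R).spanFinrank ∧
      Ideal.span Z ⊔ RingHom.ker g = maximalIdeal P := by
  have hfg : Submodule.FG (maximalIdeal R) := (maximalIdeal R).fg_of_isNoetherianRing
  have hl : IsLocalHom g := hg.isLocalHom
  refine ⟨Function.surjInv hg '' (maximalIdeal R).generators, hfg.finite_generators.image _, ?_, ?_⟩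
  · rw [← hfg.generators_ncard]
    exact Set.ncard_image_le hfg.finite_generators
  · have hc : (maximalIdeal R).comap g = maximalIdeal P := ((local_hom_TFAE g).out 0 4).mp hl
    have hm : maximalIdeal R = Ideal.span (maximalIdeal R).generators :=
      (maximalIdeal R).span_generators.symm
    have : (maximalIdeal R).generators
        = g '' (Function.surjInv hg '' (maximalIdeal R).generators) := by
      rw [← Set.image_comp]
      conv_lhs => rw [← Set.image_id (maximalIdeal R).generators]
      exact Set.image_congr fun x _ ↦ (Function.surjInv_eq hg x).symm
    conv_rhs => rw [← hc, hm, this]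
    rw [← Ideal.map_span, Ideal.comap_map_of_surjective g hg, RingHom.ker_eq_comap_bot]

/-- The embedding dimension does not drop along a quotient by elements of `𝔪²`. -/
lemma spanFinrank_le_of_ker_le_sq [IsLocalRing P] [IsNoetherianRing P] [IsLocalRing R]
    {g : P →+* R} (hg : Function.Surjective g) (hker : RingHom.ker g ≤ maximalIdeal P ^ 2) :
    (maximalIdeal P).spanFinrank ≤ (maximalIdeal R).spanFinrank := by
  have : IsNoetherianRing R := isNoetherianRing_of_surjective P R g hg
  obtain ⟨Z, hfin, hcard, hZ⟩ := exists_finset_sup_ker hg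
  have hspan : Ideal.span Z = maximalIdeal P := by
    -- Since the kernel lies in 𝔪², Nakayama shows that the lifted generators alone generate the
    -- maximal ideal.
    refine le_antisymm (le_sup_left.trans hZ.le) ?_
    refine Submodule.le_of_le_smul_of_le_jacobson_bot (I := maximalIdeal P)
      (IsNoetherian.noetherian _) (maximalIdeal_le_jacobson _) ?_
    rw [smul_eq_mul, ← pow_two]
    conv_lhs => rw [← hZ]
    exact sup_le_sup_left hker _
  rw [← hspan]
  exact (Submodule.spanFinrank_span_le_ncard_of_finite hfin).trans hcard

/-- The kernel of a surjection of regular local rings is generated by part of a regular system of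
parameters; in particular it meets `𝔪²` in `𝔪 * ker`. -/
lemma mem_maximalIdeal_mul_ker [IsRegularLocalRing P] [IsRegularLocalRing R] {g : P →+* R}
    (hg : Function.Surjective g) {i : P} (hi : i ∈ RingHom.ker g) (hi2 : i ∈ maximalIdeal P ^ 2) :
    i ∈ maximalIdeal P * RingHom.ker g := by
  classical
  obtain ⟨Z, hfin, hcard, hZ⟩ := exists_finset_sup_ker hg
  have hkle : RingHom.ker g ≤ maximalIdeal P := le_sup_right.trans hZ.le
  let A : Set (maximalIdeal P) := {x | x.1 ∈ Z ∨ x.1 ∈ RingHom.ker g}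
  have hA : Submodule.span P A = ⊤ := by
    apply Submodule.map_injective_of_injective (maximalIdeal P).injective_subtype
    rw [Submodule.map_span, Submodule.map_top, Submodule.range_subtype]
    refine le_antisymm ?_ ?_
    · rw [Submodule.span_le]; rintro _ ⟨x, -, rfl⟩; exact x.2
    · conv_lhs => rw [← hZ]
      refine sup_le (Ideal.span_le.mpr fun z hz ↦ Submodule.subset_span ?_)
        fun z hz ↦ Submodule.subset_span ?_
      · exact ⟨⟨z, hZ.le (Ideal.mem_sup_left (Ideal.subset_span hz))⟩, Or.inl hz, rfl⟩
      · exact ⟨⟨z, hkle hz⟩, Or.inr hz, rfl⟩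
  have hA' := CotangentSpace.span_image_eq_top_iff.mpr hA
  -- A basis of the cotangent space is selected among lifts of generators of the maximal ideal of R
  -- and elements of the kernel. Its representatives are a regular system of parameters of P.
  obtain ⟨b, hbA, hbs, hbl⟩ :=
    exists_linearIndependent (ResidueField P) ((maximalIdeal P).toCotangent '' A)
  rw [hA'] at hbs
  have hfb : Finite b := hbl.finite
  choose t htA htc using fun v : b ↦ hbA v.2
  have hspan : Submodule.span P (Set.range t) = ⊤ := by
    rw [← CotangentSpace.span_image_eq_top_iff, ← hbs]
    congr 1
    ext v
    constructor
    · rintro ⟨_, ⟨w, rfl⟩, rfl⟩; rw [htc]; exact w.2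
    · intro hv; exact ⟨_, ⟨⟨v, hv⟩, rfl⟩, htc _⟩
  have ht : IsParameterFamily fun v : b ↦ (t v).1 := by
    refine ⟨?_, ?_⟩
    · have := congrArg (Submodule.map (maximalIdeal P).subtype) hspan
      rw [Submodule.map_span, Submodule.map_top, Submodule.range_subtype, ← Set.range_comp] at this
      exact this
    · rw [← (IsRegularLocalRing.iff_finrank_cotangentSpace P).mp inferInstance]
      congr 2
      have B := Module.Basis.mk hbl (by simpa using hbs.ge)
      rw [Module.finrank_eq_nat_card_basis B]
  let S : Set b := {v | (t v).1 ∈ RingHom.ker g}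
  let J : Ideal P := Ideal.span ((fun v : b ↦ (t v).1) '' S)
  have hJle : J ≤ RingHom.ker g := by
    rw [Ideal.span_le]; rintro _ ⟨v, hv, rfl⟩; exact hv
  have hScard : Nat.card (Sᶜ : Set b) ≤ Z.ncard := by
    have := hfin.to_subtype
    rw [← Nat.card_coe_set_eq]
    refine Nat.card_le_card_of_injective
      (fun v : (Sᶜ : Set b) ↦ (⟨(t v).1, (htA v).resolve_right v.2⟩ : Z)) fun v w hvw ↦ ?_
    have h1 : t v = t w := Subtype.ext (by simpa using hvw)
    refine Subtype.ext (Subtype.ext ?_)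
    rw [← htc, ← htc, h1]
  obtain ⟨hloc, hQ⟩ := ht.quotient S
  have hdom := hQ.isDomain
  -- P/J is a regular domain of dimension at most dim R, because the parameters outside the kernel
  -- are among the chosen lifts. An element of the kernel outside J would lower the dimension of P/J
  -- below dim R, while R is still a quotient.
  have hJ : J = RingHom.ker g := by
    refine le_antisymm hJle fun a ha ↦ ?_
    by_contra haJ
    have h0 : Ideal.Quotient.mk J a ∈ nonZeroDivisors (P ⧸ J) :=
      mem_nonZeroDivisors_of_ne_zero fun h ↦ haJ (Ideal.Quotient.eq_zero_iff_mem.mp h)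
    have h1 := ringKrullDim_quotient_succ_le_of_nonZeroDivisor h0
    have h2 : ringKrullDim R ≤ ringKrullDim ((P ⧸ J) ⧸ Ideal.span {Ideal.Quotient.mk J a}) := by
      refine ringKrullDim_le_of_surjective (Ideal.Quotient.lift _ (Ideal.Quotient.lift J g hJle)
        fun x hx ↦ ?_) (Ideal.Quotient.lift_surjective_of_surjective _ _
          (Ideal.Quotient.lift_surjective_of_surjective _ _ hg))
      obtain ⟨y, rfl⟩ := Ideal.mem_span_singleton'.mp hx
      exact (map_mul _ _ _).trans ((congrArg _ ha).trans (mul_zero _))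
    have h3 : ringKrullDim (P ⧸ J) ≤ ringKrullDim R := by
      rw [← hQ.card_eq, ← IsRegularLocalRing.spanFinrank_maximalIdeal (R := R)]
      exact_mod_cast hScard.trans hcard
    rw [← IsRegularLocalRing.spanFinrank_maximalIdeal (R := R)] at h2 h3
    have h4 := ((add_le_add_left h2 1).trans h1).trans h3
    have h5 : (maximalIdeal R).spanFinrank + 1 ≤ (maximalIdeal R).spanFinrank := by
      exact_mod_cast h4
    omega
  rw [← hJ] at hi ⊢
  have hJr : J = Ideal.span (Set.range fun v : S ↦ (t v).1) := by
    simp only [J, Set.image_eq_range]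
  have := Fintype.ofFinite S
  rw [hJr, Ideal.mem_span_range_iff_exists_fun] at hi
  obtain ⟨a, rfl⟩ := hi
  refine Ideal.sum_mem _ fun v _ ↦
    Ideal.mul_mem_mul ?_ (Ideal.subset_span ⟨v.1, v.2, rfl⟩)
  -- The element vanishes in the cotangent space, where the parameters are independent, so all its
  -- coefficients lie in the maximal ideal.
  have hzero : ∑ v : S, residue P (a v) • (v.1 : b).1 = 0 := by
    have h := (Ideal.toCotangent_eq_zero _ (∑ v : S, a v • t v)).mpr (by simpa using hi2)
    rw [map_sum] at h
    rw [← h]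
    refine Finset.sum_congr rfl fun v _ ↦ ?_
    rw [map_smul, htc]
    rfl
  have hli : LinearIndependent (ResidueField P) fun v : S ↦ (v.1 : b).1 :=
    hbl.comp _ Subtype.val_injective
  rw [← residue_eq_zero_iff]
  exact Fintype.linearIndependent_iff.mp hli _ hzero v

end RegularQuotient

/-! ### Differentials and the square of the maximal ideal -/

section Derivation

open TensorProduct

variable {P κ : Type*} [CommRing P] [Field κ] [Algebra P κ]

/-- With κ = P/𝔪, the module κ ⊗ M is M/𝔪M. -/
lemma one_tmul_eq_zero_iff (hκ : Function.Surjective (algebraMap P κ)) {M : Type*} [AddCommGroup M]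
    [Module P M] (x : M) :
    (1 : κ) ⊗ₜ[P] x = 0 ↔ x ∈ RingHom.ker (algebraMap P κ) • (⊤ : Submodule P M) := by
  let e : (P ⧸ RingHom.ker (Algebra.ofId P κ)) ≃ₐ[P] κ :=
    Ideal.quotientKerAlgEquivOfSurjective (f := Algebra.ofId P κ) hκ
  let e' := (TensorProduct.congr e.toLinearEquiv (LinearEquiv.refl P M)).symm.trans
    (quotTensorEquivQuotSMul M (RingHom.ker (Algebra.ofId P κ)))
  have h : e' ((1 : κ) ⊗ₜ[P] x) = Submodule.Quotient.mk x := by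
    have h1 : e.symm 1 = Ideal.Quotient.mk _ 1 := by rw [map_one, map_one]
    change quotTensorEquivQuotSMul M _ (e.symm 1 ⊗ₜ[P] x) = _
    rw [h1, quotTensorEquivQuotSMul_mk_tmul, one_smul]
  rw [← e'.map_eq_zero_iff, h, Submodule.Quotient.mk_eq_zero]
  rfl

variable {k O : Type*} [Field k] [CommRing O] [Algebra O k] [Algebra k κ] [Algebra O P]
  [Algebra O κ] [IsScalarTower O P κ] [IsScalarTower O k κ] [Algebra.FormallySmooth k κ]

-- Formal smoothness of κ over k gives a k-algebra section s of the square-zero extension P/J → κ,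
-- where J is 𝔪² plus the extension of the kernel of O → k. The difference x ↦ s(x̄) - x is an
-- O-derivation with values in the kernel of P/J → κ. If df vanishes in κ ⊗ Ω this derivation kills
-- f, but for f in 𝔪 its value is the class of -f.
open KaehlerDifferential in
lemma mem_sup_of_one_tmul_D_eq_zero (hκ : Function.Surjective (algebraMap P κ))
    (hk : Function.Surjective (algebraMap O k)) {f : P}
    (hf : f ∈ RingHom.ker (algebraMap P κ)) (hdf : (1 : κ) ⊗ₜ[P] D O P f = 0) :
    f ∈ RingHom.ker (algebraMap P κ) ^ 2 ⊔ (RingHom.ker (algebraMap O k)).map (algebraMap O P) := by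
  let m := RingHom.ker (algebraMap P κ)
  let J := m ^ 2 ⊔ (RingHom.ker (algebraMap O k)).map (algebraMap O P)
  have hJm : J ≤ m := by
    refine sup_le (Ideal.pow_le_self two_ne_zero) (Ideal.map_le_iff_le_comap.mpr fun x hx ↦ ?_)
    change algebraMap P κ (algebraMap O P x) = 0
    rw [← IsScalarTower.algebraMap_apply, IsScalarTower.algebraMap_apply O k κ, hx, map_zero]
  have hE : ∀ x ∈ RingHom.ker (algebraMap O k), algebraMap O (P ⧸ J) x = 0 := fun x hx ↦
    Ideal.Quotient.eq_zero_iff_mem.mpr (Ideal.mem_sup_right (Ideal.mem_map_of_mem _ hx))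
  let aE : k →+* P ⧸ J := (Ideal.Quotient.lift _ (algebraMap O (P ⧸ J)) hE).comp
    (RingHom.quotientKerEquivOfSurjective hk).symm.toRingHom
  have haE : ∀ x, aE (algebraMap O k x) = algebraMap O (P ⧸ J) x := fun x ↦ by
    have : (RingHom.quotientKerEquivOfSurjective hk).symm (algebraMap O k x)
        = Ideal.Quotient.mk _ x := by
      rw [RingEquiv.symm_apply_eq]; rfl
    change Ideal.Quotient.lift _ _ hE ((RingHom.quotientKerEquivOfSurjective hk).symm _) = _
    rw [this, Ideal.Quotient.lift_mk]
  algebraize [aE]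
  let g₀ : P ⧸ J →+* κ := Ideal.Quotient.lift J (algebraMap P κ) fun x hx ↦ hJm hx
  let g : P ⧸ J →ₐ[k] κ := { g₀ with
    commutes' := fun x ↦ by
      obtain ⟨x, rfl⟩ := hk x
      change g₀ (aE _) = _
      rw [haE, ← IsScalarTower.algebraMap_apply, IsScalarTower.algebraMap_apply O P κ]
      rfl }
  have hgmk : ∀ x, g (Ideal.Quotient.mk J x) = algebraMap P κ x := fun x ↦ rfl
  have hgs : Function.Surjective g := fun y ↦ by
    obtain ⟨x, rfl⟩ := hκ y; exact ⟨Ideal.Quotient.mk J x, rfl⟩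
  have hsq : ∀ a b, g a = 0 → g b = 0 → a * b = 0 := fun a b ha hb ↦ by
    obtain ⟨a, rfl⟩ := Ideal.Quotient.mk_surjective a
    obtain ⟨b, rfl⟩ := Ideal.Quotient.mk_surjective b
    rw [← map_mul]
    refine Ideal.Quotient.eq_zero_iff_mem.mpr (Ideal.mem_sup_left ?_)
    rw [pow_two]
    exact Ideal.mul_mem_mul ha hb
  have hnil : IsNilpotent (RingHom.ker (g : P ⧸ J →+* κ)) := by
    refine ⟨2, ?_⟩
    rw [pow_two, Ideal.zero_eq_bot, eq_bot_iff, Ideal.mul_le]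
    exact fun a ha b hb ↦ hsq a b ha hb
  let s : κ →ₐ[k] P ⧸ J := Algebra.FormallySmooth.liftOfSurjective (AlgHom.id k κ) g hgs hnil
  have hs : ∀ x, g (s x) = x := fun x ↦
    Algebra.FormallySmooth.liftOfSurjective_apply (AlgHom.id k κ) g hgs hnil x
  have hsO : ∀ x : O, s (algebraMap O κ x) = algebraMap O (P ⧸ J) x := fun x ↦ by
    rw [IsScalarTower.algebraMap_apply O k κ, s.commutes]; exact haE x
  let δ : P → P ⧸ J := fun x ↦ s (algebraMap P κ x) - Ideal.Quotient.mk J x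
  have hδg : ∀ x, g (δ x) = 0 := fun x ↦ by
    simp only [δ, map_sub, hs, hgmk, sub_self]
  let D' : Derivation O P (P ⧸ J) := Derivation.mk'
    { toFun := δ
      map_add' := fun x y ↦ by simp only [δ, map_add]; ring
      map_smul' := fun c x ↦ by
        simp only [δ, Algebra.smul_def, map_mul, RingHom.id_apply,
          ← IsScalarTower.algebraMap_apply, hsO]
        rw [IsScalarTower.algebraMap_apply O P (P ⧸ J)]
        change _ - algebraMap P (P ⧸ J) (algebraMap O P c) * _ = _
        ring } fun x y ↦ by
      -- The defect in the Leibniz rule is exactly δ(x)δ(y), a product of two elements of a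
      -- square-zero ideal.
      have h := hsq _ _ (hδg x) (hδg y)
      change δ (x * y) = x • δ y + y • δ x
      simp only [δ, Algebra.smul_def, map_mul, Ideal.Quotient.algebraMap_eq] at h ⊢
      linear_combination h
  have hrange : ∀ ω : Ω[P⁄O], g (D'.liftKaehlerDifferential ω) = 0 := fun ω ↦ by
    have hω : ω ∈ Submodule.span P (Set.range (D O P)) := by
      rw [KaehlerDifferential.span_range_derivation]; trivial
    induction hω using Submodule.span_induction with
    | mem x hx =>
      obtain ⟨x, rfl⟩ := hx
      rw [Derivation.liftKaehlerDifferential_comp_D]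
      exact hδg x
    | zero => simp
    | add x y _ _ hx hy => rw [map_add, map_add, hx, hy, add_zero]
    | smul a x _ hx => rw [map_smul, Algebra.smul_def, map_mul, hx, mul_zero]
  rw [one_tmul_eq_zero_iff hκ] at hdf
  have hker : D'.liftKaehlerDifferential (D O P f) = 0 := by
    refine Submodule.smul_induction_on hdf (p := fun ω ↦ D'.liftKaehlerDifferential ω = 0)
      (fun a ha ω _ ↦ ?_) fun x y hx hy ↦ by rw [map_add, hx, hy, add_zero]
    rw [map_smul, Algebra.smul_def]
    exact hsq _ _ ha (hrange ω)
  rw [Derivation.liftKaehlerDifferential_comp_D] at hker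
  have hker' : s (algebraMap P κ f) - Ideal.Quotient.mk J f = 0 := hker
  rw [show algebraMap P κ f = 0 from hf, map_zero, zero_sub, neg_eq_zero] at hker'
  exact Ideal.Quotient.eq_zero_iff_mem.mp hker'

end Derivation

/-! ### A Jacobian criterion over a discrete valuation ring -/

section JacobianCriterion

open TensorProduct KaehlerDifferential

lemma ker_algebraMap_eq_maximalIdeal {P κ : Type*} [CommRing P] [IsLocalRing P] [Field κ]
    [Algebra P κ] (h : Function.Surjective (algebraMap P κ)) :
    RingHom.ker (algebraMap P κ) = maximalIdeal P :=
  eq_maximalIdeal (RingHom.ker_isMaximal_of_surjective _ h)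

/-- A regular quotient `R` of a regular local ring `P` which is smooth over a discrete valuation
ring with uniformizer `π ∉ 𝔪_P²` is smooth if and only if `π ∉ 𝔪_R²`. -/
lemma formallySmooth_iff_uniformizer_notMem_sq {O P R : Type*} [CommRing O] [IsDomain O]
    [IsDiscreteValuationRing O] [PerfectField (ResidueField O)] {π : O}
    (hπ : maximalIdeal O = Ideal.span {π})
    [CommRing P] [CommRing R] [Algebra O P] [Algebra O R] [Algebra P R] [IsScalarTower O P R]
    [IsRegularLocalRing P] [IsRegularLocalRing R] [Algebra.FormallySmooth O P]
    [Algebra.EssFiniteType O P] [Module.Free P Ω[P⁄O]] [IsLocalHom (algebraMap O R)]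
    (hPR : Function.Surjective (algebraMap P R))
    (hπP : algebraMap O P π ∉ maximalIdeal P ^ 2) :
    Algebra.FormallySmooth O R ↔ algebraMap O R π ∉ maximalIdeal R ^ 2 := by
  have hκ : Function.Surjective (algebraMap P (ResidueField R)) := by
    rw [IsScalarTower.algebraMap_eq P R (ResidueField R)]
    exact residue_surjective.comp hPR
  have hk : Function.Surjective (algebraMap O (ResidueField O)) := residue_surjective
  have hkerκ := ker_algebraMap_eq_maximalIdeal hκ
  have hkerk : RingHom.ker (algebraMap O (ResidueField O)) = Ideal.span {π} := by
    rw [← hπ]; exact ker_algebraMap_eq_maximalIdeal hk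
  have : Algebra.EssFiniteType P R := .of_surjective (Algebra.ofId P R) hPR
  have : Algebra.EssFiniteType O R := .comp O P R
  have : Algebra.EssFiniteType R (ResidueField R) := inferInstance
  have : Algebra.EssFiniteType O (ResidueField R) := .comp O R _
  have : Algebra.EssFiniteType (ResidueField O) (ResidueField R) := .of_comp O _ _
  have : Algebra.FormallySmooth (ResidueField O) (ResidueField R) :=
    Algebra.FormallySmooth.of_perfectField
  have hkle : RingHom.ker (algebraMap P R) ≤ maximalIdeal P :=
    le_maximalIdeal (RingHom.ker_ne_top _)
  have hpow : (maximalIdeal P ^ 2).map (algebraMap P R) = maximalIdeal R ^ 2 := by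
    rw [Ideal.map_pow, map_maximalIdeal_of_surjective hPR]
  have hD : ∀ x ∈ maximalIdeal P ^ 2, (1 : ResidueField R) ⊗ₜ[P] D O P x = 0 := fun x hx ↦ by
    rw [pow_two] at hx
    refine Submodule.mul_induction_on hx (fun a ha b hb ↦ ?_) fun a b ha hb ↦ by
      rw [map_add, tmul_add, ha, hb, add_zero]
    rw [← hkerκ] at ha hb
    rw [Derivation.leibniz, tmul_add, ← smul_tmul, ← smul_tmul, ← Algebra.algebraMap_eq_smul_one,
      ← Algebra.algebraMap_eq_smul_one, show algebraMap P (ResidueField R) a = 0 from ha,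
      show algebraMap P (ResidueField R) b = 0 from hb,
      zero_tmul, zero_tmul, add_zero]
  have hmem : ∀ i : RingHom.ker (algebraMap P R), (1 : ResidueField R) ⊗ₜ[P] i = 0 ↔
      i.1 ∈ maximalIdeal P * RingHom.ker (algebraMap P R) := fun i ↦ by
    rw [one_tmul_eq_zero_iff hκ, hkerκ, ← smul_eq_mul, ← Submodule.mem_smul_top_iff]
  -- With I the kernel of P → R, smoothness of R means that i ↦ di is injective from κ ⊗ I to κ ⊗ Ω.
  rw [Algebra.FormallySmooth.iff_injective_cotangentComplexBaseChange_residueField (P := P) hPR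
    (RingHom.ker (algebraMap P R)).fg_of_isNoetherianRing]
  have happ : ∀ i : RingHom.ker (algebraMap P R),
      cotangentComplexBaseChange O R P (ResidueField R) (1 ⊗ₜ i) = 1 ⊗ₜ D O P i.1 := fun i ↦ by
    rw [cotangentComplexBaseChange_tmul, one_smul]; rfl
  constructor
  · intro hinj hmem2
    rw [← hpow, IsScalarTower.algebraMap_apply O P R,
      Ideal.mem_map_iff_of_surjective _ hPR] at hmem2
    obtain ⟨x, hx, hxe⟩ := hmem2
    -- If π ∈ 𝔪_R², then π - x ∈ I for some x ∈ 𝔪_P², and its differential vanishes in κ ⊗ Ω.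
    -- Injectivity puts it in 𝔪_P I, and so π in 𝔪_P².
    have hi : algebraMap O P π - x ∈ RingHom.ker (algebraMap P R) := by
      rw [RingHom.mem_ker, map_sub, hxe, sub_self]
    have h0 : (1 : ResidueField R) ⊗ₜ[P] (⟨_, hi⟩ : RingHom.ker (algebraMap P R)) = 0 := by
      apply hinj
      rw [happ, map_zero, map_sub, Derivation.map_algebraMap, zero_sub, tmul_neg, hD x hx, neg_zero]
    rw [hmem] at h0
    have h1 : algebraMap O P π - x ∈ maximalIdeal P ^ 2 := by
      rw [pow_two]; exact Ideal.mul_mono_right hkle h0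
    exact hπP (by simpa using Ideal.add_mem _ h1 hx)
  · intro hπR
    rw [injective_iff_map_eq_zero]
    intro z hz
    obtain ⟨i, rfl⟩ : ∃ i : RingHom.ker (algebraMap P R), (1 : ResidueField R) ⊗ₜ[P] i = z := by
      exact TensorProduct.mk_surjective _ _ _ hκ z
    rw [happ] at hz
    -- An element i of I with zero differential has the form x + aπ with x ∈ 𝔪_P². If a is a unit,
    -- then π ∈ 𝔪_R². Otherwise i ∈ 𝔪_P², and regularity of R puts it in 𝔪_P I.
    have hd := mem_sup_of_one_tmul_D_eq_zero hκ hk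
      (hkerκ.symm ▸ hkle i.2 : i.1 ∈ RingHom.ker (algebraMap P (ResidueField R))) hz
    rw [hkerκ, hkerk, Ideal.map_span, Set.image_singleton] at hd
    obtain ⟨x, hx, y, hy, hxy⟩ := Submodule.mem_sup.mp hd
    obtain ⟨a, rfl⟩ := Ideal.mem_span_singleton'.mp hy
    rw [hmem]
    refine mem_maximalIdeal_mul_ker hPR i.2 ?_
    have hπm : algebraMap O P π ∈ maximalIdeal P := by
      have hl : IsLocalHom (algebraMap P R) := hPR.isLocalHom
      have hc : (maximalIdeal R).comap (algebraMap P R) = maximalIdeal P :=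
        ((local_hom_TFAE (algebraMap P R)).out 0 4).mp hl
      rw [← hc, Ideal.mem_comap, ← IsScalarTower.algebraMap_apply, mem_maximalIdeal, mem_nonunits_iff,
        isUnit_map_iff, ← mem_nonunits_iff, ← mem_maximalIdeal, hπ]
      exact Ideal.mem_span_singleton_self π
    by_cases ha : a ∈ maximalIdeal P
    · rw [← hxy]
      exact Ideal.add_mem _ hx (by rw [pow_two]; exact Ideal.mul_mem_mul ha hπm)
    · have hu : IsUnit (algebraMap P R a) := (not_not.mp ha).map _
      refine absurd ?_ hπR
      rw [← Ideal.unit_mul_mem_iff_mem _ hu, IsScalarTower.algebraMap_apply O P R, ← map_mul]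
      have h1 : algebraMap P R (a * algebraMap O P π) = - algebraMap P R x := by
        rw [eq_neg_iff_add_eq_zero, ← map_add, add_comm, hxy]; exact i.2
      rw [h1, ← hpow]
      exact neg_mem (Ideal.mem_map_of_mem _ hx)

end JacobianCriterion

/-- A uniformizer stays outside `𝔪²` in the local rings of affine space. -/
lemma uniformizer_notMem_sq_of_mvPolynomial {O : Type u} [CommRing O] [IsDomain O]
    [IsDiscreteValuationRing O] {π : O} (hπ : maximalIdeal O = Ideal.span {π}) {n : ℕ}
    (q : Ideal (MvPolynomial (Fin n) O)) [q.IsPrime] (hq : MvPolynomial.C π ∈ q) :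
    algebraMap O (Localization.AtPrime q) π ∉ maximalIdeal (Localization.AtPrime q) ^ 2 := by
  intro hmem
  let φ : MvPolynomial (Fin n) O →+* MvPolynomial (Fin n) (ResidueField O) :=
    MvPolynomial.map (residue O)
  have hφ : Function.Surjective φ := MvPolynomial.map_surjective _ residue_surjective
  have hkerφ : RingHom.ker φ = Ideal.span {MvPolynomial.C π} := by
    rw [MvPolynomial.ker_map, ker_residue, hπ, Ideal.map_span, Set.image_singleton]
  have hle : RingHom.ker φ ≤ q := by
    rw [hkerφ, Ideal.span_singleton_le_iff_mem]; exact hq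
  let q' := q.map φ
  have hq' : q'.IsPrime := Ideal.map_isPrime_of_surjective hφ hle
  have hcomap : q = q'.comap φ := by
    rw [Ideal.comap_map_of_surjective φ hφ, ← RingHom.ker_eq_comap_bot, sup_eq_left.mpr hle]
  let g := Localization.localRingHom q q' φ hcomap
  have hg : Function.Surjective g := by
    have h : ∀ (I : Ideal (MvPolynomial (Fin n) O)) [I.IsPrime] (h : I = q'.comap φ),
        Function.Surjective (Localization.localRingHom I q' φ h) := by
      rintro I hI rfl
      exact RingHom.surjective_localRingHom_of_surjective φ hφ q'
    exact h q hcomap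
  -- Reduction modulo π leads to a local ring of affine space over the residue field.
  have hker : RingHom.ker g = Ideal.span {algebraMap O (Localization.AtPrime q) π} := by
    refine le_antisymm (fun x hx ↦ ?_) ?_
    · obtain ⟨x, s, rfl⟩ := IsLocalization.exists_mk'_eq q.primeCompl x
      rw [RingHom.mem_ker, Localization.localRingHom_mk', IsLocalization.mk'_eq_zero_iff] at hx
      obtain ⟨m, hm⟩ := hx
      have hx0 : x ∈ RingHom.ker φ := by
        have hm0 : (m : MvPolynomial (Fin n) (ResidueField O)) ≠ 0 := fun h ↦
          m.2 (h ▸ q'.zero_mem)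
        exact (mul_eq_zero.mp hm).resolve_left hm0
      rw [hkerφ] at hx0
      obtain ⟨y, rfl⟩ := Ideal.mem_span_singleton'.mp hx0
      rw [IsLocalization.mk'_eq_mul_mk'_one, map_mul]
      refine Ideal.mul_mem_right _ _ (Ideal.mul_mem_left _ _ ?_)
      exact Ideal.mem_span_singleton_self _
    · rw [Ideal.span_singleton_le_iff_mem, RingHom.mem_ker,
        IsScalarTower.algebraMap_apply O (MvPolynomial (Fin n) O) (Localization.AtPrime q)]
      change Localization.localRingHom q q' φ hcomap (algebraMap _ _ (MvPolynomial.C π)) = 0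
      rw [Localization.localRingHom_to_map, (hkerφ.symm ▸ Ideal.mem_span_singleton_self _ :
        MvPolynomial.C π ∈ RingHom.ker φ), map_zero]
  -- If π were in 𝔪², dividing by it would not lower the embedding dimension. But π is a
  -- nonzerodivisor, so the dimension drops, and for regular rings the two numbers agree.
  have h1 := spanFinrank_le_of_ker_le_sq hg
    (by rw [hker, Ideal.span_singleton_le_iff_mem]; exact hmem)
  have h0 : algebraMap O (Localization.AtPrime q) π ∈ nonZeroDivisors (Localization.AtPrime q) := by
    refine mem_nonZeroDivisors_of_ne_zero fun h ↦ ?_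
    have hC : MvPolynomial.C (σ := Fin n) π = 0 :=
      IsLocalization.injective (Localization.AtPrime q) q.primeCompl_le_nonZeroDivisors
        (h.trans (map_zero _).symm)
    rw [MvPolynomial.C_eq_zero] at hC
    exact IsDiscreteValuationRing.not_isField O
      ((isField_iff_maximalIdeal_eq).mpr (by rw [hπ, hC, Ideal.span_singleton_eq_bot.mpr rfl]))
  have h2 := ringKrullDim_quotient_succ_le_of_nonZeroDivisor h0
  rw [← hker, ringKrullDim_eq_of_ringEquiv (RingHom.quotientKerEquivOfSurjective hg),
    ← IsRegularLocalRing.spanFinrank_maximalIdeal,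
    ← IsRegularLocalRing.spanFinrank_maximalIdeal] at h2
  have h3 : (maximalIdeal (Localization.AtPrime q')).spanFinrank + 1
      ≤ (maximalIdeal (Localization.AtPrime q)).spanFinrank := by exact_mod_cast h2
  omega

/-- A presentation of A by a polynomial ring exhibits R as a quotient of a local ring P of affine
space over O, to which the Jacobian criterion applies. -/
lemma formallySmooth_localization_iff {O A R : Type u} [CommRing O] [IsDomain O]
    [IsDiscreteValuationRing O] [PerfectField (ResidueField O)] {π : O}
    (hπ : maximalIdeal O = Ideal.span {π})
    [CommRing A] [CommRing R] [Algebra O A] [Algebra A R] [Algebra O R] [IsScalarTower O A R]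
    [Algebra.FiniteType O A] [IsRegularLocalRing R] (p : Ideal A) [p.IsPrime]
    [IsLocalization.AtPrime R p] [IsLocalHom (algebraMap O R)] :
    Algebra.FormallySmooth O R ↔ algebraMap O R π ∉ maximalIdeal R ^ 2 := by
  obtain ⟨n, f₀, hf₀⟩ := Algebra.FiniteType.iff_quotient_mvPolynomial''.mp
    (inferInstance : Algebra.FiniteType O A)
  let q := p.comap f₀
  have hq : q.IsPrime := inferInstanceAs (p.comap f₀).IsPrime
  let P := Localization.AtPrime q
  let fP : P →ₐ[O] R := IsLocalization.liftAlgHom (M := q.primeCompl)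
      (f := (IsScalarTower.toAlgHom O A R).comp f₀) fun x ↦
    IsLocalization.map_units (M := p.primeCompl) R ⟨f₀ x.1, x.2⟩
  have hfP : Function.Surjective fP := by
    intro x
    obtain ⟨x, ⟨s, hs⟩, rfl⟩ := IsLocalization.exists_mk'_eq p.primeCompl x
    obtain ⟨x, rfl⟩ := hf₀ x
    obtain ⟨s, rfl⟩ := hf₀ s
    refine ⟨IsLocalization.mk' (M := q.primeCompl) _ x ⟨s, hs⟩, ?_⟩
    refine (IsLocalization.lift_mk'_spec (M := q.primeCompl) _ _ _ _).mpr ?_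
    exact (IsLocalization.mk'_spec' R (f₀ x) (⟨f₀ s, hs⟩ : p.primeCompl)).symm
  algebraize [fP.toRingHom]
  have : Algebra.FormallyEtale (MvPolynomial (Fin n) O) P := .of_isLocalization q.primeCompl
  have : Algebra.FormallySmooth O P := .comp _ (MvPolynomial (Fin n) O) _
  have : Module.Free P Ω[P⁄O] := .of_equiv
    (KaehlerDifferential.tensorKaehlerEquivOfFormallyEtale O (MvPolynomial (Fin n) O) P)
  have : Algebra.EssFiniteType (MvPolynomial (Fin n) O) P := .of_isLocalization _ q.primeCompl
  have : Algebra.EssFiniteType O P := .comp O (MvPolynomial (Fin n) O) P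
  refine formallySmooth_iff_uniformizer_notMem_sq (P := P) hπ hfP
    (uniformizer_notMem_sq_of_mvPolynomial hπ q ?_)
  change f₀ (algebraMap O _ π) ∈ p
  rw [AlgHom.commutes, ← IsLocalization.AtPrime.to_map_mem_maximal_iff R p,
    ← IsScalarTower.algebraMap_apply, mem_maximalIdeal, mem_nonunits_iff, isUnit_map_iff,
    ← mem_nonunits_iff, ← mem_maximalIdeal, hπ]
  exact Ideal.mem_span_singleton_self π

/-! ### Smoothness at the points of the special fiber -/

section SmoothLocus

variable {X : Scheme.{u}}

/-- A local ring is its own localization at the maximal ideal. Smoothness of stalk maps over the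
closed point can therefore be tested over O itself. -/
lemma isIso_germ_closedPoint {O : Type u} [CommRing O] [IsLocalRing O] {y : Spec (.of O)}
    (hy : y = closedPoint O) :
    IsIso ((Scheme.ΓSpecIso (.of O)).inv ≫ (Spec (.of O)).presheaf.germ ⊤ y trivial) := by
  subst hy
  let : Algebra O ((Spec (.of O)).presheaf.stalk (closedPoint O)) :=
    StructureSheaf.stalkAlgebra O (closedPoint O)
  have h0 : IsLocalization.AtPrime ((Spec (.of O)).presheaf.stalk (closedPoint O))
    (closedPoint O).asIdeal := StructureSheaf.IsLocalization.to_stalk O (closedPoint O)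
  have hb : Function.Bijective (algebraMap O ((Spec (.of O)).presheaf.stalk (closedPoint O))) :=
    (IsLocalization.atUnits O (closedPoint O).asIdeal.primeCompl fun y hy ↦
      not_not.mp (show ¬ ¬ IsUnit y from hy)).bijective
  have : IsIso (CommRingCat.ofHom
      (algebraMap O ((Spec (.of O)).presheaf.stalk (closedPoint O)))) :=
    (ConcreteCategory.isIso_iff_bijective _).mpr hb
  exact this

lemma ΓSpecIso_inv_comp_germ {O : CommRingCat.{u}} (p : X ⟶ Spec O) (x : X) :
    (Scheme.ΓSpecIso O).inv ≫ p.appTop ≫ X.presheaf.germ ⊤ x trivial =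
      ((Scheme.ΓSpecIso O).inv ≫ (Spec O).presheaf.germ ⊤ (p x) trivial) ≫ p.stalkMap x := by
  rw [Category.assoc]
  congr 1
  exact (Scheme.Hom.germ_stalkMap p ⊤ x trivial).symm

lemma formallySmooth_stalkMap_iff_of_closedPoint {O : Type u} [CommRing O] [IsLocalRing O]
    (p : X ⟶ Spec (.of O)) {x : X} (hx : p x = closedPoint O) :
    (p.stalkMap x).hom.FormallySmooth ↔
      ((Scheme.ΓSpecIso (.of O)).inv ≫ p.appTop ≫
        X.presheaf.germ ⊤ x trivial).hom.FormallySmooth := by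
  have := isIso_germ_closedPoint hx
  rw [ΓSpecIso_inv_comp_germ]
  exact (RingHom.FormallySmooth.respectsIso.cancel_left_isIso _ _).symm

lemma specialFiberIdeal_eq_span {O : Type u} [CommRing O] [IsLocalRing O] {π : O}
    (hπ : maximalIdeal O = Ideal.span {π}) (p : X ⟶ Spec (.of O)) (x : X) :
    specialFiberIdeal p x = Ideal.span {((Scheme.ΓSpecIso (.of O)).inv ≫ p.appTop ≫
        X.presheaf.germ ⊤ x trivial).hom π} := by
  rw [specialFiberIdeal, hπ, Ideal.map_span, Set.image_singleton]

/-- At a point of the special fiber where the total space is regular, smoothness means that the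
special fiber is not contained in the square of the maximal ideal. -/
lemma formallySmooth_stalkMap_iff_specialFiberIdeal {O : Type u} [CommRing O] [IsDomain O]
    [IsDiscreteValuationRing O] [PerfectField (ResidueField O)]
    (p : X ⟶ Spec (.of O)) [LocallyOfFiniteType p] {x : X} (hx : p x = closedPoint O)
    [IsRegularLocalRing (X.presheaf.stalk x)] :
    (p.stalkMap x).hom.FormallySmooth ↔
      ¬ specialFiberIdeal p x ≤ maximalIdeal (X.presheaf.stalk x) ^ 2 := by
  obtain ⟨π, hπ⟩ := IsDiscreteValuationRing.exists_irreducible O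
  have hπ := hπ.maximalIdeal_eq
  rw [formallySmooth_stalkMap_iff_of_closedPoint p hx, specialFiberIdeal_eq_span hπ,
    Ideal.span_singleton_le_iff_mem]
  obtain ⟨_, ⟨U, hU, rfl⟩, hxU, -⟩ := X.isBasis_affineOpens.exists_subset_of_mem_open
    (Set.mem_univ x) isOpen_univ
  have hU : IsAffineOpen U := hU
  obtain ⟨q, hq⟩ : x ∈ Set.range hU.fromSpec := by rwa [hU.range_fromSpec]
  obtain ⟨φ, hφ⟩ := Spec.map_surjective (hU.fromSpec ≫ p)
  have hft : φ.hom.FiniteType := by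
    rw [← HasRingHomProperty.Spec_iff (P := @LocallyOfFiniteType), hφ]
    infer_instance
  have hloc : IsLocalHom ((Scheme.ΓSpecIso (.of O)).inv ≫ p.appTop ≫
        X.presheaf.germ ⊤ x trivial).hom := by
    have := isIso_germ_closedPoint hx
    rw [ΓSpecIso_inv_comp_germ]
    have h1 : IsLocalHom ((Scheme.ΓSpecIso (.of O)).inv ≫
      (Spec (.of O)).presheaf.germ ⊤ (p x) trivial).hom := isLocalHom_of_isIso _
    exact RingHom.isLocalHom_comp (p.stalkMap x).hom _
  obtain ⟨κ, hκ, -, he⟩ := exists_stalkHom_comp hU.fromSpec hφ.symm q hq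
  rw [he] at hloc ⊢
  let : Algebra O Γ(X, U) := φ.hom.toAlgebra
  let : Algebra Γ(X, U) (X.presheaf.stalk x) := κ.hom.toAlgebra
  let : Algebra O (X.presheaf.stalk x) := (φ ≫ κ).hom.toAlgebra
  have : IsScalarTower O Γ(X, U) (X.presheaf.stalk x) := .of_algebraMap_eq fun _ ↦ rfl
  have : Algebra.FiniteType O Γ(X, U) := hft
  have : IsLocalization.AtPrime (X.presheaf.stalk x) q.asIdeal := hκ
  have : IsLocalHom (algebraMap O (X.presheaf.stalk x)) := hloc
  exact formallySmooth_localization_iff (A := Γ(X, U)) hπ q.asIdeal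

end SmoothLocus

/-! ### Monomials in parameters outside the square of the maximal ideal -/

section SncMultiplicity

variable {R : Type*} [CommRing R] [IsLocalRing R]

/-- Otherwise the remaining parameters would generate the maximal ideal by Nakayama, and would
therefore contain the given one in their ideal. -/
lemma IsParameterFamily.notMem_sq [IsNoetherianRing R] {ι : Type*} [Finite ι] {t : ι → R}
    (ht : IsParameterFamily t) (i : ι) : t i ∉ maximalIdeal R ^ 2 := by
  intro hi
  have h : maximalIdeal R ≤ Ideal.span (t '' {i}ᶜ) := by
    refine Submodule.le_of_le_smul_of_le_jacobson_bot (I := maximalIdeal R)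
      (IsNoetherian.noetherian _) (maximalIdeal_le_jacobson _) ?_
    rw [smul_eq_mul, ← pow_two]
    conv_lhs => rw [← ht.span_range]
    refine Ideal.span_le.mpr ?_
    rintro _ ⟨j, rfl⟩
    by_cases hj : j = i
    · subst hj; exact Ideal.mem_sup_right hi
    · exact Ideal.mem_sup_left (Ideal.subset_span ⟨j, hj, rfl⟩)
  refine ht.isPrimeFamily.notMem {i}ᶜ i (by simp) (h ?_)
  rw [← ht.span_range]
  exact Ideal.subset_span ⟨i, rfl⟩

/-- The monomial lies in the power of 𝔪 given by its degree, so outside 𝔪² it is a single parameter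
or 1. -/
lemma prod_pow_mem_sq_iff [IsNoetherianRing R] {ι : Type*} [Fintype ι] [DecidableEq ι] {t : ι → R}
    (ht : IsParameterFamily t) (a : ι → ℕ) :
    ∏ i, t i ^ a i ∉ maximalIdeal R ^ 2 ↔
      (Finset.univ.filter fun i ↦ a i ≠ 0).val.map a = {1} ∨ ∀ i, a i = 0 := by
  have htm (i : ι) : t i ∈ maximalIdeal R := by
    rw [← ht.span_range]; exact Ideal.subset_span ⟨i, rfl⟩
  have hmem : ∏ i, t i ^ a i ∈ maximalIdeal R ^ (∑ i, a i) := by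
    rw [← Finset.prod_pow_eq_pow_sum]
    exact Ideal.prod_mem_prod fun i _ ↦ Ideal.pow_mem_pow (htm i) _
  constructor
  · intro h
    have hsum : ∑ i, a i < 2 := by
      by_contra hge
      exact h (Ideal.pow_le_pow_right (not_lt.mp hge) hmem)
    have hsum' : ((Finset.univ.filter fun i ↦ a i ≠ 0).val.map a).sum = ∑ i, a i :=
      Finset.sum_filter_ne_zero _
    interval_cases h0 : ∑ i, a i
    · right
      simpa using h0
    · left
      have hcard := Multiset.card_nsmul_le_sum (s := (Finset.univ.filter fun i ↦ a i ≠ 0).val.map a)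
        (a := 1) fun x hx ↦ by
          obtain ⟨i, hi, rfl⟩ := Multiset.mem_map.mp hx
          exact Nat.one_le_iff_ne_zero.mpr (Finset.mem_filter.mp hi).2
      rw [hsum', smul_eq_mul, mul_one] at hcard
      rcases Nat.le_one_iff_eq_zero_or_eq_one.mp hcard with hc | hc
      · rw [Multiset.card_eq_zero.mp hc] at hsum'; simp at hsum'
      · obtain ⟨x, hx⟩ := Multiset.card_eq_one.mp hc
        rw [hx, Multiset.sum_singleton] at hsum'
        rw [hx, hsum']
  · rintro (h | h)
    · obtain ⟨i, hi, hai⟩ := Multiset.map_eq_singleton.mp h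
      have hi : (Finset.univ.filter fun i ↦ a i ≠ 0) = {i} := Finset.val_injective hi
      have hprod : ∏ j, t j ^ a j = t i := by
        rw [Finset.prod_eq_single i, hai, pow_one]
        · intro j _ hj
          have : a j = 0 := by
            by_contra h0
            exact hj (Finset.mem_singleton.mp (hi ▸ Finset.mem_filter.mpr ⟨Finset.mem_univ j, h0⟩))
          rw [this, pow_zero]
        · simp
      rw [hprod]
      exact ht.notMem_sq i
    · simp only [h, pow_zero, Finset.prod_const_one]
      exact fun h1 ↦ (Ideal.ne_top_iff_one _).mp
        (ne_top_of_le_ne_top Ideal.IsPrime.ne_top' (Ideal.pow_le_self two_ne_zero)) h1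

end SncMultiplicity

/-! ### Comparison with the motivic Serre invariant -/

namespace RegularSncModel

variable {O K : Type u} [CommRing O] [IsDomain O] [IsDiscreteValuationRing O]
  [PerfectField (ResidueField O)] [Field K] [Algebra O K]
  {X : Scheme.{u}} {f : X ⟶ Spec (CommRingCat.of K)}

/-- Smoothness means that the equation ∏ t_v^a_v of the special fiber is outside 𝔪², and the
multiplicities at the point are the nonzero exponents. -/
lemma specialFiberι_mem_smoothLocus_iff (𝒳 : RegularSncModel O f) (z : 𝒳.specialFiber.carrier) :
    𝒳.specialFiberι z ∈ 𝒳.hom.smoothLocus ↔ 𝒳.specialFiber.mults z = {1} := by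
  classical
  have hz := 𝒳.hom_specialFiberι z
  have hreg : IsRegularLocalRing (𝒳.carrier.presheaf.stalk (𝒳.specialFiberι z)) :=
    𝒳.isRegular.2 _
  rw [Scheme.Hom.mem_smoothLocus, formallySmooth_stalkMap_iff_specialFiberIdeal _ hz]
  obtain ⟨d, t, a, ht, hta⟩ := 𝒳.snc _ hz
  have ht := ht.isParameterFamily
  have hdom := ht.isDomain
  have hP := ht.isPrimeFamily
  have hprod : ∏ v ∈ Finset.univ.filter (fun v ↦ a v ≠ 0), t v ^ a v = ∏ v, t v ^ a v :=
    Finset.prod_subset (Finset.subset_univ _) fun v _ hv ↦ by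
      rw [show a v = 0 by simpa using hv, pow_zero]
  have hmults : 𝒳.specialFiber.mults z = (Finset.univ.filter fun v ↦ a v ≠ 0).val.map a :=
    AlgVar.mults_eq_of_stalk _ z (𝒳.specialFiberι.stalkMap z).hom
      (𝒳.specialFiberι.stalkMap_surjective z) _ t a (fun v hv ↦ (Finset.mem_filter.mp hv).2)
      (by rw [ker_stalkMap_specialFiberι, hta, hprod]) (fun v _ ↦ hP.prime v)
      fun v _ w _ hvw ↦ hP.eq_of_dvd hvw
  -- The monomial 1 is excluded, since its ideal would leave no local ring for the special fiber at
  -- z.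
  have hne : ¬ ∀ v, a v = 0 := fun h ↦ by
    have h1 : RingHom.ker (𝒳.specialFiberι.stalkMap z).hom = ⊤ := by
      rw [ker_stalkMap_specialFiberι, hta]
      simp [h]
    exact RingHom.ker_ne_top _ h1
  rw [hmults, hta, Ideal.span_singleton_le_iff_mem, prod_pow_mem_sq_iff ht]
  exact or_iff_left hne

lemma reduction_serreTilde (𝒳 : RegularSncModel O f) :
    reduction (ResidueField O) 𝒳.serreTilde = rationalization (ResidueField O) 𝒳.serre := by
  let U := 𝒳.specialFiberι ⁻¹ᵁ 𝒳.hom.smoothLocus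
  have h := AlgVar.setCls_range 𝒳.smoothSpecialFiber 𝒳.specialFiber U.ι
    (inferInstanceAs (IsImmersion U.ι)) rfl
  rw [serre, ← h]
  have hr : Set.range U.ι = (U : Set 𝒳.specialFiber.carrier) := U.range_ι
  refine AlgVar.reduction_serreTilde _ (S := Set.range U.ι) ?_ fun y ↦ ?_
  · rw [hr]; exact U.2.isLocallyClosed
  · rw [hr]; exact 𝒳.specialFiberι_mem_smoothLocus_iff y

end RegularSncModel

end MotivicSerre

end

/-! ### Conclusion along the chain of blowups -/

open MotivicSerre in
theorem theorem1p4
    {O K : Type u} [CommRing O] [IsDomain O] [IsDiscreteValuationRing O]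
    [IsAdicComplete (maximalIdeal O) O] [PerfectField (ResidueField O)]
    [Field K] [Algebra O K] [IsFractionRing O K]
    (X : Scheme.{u}) (f : X ⟶ Spec (CommRingCat.of K)) (hsmooth : Smooth f)
    (hproj : IsProjective f)
    -- desingularization
    (hdesing : Nonempty (RegularSncModel O f))
    -- weak factorization
    (hfact : ∀ 𝒳 𝒳' : RegularSncModel O f,
      Relation.ReflTransGen (fun 𝒜 ℬ ↦ 𝒜.IsBlowupOf ℬ ∨ ℬ.IsBlowupOf 𝒜) 𝒳 𝒳') :
    (∃! s : K0Q (ResidueField O) ⧸ idealLQ (ResidueField O) 2,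
      ∀ 𝒳 : RegularSncModel O f, 𝒳.serreTilde = s) ∧
    ∀ 𝒳 : RegularSncModel O f,
      reduction (ResidueField O) 𝒳.serreTilde = rationalization (ResidueField O) 𝒳.serre := by
  have hstep (𝒜 ℬ : RegularSncModel O f) (h : 𝒜.IsBlowupOf ℬ ∨ ℬ.IsBlowupOf 𝒜) :
      𝒜.serreTilde = ℬ.serreTilde :=
    h.elim (fun h ↦ RegularSncModel.serreTilde_eq_of_isBlowupOf h)
      fun h ↦ (RegularSncModel.serreTilde_eq_of_isBlowupOf h).symm
  have heq (𝒳 𝒳' : RegularSncModel O f) : 𝒳.serreTilde = 𝒳'.serreTilde := by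
    induction hfact 𝒳 𝒳' with
    | refl => rfl
    | tail _ h ih => exact ih.trans (hstep _ _ h)
  obtain ⟨𝒳₀⟩ := hdesing
  exact ⟨⟨𝒳₀.serreTilde, fun 𝒳 ↦ heq 𝒳 𝒳₀, fun s hs ↦ (hs 𝒳₀).symm⟩,
    fun 𝒳 ↦ 𝒳.reduction_serreTilde⟩
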